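/- Let $K$ be a finite extension of $\mathbb{Q}_p$ with ring of integers $R$, uniformizer $\pi$ and residue field $k$. Let $T_n^\dagger\subset R[[\xi_1,\dots,\xi_n]]$ be the ring of power series $\sum_v c_v\xi^v$ for which there is $\varepsilon>0$ with $|c_v|p^{\varepsilon|v|}\to 0$. A w.c.f.g. (weakly complete finitely generated) $R$-algebra is an $R$-algebra $A$ isomorphic to a quotient $T_n^\dagger/I$ for some $n\ge 0$; for $f\in A$ put $A\langle f^{-1}\rangle^\dagger=A\langle\xi\rangle^\dagger/(f\xi-1)$, where $A\langle\xi\rangle^\dagger=T_{n+1}^\dagger/I\,T_{n+1}^\dagger\subset A[[\xi]]$. Write $\bar f$ for the image of $f$ in $A\otimes_R k$. Let $\mathrm{Spf}^\dagger(A)$ be the locally ringed space with underlying space $X=\mathrm{Spec}(A\otimes_R k)$ and structure sheaf $\mathcal{O}^\dagger_A$ defined as follows: put $\mathcal{O}^\dagger_p=\varinjlim_{\bar f\notin p}A\langle f^{-1}\rangle^\dagger$ for $p\in X$, and let $\mathcal{O}^\dagger_A(U)$ be the ring of functions $s$ on $U$ with $s(p)\in\mathcal{O}^\dagger_p$ such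 that for each $p\in U$ there are $f\in A$ with $\bar f\notin p$ and $x\in A\langle f^{-1}\rangle^\dagger$ such that $s(q)$ is the image of $x$ for all $q\in X_{\bar f}\cap U$. Let $A,B$ be w.c.f.g. $R$-algebras. Say that a morphism $(\varphi,\varphi^\sharp):\mathrm{Spf}^\dagger(B)\to\mathrm{Spf}^\dagger(A)$ of locally ringed spaces is induced by a ring homomorphism $\rho:A\to B$ if, for all $f\in A$, $\varphi^{-1}(X_{\bar f})=Y_{\overline{\rho(f)}}$ (where $Y=\mathrm{Spec}(B\otimes_R k)$), the coefficientwise map $\sum_j a_j\xi^j\mapsto\sum_j\rho(a_j)\xi^j$ sends $A\langle\xi\rangle^\dagger$ into $B\langle\xi\rangle^\dagger$, and $\varphi^\sharp:\mathcal{O}_A^\dagger(X_{\bar f})\to\mathcal{O}_B^\dagger(Y_{\overline{\rho(f)}})$ is compatible with the resulting map $A\langle f^{-1}\rangle^\dagger\to B\langle\rho(f)^{-1}\rangle^\dagger$. (i) Every homomorphism of $R$-algebras $\rho:A\to B$ induces a unique morphism of locally ringed spaces $\mathrm{Spf}^\dagger(B)\to\mathrm{Spf}^\dagger(A)$. (ii)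 Every morphism of locally ringed spaces $\mathrm{Spf}^\dagger(B)\to\mathrm{Spf}^\dagger(A)$ is induced by a unique ring homomorphism $\rho:A\to B$. Moreover, a morphism is a morphism over $R$ (that is, its map on global sections is $R$-linear) if and only if it is induced by a homomorphism of $R$-algebras. -/

import Mathlib

universe u

namespace Dagger

open Filter Topology

section Analysis

variable (K : Type u) [NontriviallyNormedField K] [IsUltrametricDist K]

/-- The ring of integers `R = {c : K | ‖c‖ ≤ 1}` of a non-archimedean field `K`. -/
abbrev RInt : Type u := (NormedField.valuation (K := K)).valuationSubring

variable {K}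

theorem norm_le_one (c : RInt K) : ‖(c : K)‖ ≤ 1 := by
  have := c.2
  rw [Valuation.mem_valuationSubring_iff] at this
  exact this

/-- A family with finitely many indices of each bounded degree. -/
theorem tendsto_of_bdd {I : Type*} {d : I → ℕ} (hd : Tendsto d cofinite atTop)
    {c : I → RInt K} {r C : ℝ} (hr : 1 < r) (h : ∀ i, ‖(c i : K)‖ * r ^ d i ≤ C) :
    ∃ s : ℝ, 1 < s ∧ Tendsto (fun i => ‖(c i : K)‖ * s ^ d i) cofinite (𝓝 0) := by
  refine ⟨√r, Real.lt_sqrt_of_sq_lt (by simpa using hr), ?_⟩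
  have hs : 1 < √r := Real.lt_sqrt_of_sq_lt (by simpa using hr)
  have h0 : Tendsto (fun i => C * (√r)⁻¹ ^ d i) cofinite (𝓝 0) := by
    have := (tendsto_pow_atTop_nhds_zero_of_lt_one (r := (√r)⁻¹) (by positivity)
      (inv_lt_one_of_one_lt₀ hs)).comp hd
    simpa using this.const_mul C
  refine squeeze_zero (fun i => by positivity) (fun i => ?_) h0
  have : r ^ d i = √r ^ d i * √r ^ d i := by
    rw [← mul_pow, Real.mul_self_sqrt (by linarith)]
  have hp : 0 < √r ^ d i := by positivity
  calc ‖(c i : K)‖ * √r ^ d i = (‖(c i : K)‖ * r ^ d i) * (√r)⁻¹ ^ d i := by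
        rw [this, inv_pow]; field_simp
    _ ≤ C * (√r)⁻¹ ^ d i := by gcongr; exact h i

theorem bdd_of_tendsto {I : Type*} {f : I → ℝ} (h : Tendsto f cofinite (𝓝 0)) :
    ∃ C : ℝ, 0 < C ∧ ∀ i, f i ≤ C := by
  have hf : {i | ¬ f i < 1}.Finite := h.eventually (gt_mem_nhds one_pos)
  obtain ⟨M, hM⟩ := (hf.image f).bddAbove
  refine ⟨max M 1, by positivity, fun i => ?_⟩
  by_cases hi : f i < 1
  · exact hi.le.trans (le_max_right _ _)
  · exact (hM ⟨i, hi, rfl⟩).trans (le_max_left _ _)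

theorem shrink {I : Type*} {d : I → ℕ} {c : I → RInt K} {r D t : ℝ} (hr : 1 < r) (hD : 0 < D)
    (ht : 1 < t) (h : Tendsto (fun i => ‖(c i : K)‖ * r ^ d i) cofinite (𝓝 0))
    (hc : ∀ i, ‖(c i : K)‖ < D) :
    ∃ s : ℝ, 1 < s ∧ s ≤ r ∧ s ≤ t ∧ ∀ i, ‖(c i : K)‖ * s ^ d i ≤ D := by
  have hf : {i | ¬ ‖(c i : K)‖ * r ^ d i < D}.Finite := h.eventually (gt_mem_nhds hD)
  have h1 : ∀ᶠ s in 𝓝[>] (1 : ℝ), ∀ i ∈ {i | ¬ ‖(c i : K)‖ * r ^ d i < D},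
      ‖(c i : K)‖ * s ^ d i < D := by
    rw [hf.eventually_all]
    intro i _
    have : Tendsto (fun s : ℝ => ‖(c i : K)‖ * s ^ d i) (𝓝[>] 1) (𝓝 (‖(c i : K)‖ * 1 ^ d i)) :=
      ((continuous_const.mul (continuous_id.pow _)).tendsto 1).mono_left nhdsWithin_le_nhds
    exact this.eventually (gt_mem_nhds (by simpa using hc i))
  have h2 : ∀ᶠ s in 𝓝[>] (1 : ℝ), s < r :=
    nhdsWithin_le_nhds (gt_mem_nhds hr)
  have h3 : ∀ᶠ s in 𝓝[>] (1 : ℝ), s < t :=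
    nhdsWithin_le_nhds (gt_mem_nhds ht)
  obtain ⟨s, hs1, hs2, hs3, hs4⟩ := (h1.and (h2.and (h3.and self_mem_nhdsWithin))).exists
  refine ⟨s, hs4, hs2.le, hs3.le, fun i => ?_⟩
  have hs0 : (1 : ℝ) < s := hs4
  by_cases hi : ‖(c i : K)‖ * r ^ d i < D
  · refine le_trans ?_ hi.le
    gcongr
  · exact (hs1 i hi).le

/-- `‖G_v‖ r^{|v|} ≤ C` for all coefficients `G_v`. -/
def Bdd {n : ℕ} (C r : ℝ) (G : MvPowerSeries (Fin n) (RInt K)) : Prop :=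
  ∀ v, ‖((MvPowerSeries.coeff v G : RInt K) : K)‖ * r ^ v.degree ≤ C

section
variable {n : ℕ} {C D r s : ℝ} {G H : MvPowerSeries (Fin n) (RInt K)}

theorem Bdd.mono (h : Bdd C r G) (hCD : C ≤ D) (hs : 0 ≤ s) (hsr : s ≤ r) : Bdd D s G :=
  fun v => le_trans (by gcongr) ((h v).trans hCD)

theorem Bdd.sum {ι : Type*} {t : Finset ι} {F : ι → MvPowerSeries (Fin n) (RInt K)}
    (hC : 0 ≤ C) (hr : 0 < r) (h : ∀ i ∈ t, Bdd C r (F i)) : Bdd C r (∑ i ∈ t, F i) := by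
  intro v
  rw [map_sum, AddSubmonoidClass.coe_finsetSum, ← le_div_iff₀ (by positivity)]
  exact IsUltrametricDist.norm_sum_le_of_forall_le_of_nonneg (by positivity)
    fun i hi => (le_div_iff₀ (by positivity)).2 (h i hi v)

theorem Bdd.add (hr : 0 < r) (hG : Bdd C r G) (hH : Bdd C r H) : Bdd C r (G + H) := by
  intro v
  have h1 := hG v
  have h2 := hH v
  rw [← le_div_iff₀ (by positivity)] at h1 h2 ⊢
  rw [map_add]
  exact (IsUltrametricDist.norm_add_le_max _ _).trans (max_le h1 h2)

theorem Bdd.neg (hG : Bdd C r G) : Bdd C r (-G) := by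
  intro v
  have := hG v
  simpa using this

theorem Bdd.mul (hC : 0 ≤ C) (hD : 0 ≤ D) (hr : 0 < r) (hG : Bdd C r G) (hH : Bdd D r H) :
    Bdd (C * D) r (G * H) := by
  classical
  intro v
  rw [MvPowerSeries.coeff_mul, AddSubmonoidClass.coe_finsetSum, ← le_div_iff₀ (by positivity)]
  refine IsUltrametricDist.norm_sum_le_of_forall_le_of_nonneg (by positivity) fun i hi => ?_
  rw [le_div_iff₀ (by positivity), ← Finset.HasAntidiagonal.mem_antidiagonal.1 hi, map_add, pow_add]
  push_cast
  rw [norm_mul, mul_mul_mul_comm]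
  exact mul_le_mul (hG _) (hH _) (by positivity) hC

theorem bdd_C (a : RInt K) : Bdd 1 r (MvPowerSeries.C (σ := Fin n) a) := by
  classical
  intro v
  rw [MvPowerSeries.coeff_C]
  split_ifs with h
  · subst h; simpa using norm_le_one a
  · simp

theorem bdd_one : Bdd 1 r (1 : MvPowerSeries (Fin n) (RInt K)) := bdd_C 1

theorem Bdd.pow (hC : 0 ≤ C) (hr : 0 < r) (hG : Bdd C r G) (j : ℕ) : Bdd (C ^ j) r (G ^ j) := by
  induction j with
  | zero => simpa using bdd_one
  | succ j ih => rw [pow_succ, pow_succ]; exact ih.mul (by positivity) hC hr hG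

theorem norm_unit (u : (RInt K)ˣ) : ‖((u : RInt K) : K)‖ = 1 := by
  refine le_antisymm (norm_le_one _) ?_
  have h1 : ‖((u : RInt K) : K)‖ * ‖((u⁻¹ : (RInt K)ˣ) : K)‖ = 1 := by
    rw [← norm_mul]
    have : ((u : RInt K) : K) * ((u⁻¹ : (RInt K)ˣ) : RInt K) = ((u * u⁻¹ : (RInt K)ˣ) : RInt K) := by
      push_cast; rfl
    rw [this]; simp
  have h2 := norm_le_one ((u⁻¹ : (RInt K)ˣ) : RInt K)
  nlinarith [norm_nonneg ((u : RInt K) : K)]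

theorem isUnit_of_norm_eq {c : RInt K} (h : ‖(c : K)‖ = 1) : IsUnit c := by
  have hc : (c : K) ≠ 0 := by intro h0; simp [h0] at h
  refine isUnit_iff_exists_inv.2 ⟨⟨(c : K)⁻¹, ?_⟩, ?_⟩
  · rw [Valuation.mem_valuationSubring_iff]
    change ‖(c : K)⁻¹‖ ≤ 1
    rw [norm_inv, h, inv_one]
  · ext; exact mul_inv_cancel₀ hc

theorem norm_one_add {c : RInt K} (h : ‖(c : K)‖ < 1) : ‖((1 + c : RInt K) : K)‖ = 1 := by
  push_cast
  have := IsUltrametricDist.norm_add_eq_max_of_norm_ne_norm (x := (1 : K)) (y := (c : K))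
    (by rw [norm_one]; exact h.ne')
  rw [this, norm_one, max_eq_left h.le]

/-- The inverse of a power series with bounded coefficients and unit constant coefficient. -/
theorem Bdd.invOfUnit (hr : 0 < r) (hG : Bdd 1 r G) (u : (RInt K)ˣ) :
    Bdd 1 r (MvPowerSeries.invOfUnit G u) := by
  classical
  intro v
  induction v using WellFoundedLT.induction with
  | ind v ih =>
    rw [MvPowerSeries.coeff_invOfUnit]
    split_ifs with h
    · subst h; simpa using (norm_unit u⁻¹).le
    · push_cast
      rw [norm_mul, norm_neg, norm_unit, one_mul, ← le_div_iff₀ (by positivity)]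
      refine IsUltrametricDist.norm_sum_le_of_forall_le_of_nonneg (by positivity) fun i hi => ?_
      split_ifs with hlt
      · rw [le_div_iff₀ (by positivity)]
        conv_lhs => rw [← Finset.HasAntidiagonal.mem_antidiagonal.1 hi]
        rw [map_add, pow_add]
        push_cast
        rw [norm_mul, mul_mul_mul_comm]
        exact mul_le_one₀ (hG _) (by positivity) (ih _ hlt)
      · simp; positivity

end

theorem tendsto_degree (n : ℕ) :
    Tendsto (fun v : Fin n →₀ ℕ => v.degree) cofinite atTop := by
  refine tendsto_atTop.2 fun b => ?_
  refine (Finsupp.finite_of_degree_le (σ := Fin n) b).subset fun v hv => ?_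
  simp only [Set.mem_compl_iff, Set.mem_ofPred_eq, not_le] at hv ⊢
  exact hv.le

theorem tendsto_degree' (n : ℕ) :
    Tendsto (fun v : (Fin n →₀ ℕ) × ℕ => v.1.degree + v.2) cofinite atTop := by
  refine tendsto_atTop.2 fun b => ?_
  refine ((Finsupp.finite_of_degree_le (σ := Fin n) b).prod (Set.finite_Iic b)).subset fun v hv => ?_
  simp only [Set.mem_compl_iff, Set.mem_ofPred_eq, not_le, Set.mem_prod, Set.mem_Iic] at hv ⊢
  omega

variable (K) in
/-- The ring `T_n†` of overconvergent power series `∑ c_v ξ^v` over the ring of integers of `K`: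
those with `‖c_v‖ r^{|v|} → 0` for some `r > 1` (that is, `r = p^ε` with `ε > 0`). -/
def T (n : ℕ) : Subalgebra (RInt K) (MvPowerSeries (Fin n) (RInt K)) where
  carrier := {G | ∃ r : ℝ, 1 < r ∧
    Tendsto (fun v => ‖((MvPowerSeries.coeff v G : RInt K) : K)‖ * r ^ v.degree) cofinite (𝓝 0)}
  mul_mem' := by
    rintro G H ⟨r, hr, hG⟩ ⟨s, hs, hH⟩
    obtain ⟨C, hC, hG⟩ := bdd_of_tendsto hG
    obtain ⟨D, hD, hH⟩ := bdd_of_tendsto hH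
    have hm : 1 < min r s := lt_min hr hs
    exact tendsto_of_bdd (tendsto_degree n) hm
      (Bdd.mul hC.le hD.le (by positivity)
        (Bdd.mono (G := G) hG le_rfl (by positivity) (min_le_left _ _))
        (Bdd.mono (G := H) hH le_rfl (by positivity) (min_le_right _ _)))
  add_mem' := by
    rintro G H ⟨r, hr, hG⟩ ⟨s, hs, hH⟩
    obtain ⟨C, hC, hG⟩ := bdd_of_tendsto hG
    obtain ⟨D, hD, hH⟩ := bdd_of_tendsto hH
    have hm : 1 < min r s := lt_min hr hs
    exact tendsto_of_bdd (tendsto_degree n) hm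
      (Bdd.add (C := max C D) (by positivity)
        (Bdd.mono (G := G) hG (le_max_left _ _) (by positivity) (min_le_left _ _))
        (Bdd.mono (G := H) hH (le_max_right _ _) (by positivity) (min_le_right _ _)))
  algebraMap_mem' a := tendsto_of_bdd (tendsto_degree n) (r := 2) one_lt_two (bdd_C a)

theorem mem_T_of_bdd {n : ℕ} {C r : ℝ} (hr : 1 < r) {G : MvPowerSeries (Fin n) (RInt K)}
    (h : Bdd C r G) : G ∈ T K n := tendsto_of_bdd (tendsto_degree n) hr h

/-- `‖G_{v,j}‖ r^{|v|+j} ≤ C` for all coefficients. -/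
def PBdd {n : ℕ} (C r : ℝ) (G : PowerSeries (T K n)) : Prop :=
  ∀ j, Bdd (C * r⁻¹ ^ j) r (PowerSeries.coeff j G : T K n).1

section
variable {n : ℕ} {C D r s : ℝ} {G H : PowerSeries (T K n)}

theorem pbdd_iff (hr : 0 < r) : PBdd C r G ↔ ∀ vj : (Fin n →₀ ℕ) × ℕ,
    ‖((MvPowerSeries.coeff vj.1 (PowerSeries.coeff vj.2 G : T K n).1 : RInt K) : K)‖
      * r ^ (vj.1.degree + vj.2) ≤ C := by
  have key : ∀ (x : ℝ) (j k : ℕ), x * r ^ k ≤ C * r⁻¹ ^ j ↔ x * r ^ (k + j) ≤ C := by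
    intro x j k
    rw [pow_add, ← mul_assoc, inv_pow, ← div_eq_mul_inv, le_div_iff₀ (by positivity)]
  exact ⟨fun h vj => (key _ _ _).1 (h _ _), fun h j v => (key _ _ _).2 (h (v, j))⟩

theorem PBdd.mono (h : PBdd C r G) (hC : 0 ≤ C) (hCD : C ≤ D) (hs : 0 < s) (hsr : s ≤ r) :
    PBdd D s G := by
  intro j
  refine (h j).mono ?_ hs.le hsr
  have : r⁻¹ ≤ s⁻¹ := inv_anti₀ hs hsr
  have : 0 < r := hs.trans_le hsr
  have : 0 ≤ D := hC.trans hCD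
  gcongr

theorem PBdd.add (hr : 0 < r) (hG : PBdd C r G) (hH : PBdd C r H) : PBdd C r (G + H) := by
  intro j
  rw [map_add]
  exact (hG j).add hr (hH j)

theorem PBdd.neg (hG : PBdd C r G) : PBdd C r (-G) := by
  intro j
  rw [map_neg]
  exact (hG j).neg

theorem PBdd.mul (hC : 0 ≤ C) (hD : 0 ≤ D) (hr : 0 < r) (hG : PBdd C r G) (hH : PBdd D r H) :
    PBdd (C * D) r (G * H) := by
  intro j
  rw [PowerSeries.coeff_mul, AddSubmonoidClass.coe_finsetSum]
  refine Bdd.sum (by positivity) hr fun i hi => ?_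
  rw [← Finset.HasAntidiagonal.mem_antidiagonal.1 hi, pow_add, mul_mul_mul_comm]
  exact (hG _).mul (by positivity) (by positivity) hr (hH _)

theorem pbdd_C (hC : 0 ≤ C) (hr : 0 < r) (g : T K n) (hg : Bdd C r g.1) :
    PBdd C r (PowerSeries.C g) := by
  intro j
  rw [PowerSeries.coeff_C]
  split_ifs with h
  · subst h; simpa using hg
  · intro v; simp; positivity

end

variable (K) in
/-- `T_{n+1}†`, its elements written as power series `∑_j G_j ξ^j` in the last variable with
coefficients `G_j` in `T_n†`. -/
def TSucc (n : ℕ) : Subring (PowerSeries (T K n)) where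
  carrier := {G | ∃ r : ℝ, 1 < r ∧ Tendsto (fun vj : (Fin n →₀ ℕ) × ℕ =>
    ‖((MvPowerSeries.coeff vj.1 (PowerSeries.coeff vj.2 G : T K n).1 : RInt K) : K)‖
      * r ^ (vj.1.degree + vj.2)) cofinite (𝓝 0)}
  mul_mem' := by
    rintro G H ⟨r, hr, hG⟩ ⟨s, hs, hH⟩
    obtain ⟨C, hC, hG⟩ := bdd_of_tendsto hG
    obtain ⟨D, hD, hH⟩ := bdd_of_tendsto hH
    have hm : 1 < min r s := lt_min hr hs
    have hm0 : 0 < min r s := by positivity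
    exact tendsto_of_bdd (tendsto_degree' n) hm ((pbdd_iff hm0).1
      (PBdd.mul hC.le hD.le hm0
        (((pbdd_iff (by positivity)).2 hG).mono hC.le le_rfl hm0 (min_le_left _ _))
        (((pbdd_iff (by positivity)).2 hH).mono hD.le le_rfl hm0 (min_le_right _ _))))
  add_mem' := by
    rintro G H ⟨r, hr, hG⟩ ⟨s, hs, hH⟩
    obtain ⟨C, hC, hG⟩ := bdd_of_tendsto hG
    obtain ⟨D, hD, hH⟩ := bdd_of_tendsto hH
    have hm : 1 < min r s := lt_min hr hs
    have hm0 : 0 < min r s := by positivity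
    exact tendsto_of_bdd (tendsto_degree' n) hm ((pbdd_iff hm0).1
      (PBdd.add (C := max C D) hm0
        (((pbdd_iff (by positivity)).2 hG).mono hC.le (le_max_left _ _) hm0 (min_le_left _ _))
        (((pbdd_iff (by positivity)).2 hH).mono hD.le (le_max_right _ _) hm0 (min_le_right _ _))))
  neg_mem' := by
    rintro G ⟨r, hr, hG⟩
    exact ⟨r, hr, by simpa using hG⟩
  zero_mem' := ⟨2, one_lt_two, by simp⟩
  one_mem' := tendsto_of_bdd (tendsto_degree' n) one_lt_two ((pbdd_iff two_pos).1
      (pbdd_C zero_le_one two_pos 1 bdd_one))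

section
variable {n : ℕ}

theorem mem_TSucc_of_pbdd {C r : ℝ} {G : PowerSeries (T K n)} (hr : 1 < r) (h : PBdd C r G) :
    G ∈ TSucc K n :=
  tendsto_of_bdd (tendsto_degree' n) hr ((pbdd_iff (by positivity)).1 h)

theorem exists_pbdd {G : PowerSeries (T K n)} (h : G ∈ TSucc K n) :
    ∃ C r : ℝ, 0 < C ∧ 1 < r ∧ PBdd C r G := by
  obtain ⟨r, hr, h⟩ := h
  obtain ⟨C, hC, h⟩ := bdd_of_tendsto h
  exact ⟨C, r, hC, hr, (pbdd_iff (by positivity)).2 h⟩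

theorem C_mem_TSucc (g : T K n) : PowerSeries.C g ∈ TSucc K n := by
  obtain ⟨r, hr, h⟩ := g.2
  obtain ⟨C, hC, h⟩ := bdd_of_tendsto h
  exact mem_TSucc_of_pbdd hr (pbdd_C hC.le (by positivity) g h)

theorem X_mem_TSucc : (PowerSeries.X : PowerSeries (T K n)) ∈ TSucc K n := by
  refine mem_TSucc_of_pbdd (r := 2) (C := 2) one_lt_two fun j => ?_
  rw [PowerSeries.coeff_X]
  split_ifs with h
  · subst h
    exact Bdd.mono (C := 1) (r := 2) bdd_one (by norm_num) (by norm_num) le_rfl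
  · intro v; simp

theorem rescale_mem_TSucc (g : T K n) {G : PowerSeries (T K n)} (h : G ∈ TSucc K n) :
    PowerSeries.rescale g G ∈ TSucc K n := by
  obtain ⟨C, r, hC, hr, hG⟩ := exists_pbdd h
  obtain ⟨t, ht, hg⟩ := g.2
  have hsr : 1 < √r := Real.lt_sqrt_of_sq_lt (by simpa using hr)
  obtain ⟨s, hs, hst, hsr', hb⟩ := shrink (D := √r) ht (by positivity) hsr hg
    fun v => (norm_le_one _).trans_lt hsr
  have hs0 : 0 < s := by positivity
  have hsqr : √r ≤ r := by
    rw [Real.sqrt_le_left (by linarith)]; nlinarith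
  refine mem_TSucc_of_pbdd (r := s) (C := C) hs fun j => ?_
  rw [PowerSeries.coeff_rescale]
  have h1 : Bdd (√r ^ j) s ((g : MvPowerSeries (Fin n) (RInt K)) ^ j) :=
    Bdd.pow (by positivity) hs0 hb j
  have h2 := (hG j).mono le_rfl hs0.le (hsr'.trans hsqr)
  have h3 := h1.mul (by positivity) (by positivity) hs0 h2
  refine h3.mono ?_ hs0.le le_rfl
  have : √r ^ j * (C * r⁻¹ ^ j) = C * (√r)⁻¹ ^ j := by
    have : r ^ j = √r ^ j * √r ^ j := by
      rw [← mul_pow, Real.mul_self_sqrt (by linarith)]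
    rw [inv_pow, inv_pow, this]
    have hp : 0 < √r ^ j := by positivity
    field_simp
  rw [this]
  have : (√r)⁻¹ ≤ s⁻¹ := inv_anti₀ hs0 hsr'
  gcongr

theorem isUnit_T {g : T K n} {s : ℝ} (hs : 1 < s) (hb : Bdd 1 s g.1)
    (h0 : ‖((MvPowerSeries.constantCoeff g.1 : RInt K) : K)‖ < 1) :
    ∃ g' : T K n, (1 + g) * g' = 1 ∧ Bdd 1 s g'.1 := by
  obtain ⟨u, hu⟩ := isUnit_of_norm_eq (norm_one_add h0)
  have h1 : Bdd 1 s (1 + g.1) := bdd_one.add (by positivity) hb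
  have h2 := h1.invOfUnit (by positivity) u
  refine ⟨⟨_, mem_T_of_bdd hs h2⟩, ?_, h2⟩
  ext1
  exact MvPowerSeries.mul_invOfUnit _ u (by simp [hu])

theorem isUnit_TSucc {G : PowerSeries (T K n)} (hG : G ∈ TSucc K n)
    (h : ∀ j v, ‖((MvPowerSeries.coeff v (PowerSeries.coeff j G : T K n).1 : RInt K) : K)‖ < 1) :
    ∃ H ∈ TSucc K n, (1 + G) * H = 1 := by
  obtain ⟨r, hr, hG⟩ := hG
  obtain ⟨s, hs, hsr, -, hb⟩ := shrink hr one_pos hr hG fun vj => h _ _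
  have hs0 : 0 < s := by positivity
  replace hb : PBdd 1 s G := (pbdd_iff hs0).2 hb
  obtain ⟨u, hu, hub⟩ := isUnit_T (g := PowerSeries.coeff 0 G) hs (by simpa using hb 0)
    (h 0 0)
  let U : (T K n)ˣ := ⟨_, u, hu, by rw [mul_comm, hu]⟩
  have h1 : PBdd 1 s (1 + G) :=
    (pbdd_C zero_le_one hs0 1 bdd_one).add hs0 hb
  refine ⟨PowerSeries.invOfUnit (1 + G) U, mem_TSucc_of_pbdd (C := 1) hs fun j => ?_,
    PowerSeries.mul_invOfUnit _ U (by simp [U])⟩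
  induction j using Nat.strong_induction_on with
  | _ j ih =>
    rw [PowerSeries.coeff_invOfUnit]
    split_ifs with hj
    · subst hj; simpa [U] using hub
    · have key : Bdd (1 * s⁻¹ ^ j) s (∑ x ∈ Finset.HasAntidiagonal.antidiagonal j,
          ((if x.2 < j then PowerSeries.coeff x.1 (1 + G) *
            PowerSeries.coeff x.2 (PowerSeries.invOfUnit (1 + G) U) else 0 : T K n) :
            MvPowerSeries (Fin n) (RInt K))) := by
        refine Bdd.sum (by positivity) hs0 fun i hi => ?_
        split_ifs with hlt
        · have := (h1 i.1).mul (by positivity) (by positivity) hs0 (ih _ hlt)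
          rwa [mul_mul_mul_comm, one_mul, ← pow_add, Finset.HasAntidiagonal.mem_antidiagonal.1 hi] at this
        · intro v; simp; positivity
      have := (hub.mul zero_le_one (by positivity) hs0 key).neg
      rw [one_mul] at this
      convert this using 1
      rw [← neg_mul]
      push_cast
      rfl

end

end Analysis


open AlgebraicGeometry CategoryTheory TopologicalSpace Opposite TensorProduct

/-- A presentation `A = T_n† / I` of an `R`-algebra `A` as a homomorphic image of some `T_n†`.
A weakly complete finitely generated (w.c.f.g.) algebra is an algebra that has one. -/
structure Presentation (K : Type u) [NontriviallyNormedField K] [IsUltrametricDist K]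
    (A : Type u) [CommRing A] [Algebra (RInt K) A] where
  /-- the number of variables -/
  n : ℕ
  /-- the homomorphism from `T_n†` onto `A` -/
  φ : T K n →ₐ[RInt K] A
  surjective : Function.Surjective φ

noncomputable section

section Reduction

variable (K : Type u) [NontriviallyNormedField K] [IsUltrametricDist K]
  (A : Type u) [CommRing A] [Algebra (RInt K) A]

/-- The reduction `A ⊗_R k`, where `k` is the residue field of `R`. -/
abbrev Red : Type u := A ⊗[RInt K] IsLocalRing.ResidueField (RInt K)

variable {A}

/-- The reduction map `f ↦ f ⊗ 1` from `A` to `A ⊗_R k`. -/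
def red : A →+* Red K A := Algebra.TensorProduct.includeLeftRingHom

theorem red_surjective : Function.Surjective (red K : A →+* Red K A) := by
  intro x
  induction x using TensorProduct.induction_on with
  | zero => exact ⟨0, map_zero _⟩
  | tmul a c =>
    obtain ⟨c, rfl⟩ := IsLocalRing.residue_surjective c
    refine ⟨c • a, ?_⟩
    change (c • a) ⊗ₜ[RInt K] (1 : IsLocalRing.ResidueField (RInt K)) = _
    rw [TensorProduct.smul_tmul]
    congr 1
    rw [Algebra.smul_def, mul_one]
    rfl
  | add x y hx hy =>
    obtain ⟨a, rfl⟩ := hx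
    obtain ⟨b, rfl⟩ := hy
    exact ⟨a + b, map_add _ _ _⟩

variable {K} in
theorem red_algebraMap {c : RInt K} (hc : ‖(c : K)‖ < 1) :
    red K (algebraMap (RInt K) A c) = 0 := by
  have h1 : IsLocalRing.residue (RInt K) c = 0 := by
    rw [IsLocalRing.residue_eq_zero_iff, IsLocalRing.mem_maximalIdeal, mem_nonunits_iff]
    rintro ⟨u, rfl⟩
    exact hc.ne (norm_unit u)
  change (algebraMap (RInt K) A c) ⊗ₜ[RInt K] (1 : IsLocalRing.ResidueField (RInt K)) = 0
  rw [Algebra.algebraMap_eq_smul_one, TensorProduct.smul_tmul, Algebra.smul_def, mul_one]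
  change _ ⊗ₜ[RInt K] IsLocalRing.residue (RInt K) c = 0
  rw [h1, TensorProduct.tmul_zero]

end Reduction

namespace Presentation

variable {K : Type u} [NontriviallyNormedField K] [IsUltrametricDist K]
  {A : Type u} [CommRing A] [Algebra (RInt K) A] (P : Presentation K A)

/-- For `A = T_n† / I`, the ring `A⟨ξ⟩†`: the subring of `A⟦ξ⟧` of the images `∑_j φ(G_j) ξ^j` of
the elements `∑_j G_j ξ^j` of `T_{n+1}†`. -/
def Over : Subring (PowerSeries A) :=
  (TSucc K P.n).map (PowerSeries.map (P.φ : T K P.n →+* A))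

theorem C_mem (a : A) : PowerSeries.C a ∈ P.Over := by
  obtain ⟨g, rfl⟩ := P.surjective a
  exact ⟨PowerSeries.C g, C_mem_TSucc g, by simp⟩

theorem X_mem : PowerSeries.X ∈ P.Over := ⟨PowerSeries.X, X_mem_TSucc, by simp⟩

/-- Constants in `A⟨ξ⟩†`. -/
def C : A →+* P.Over := PowerSeries.C.codRestrict _ P.C_mem

/-- The variable `ξ` of `A⟨ξ⟩†`. -/
def X : P.Over := ⟨PowerSeries.X, P.X_mem⟩

/-- `A⟨f⁻¹⟩† = A⟨ξ⟩† / (f ξ - 1)`. -/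
abbrev Loc (f : A) : Type u := P.Over ⧸ Ideal.span {P.C f * P.X - 1}

/-- The projection from `A⟨ξ⟩†` to `A⟨f⁻¹⟩†`, which sends `ξ` to `f⁻¹`. -/
abbrev proj (f : A) : P.Over →+* P.Loc f := Ideal.Quotient.mk _

theorem proj_C_mul_X (f : A) : P.proj f (P.C f) * P.proj f P.X = 1 := by
  rw [← map_mul, ← map_one (P.proj f), Ideal.Quotient.mk_eq_mk_iff_sub_mem]
  exact Ideal.subset_span rfl

theorem rescale_mem (c : A) {g : PowerSeries A} (h : g ∈ P.Over) :
    PowerSeries.rescale c g ∈ P.Over := by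
  obtain ⟨γ, rfl⟩ := P.surjective c
  obtain ⟨G, hG, rfl⟩ := h
  refine ⟨PowerSeries.rescale γ G, rescale_mem_TSucc γ hG, ?_⟩
  ext j
  simp

/-- The endomorphism `ξ ↦ c ξ` of `A⟨ξ⟩†`. -/
def scale (c : A) : P.Over →+* P.Over :=
  ((PowerSeries.rescale c).comp P.Over.subtype).codRestrict _ fun g => P.rescale_mem c g.2

theorem scale_C (c a : A) : P.scale c (P.C a) = P.C a := by
  ext1
  change PowerSeries.rescale c (PowerSeries.C a) = PowerSeries.C a
  ext j
  rw [PowerSeries.coeff_rescale, PowerSeries.coeff_C]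
  split_ifs with h <;> simp [h]

theorem scale_X (c : A) : P.scale c P.X = P.C c * P.X := by
  ext1
  exact PowerSeries.rescale_X c

/-- If `g = f c`, the canonical map from `A⟨f⁻¹⟩†` to `A⟨g⁻¹⟩†`, sending `f⁻¹` to `c g⁻¹`. -/
def trans {f g : A} (c : A) (h : g = f * c) : P.Loc f →+* P.Loc g :=
  Ideal.Quotient.lift _ ((P.proj g).comp (P.scale c)) fun a ha => by
    rw [← RingHom.mem_ker]
    revert a
    change Ideal.span {P.C f * P.X - 1} ≤ _
    rw [Ideal.span_singleton_le_iff_mem, RingHom.mem_ker, map_sub, map_one, RingHom.comp_apply,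
      map_mul, scale_C, scale_X, ← mul_assoc, ← map_mul, ← h, map_mul, proj_C_mul_X, sub_self]

@[simp]
theorem trans_proj {f g : A} (c : A) (h : g = f * c) (x : P.Over) :
    P.trans c h (P.proj f x) = P.proj g (P.scale c x) := rfl

/-- The canonical map does not depend on the cofactor. -/
theorem trans_congr {f g : A} (c c' : A) (h : g = f * c) (h' : g = f * c') :
    P.trans c h = P.trans c' h' := by
  refine Ideal.Quotient.ringHom_ext (RingHom.ext fun x => ?_)
  change P.proj g (P.scale c x) = P.proj g (P.scale c' x)
  rw [Ideal.Quotient.mk_eq_mk_iff_sub_mem]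
  have key : P.C g * (P.scale c x - P.scale c' x) = 0 := by
    ext1
    change PowerSeries.C g * (PowerSeries.rescale c x.1 - PowerSeries.rescale c' x.1) = 0
    ext j
    simp only [PowerSeries.coeff_C_mul, map_sub, PowerSeries.coeff_rescale, map_zero]
    rw [← sub_mul]
    rcases j with _ | j
    · simp
    · obtain ⟨d, hd⟩ := sub_dvd_pow_sub_pow c c' (j + 1)
      rw [hd]
      have : f * (c - c') = 0 := by rw [mul_sub, ← h, ← h', sub_self]
      calc g * ((c - c') * d * PowerSeries.coeff (j + 1) x.1) =
            c * (f * (c - c')) * d * PowerSeries.coeff (j + 1) x.1 := by rw [h]; ring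
        _ = 0 := by rw [this]; ring
  have : P.scale c x - P.scale c' x =
      -(P.scale c x - P.scale c' x) * (P.C g * P.X - 1) := by
    linear_combination P.X * key
  rw [this]
  exact Ideal.mul_mem_left _ _ (Ideal.subset_span rfl)

theorem scale_one (x : P.Over) : P.scale 1 x = x := by
  ext1
  change PowerSeries.rescale (1 : A) x.1 = x.1
  simp

theorem scale_scale (c d : A) (x : P.Over) : P.scale d (P.scale c x) = P.scale (c * d) x := by
  ext1
  change PowerSeries.rescale d (PowerSeries.rescale c x.1) = PowerSeries.rescale (c * d) x.1
  rw [PowerSeries.rescale_rescale]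

/-- The underlying space of `Spf†(A)`: the prime spectrum of `A ⊗_R k`. -/
abbrev Pt (_ : Presentation K A) : TopCat.{u} := TopCat.of (PrimeSpectrum (Red K A))

/-- The basic open set `X_f̄`. -/
def basic (f : A) : Opens P.Pt := PrimeSpectrum.basicOpen (red K f)

/-- The elements `f` of `A` with `f̄ ∉ p`, preordered by divisibility. -/
def Index (p : P.Pt) : Type u := {f : A // p ∈ P.basic f}

instance (p : P.Pt) : Preorder (P.Index p) where
  le f g := f.1 ∣ g.1
  le_refl f := dvd_rfl
  le_trans _ _ _ := dvd_trans

theorem mem_basic_mul {p : P.Pt} {f g : A} : p ∈ P.basic (f * g) ↔ p ∈ P.basic f ∧ p ∈ P.basic g := by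
  simp only [basic, map_mul]
  rw [PrimeSpectrum.basicOpen_mul]
  rfl

theorem mem_basic_one (p : P.Pt) : p ∈ P.basic 1 := by
  simp [basic]

instance (p : P.Pt) : Nonempty (P.Index p) := ⟨⟨1, P.mem_basic_one p⟩⟩

instance (p : P.Pt) : IsDirectedOrder (P.Index p) where
  directed f g := ⟨⟨f.1 * g.1, P.mem_basic_mul.2 ⟨f.2, g.2⟩⟩, dvd_mul_right _ _, dvd_mul_left _ _⟩

/-- The transition map from `A⟨f⁻¹⟩†` to `A⟨g⁻¹⟩†` for `f ∣ g`. -/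
def tr (p : P.Pt) (f g : P.Index p) (h : f ≤ g) : P.Loc f.1 →+* P.Loc g.1 :=
  P.trans h.choose h.choose_spec

theorem tr_eq (p : P.Pt) (f g : P.Index p) (h : f ≤ g) (c : A) (hc : g.1 = f.1 * c) :
    P.tr p f g h = P.trans c hc := P.trans_congr _ _ _ _

instance (p : P.Pt) : DirectedSystem (fun f : P.Index p => P.Loc f.1) (P.tr p · · ·) where
  map_self f x := by
    rw [P.tr_eq p f f le_rfl 1 (mul_one _).symm]
    obtain ⟨x, rfl⟩ := Ideal.Quotient.mk_surjective x
    change P.proj f.1 _ = P.proj f.1 _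
    rw [scale_one]
  map_map := by
    rintro h g f ⟨c, hc⟩ ⟨d, hd⟩ x
    rw [P.tr_eq p f g _ c hc, P.tr_eq p g h _ d hd,
      P.tr_eq p f h _ (c * d) (by rw [hd, hc, mul_assoc])]
    obtain ⟨x, rfl⟩ := Ideal.Quotient.mk_surjective x
    change P.proj h.1 _ = P.proj h.1 _
    rw [scale_scale]

/-- `O†_p`, the direct limit of the `A⟨f⁻¹⟩†` over the `f` with `f̄ ∉ p`. -/
def Stalk (p : P.Pt) : Type u := DirectLimit (fun f : P.Index p => P.Loc f.1) (P.tr p)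

instance (p : P.Pt) : CommRing (P.Stalk p) :=
  inferInstanceAs (CommRing (DirectLimit (fun f : P.Index p => P.Loc f.1) (P.tr p)))

/-- The canonical map from `A⟨f⁻¹⟩†` to `O†_p`, for `f̄ ∉ p`. -/
def germ (f : A) (p : P.Pt) (h : p ∈ P.basic f) : P.Loc f →+* P.Stalk p :=
  DirectLimit.Ring.of (fun f : P.Index p => P.Loc f.1) (P.tr p) ⟨f, h⟩

theorem germ_trans {f g : A} (c : A) (h : g = f * c) (p : P.Pt) (hf : p ∈ P.basic f)
    (hg : p ∈ P.basic g) (x : P.Loc f) : P.germ g p hg (P.trans c h x) = P.germ f p hf x := by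
  have hle : @LE.le (P.Index p) _ ⟨f, hf⟩ ⟨g, hg⟩ := ⟨c, h⟩
  rw [← P.tr_eq p ⟨f, hf⟩ ⟨g, hg⟩ hle c h]
  exact DirectLimit.mk_apply (f := P.tr p) (⟨f, hf⟩ : P.Index p) ⟨g, hg⟩ x hle

theorem exists_germ (p : P.Pt) (s : P.Stalk p) : ∃ f h x, P.germ f p h x = s := by
  obtain ⟨f, x, rfl⟩ := DirectLimit.exists_eq_mk (P.tr p) s
  exact ⟨f.1, f.2, x, rfl⟩

theorem germ_eq_iff {f : A} {p : P.Pt} (h : p ∈ P.basic f) (x y : P.Loc f) :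
    P.germ f p h x = P.germ f p h y ↔
      ∃ c, p ∈ P.basic (f * c) ∧ P.trans c rfl x = P.trans (g := f * c) c rfl y := by
  constructor
  · intro he
    obtain ⟨g, hx, hy, e⟩ := Quotient.exact he
    change P.tr p ⟨f, h⟩ g hx x = P.tr p ⟨f, h⟩ g hx y at e
    obtain ⟨g, hg⟩ := g
    obtain ⟨c, hc⟩ := hx
    change g = f * c at hc
    subst hc
    rw [P.tr_eq p ⟨f, h⟩ ⟨f * c, hg⟩ _ c rfl] at e
    exact ⟨c, hg, e⟩
  · rintro ⟨c, hc, e⟩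
    rw [← P.germ_trans c rfl p h hc, e, P.germ_trans c rfl p h hc]

/-! ### The stalks are local rings -/

theorem exists_small : ∃ c : RInt K, c ≠ 0 ∧ ‖(c : K)‖ < 1 := by
  obtain ⟨x, hx0, hx1⟩ := NormedField.exists_norm_lt_one K
  refine ⟨⟨x, ?_⟩, ?_, hx1⟩
  · rw [Valuation.mem_valuationSubring_iff]
    exact hx1.le
  · intro h
    have : x = 0 := congrArg Subtype.val h
    simp [this] at hx0

theorem eventually_small {n : ℕ} {G : PowerSeries (T K n)} (hG : G ∈ TSucc K n) {c : RInt K}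
    (hc : c ≠ 0) : ∃ N : ℕ, ∀ j, N ≤ j → ∃ g : T K n, PowerSeries.coeff j G = c • g := by
  obtain ⟨C, r, hC, hr, hb⟩ := exists_pbdd hG
  have hc0 : (0 : ℝ) < ‖(c : K)‖ := norm_pos_iff.2 (by simpa using hc)
  have ht : Tendsto (fun j : ℕ => C * r⁻¹ ^ j) atTop (𝓝 0) := by
    simpa using (tendsto_pow_atTop_nhds_zero_of_lt_one (r := r⁻¹) (by positivity)
      (inv_lt_one_of_one_lt₀ hr)).const_mul C
  obtain ⟨N, hN⟩ := eventually_atTop.1 (ht.eventually (gt_mem_nhds hc0))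
  refine ⟨N, fun j hj => ?_⟩
  have h1 : Bdd ‖(c : K)‖ r (PowerSeries.coeff j G : T K n).1 :=
    (hb j).mono (hN j hj).le (by positivity) le_rfl
  have h2 : ∀ v, ‖((MvPowerSeries.coeff v (PowerSeries.coeff j G : T K n).1 : RInt K) : K) /
      (c : K)‖ * r ^ v.degree ≤ 1 := by
    intro v
    rw [norm_div, div_mul_eq_mul_div, div_le_one hc0]
    exact h1 v
  have h3 : ∀ v, ((MvPowerSeries.coeff v (PowerSeries.coeff j G : T K n).1 : RInt K) : K) /
      (c : K) ∈ (NormedField.valuation (K := K)).valuationSubring := by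
    intro v
    rw [Valuation.mem_valuationSubring_iff]
    change ‖_‖ ≤ (1 : ℝ)
    refine le_trans ?_ (h2 v)
    exact le_mul_of_one_le_right (norm_nonneg _) (one_le_pow₀ hr.le)
  let g : MvPowerSeries (Fin n) (RInt K) := fun v => ⟨_, h3 v⟩
  refine ⟨⟨g, mem_T_of_bdd (C := 1) hr h2⟩, ?_⟩
  ext v
  change _ = (((c • (⟨_, h3 v⟩ : RInt K)) : RInt K) : K)
  rw [smul_eq_mul]
  push_cast
  rw [mul_div_cancel₀ _ (by simpa using hc)]

theorem red_coeff (g : P.Over) : ∃ N : ℕ, ∀ j, N ≤ j → red K (PowerSeries.coeff j g.1) = 0 := by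
  obtain ⟨G, hG, hg⟩ := g.2
  obtain ⟨c, hc0, hc1⟩ := exists_small (K := K)
  obtain ⟨N, hN⟩ := eventually_small hG hc0
  refine ⟨N, fun j hj => ?_⟩
  obtain ⟨x, hx⟩ := hN j hj
  rw [← hg, PowerSeries.coeff_map, hx]
  change red K (P.φ (c • x)) = 0
  rw [map_smul, Algebra.smul_def, map_mul, red_algebraMap hc1, zero_mul]

/-- `A⟨f⁻¹⟩†` does not vanish if `f̄` lies outside some prime. -/
theorem loc_nontrivial {f : A} {p : P.Pt} (h : p ∈ P.basic f) : (1 : P.Loc f) ≠ 0 := by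
  intro h0
  rw [← map_one (P.proj f), Ideal.Quotient.eq_zero_iff_mem, Ideal.mem_span_singleton'] at h0
  obtain ⟨H, hH⟩ := h0
  have h1 : H.1 * (PowerSeries.C f * PowerSeries.X - 1) = 1 := congrArg Subtype.val hH
  have h2 : ∀ j, PowerSeries.coeff j H.1 = - f ^ j := by
    have e : H.1 = PowerSeries.C f * H.1 * PowerSeries.X - 1 := by
      linear_combination -h1
    intro j
    induction j with
    | zero => rw [e]; simp
    | succ j ih => rw [e]; simp [PowerSeries.coeff_one, mul_assoc, PowerSeries.coeff_C_mul, ih, pow_succ']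
  obtain ⟨N, hN⟩ := P.red_coeff H
  have h3 := hN N le_rfl
  rw [h2, map_neg, map_pow, neg_eq_zero] at h3
  have h4 : red K f ∈ p.asIdeal := p.isPrime.mem_of_pow_mem N (by rw [h3]; exact zero_mem _)
  exact h h4

theorem mem_TSucc_of_smul {n : ℕ} {c : RInt K} (hc : c ≠ 0) {G H : PowerSeries (T K n)}
    (hG : G ∈ TSucc K n) (h : ∀ j, PowerSeries.coeff j G = c • PowerSeries.coeff j H) :
    H ∈ TSucc K n := by
  obtain ⟨r, hr, ht⟩ := hG
  have hc0 : ‖(c : K)‖ ≠ 0 := norm_ne_zero_iff.2 (by simpa using hc)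
  refine ⟨r, hr, ?_⟩
  have := ht.const_mul ‖(c : K)‖⁻¹
  rw [mul_zero] at this
  refine this.congr fun vj => ?_
  rw [h]
  change ‖(c : K)‖⁻¹ * (‖((c * MvPowerSeries.coeff vj.1 (PowerSeries.coeff vj.2 H : T K n).1 :
    RInt K) : K)‖ * _) = _
  push_cast
  rw [norm_mul]
  field_simp

/-- Elements of norm `< 1` of `R` lie in the Jacobson radical of `A⟨ξ⟩†`. -/
theorem isUnit_one_add {c : RInt K} (hc : ‖(c : K)‖ < 1) (y : P.Over) :
    IsUnit (1 + P.C (algebraMap (RInt K) A c) * y) := by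
  obtain ⟨_, B, hB, rfl⟩ := y
  have hcB : PowerSeries.C (algebraMap (RInt K) (T K P.n) c) * B ∈ TSucc K P.n :=
    Subring.mul_mem _ (C_mem_TSucc _) hB
  obtain ⟨H, hH, e⟩ := isUnit_TSucc hcB fun j v => by
    rw [PowerSeries.coeff_C_mul, ← Algebra.smul_def]
    change ‖((c * MvPowerSeries.coeff v (PowerSeries.coeff j B : T K P.n).1 : RInt K) : K)‖ < 1
    push_cast
    rw [norm_mul]
    exact mul_lt_one_of_nonneg_of_lt_one_left (norm_nonneg _) hc (norm_le_one _)
  refine isUnit_iff_exists_inv.2 ⟨⟨_, H, hH, rfl⟩, ?_⟩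
  ext1
  have := congrArg (PowerSeries.map (P.φ : T K P.n →+* A)) e
  simp only [map_mul, map_add, map_one, PowerSeries.map_C] at this
  rw [RingHom.coe_coe, AlgHom.commutes] at this
  exact this

/-- Elements of `A⟨f⁻¹⟩†` are fractions `a / f^N` up to multiples of `c`. -/
theorem decomp {c : RInt K} (hc0 : c ≠ 0) {f : A} (x : P.Loc f) :
    ∃ (N : ℕ) (a : A) (y : P.Loc f), P.proj f (P.C f) ^ N * x =
      P.proj f (P.C a) + P.proj f (P.C (algebraMap (RInt K) A c)) * y := by
  obtain ⟨g, rfl⟩ := Ideal.Quotient.mk_surjective x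
  obtain ⟨G, hG, hg⟩ := g.2
  obtain ⟨N, hN⟩ := eventually_small hG hc0
  choose! q hq using hN
  let t : PowerSeries (T K P.n) := ∑ j ∈ Finset.range N,
    PowerSeries.C (PowerSeries.coeff j G) * PowerSeries.X ^ j
  have ht : t ∈ TSucc K P.n := Subring.sum_mem _ fun j _ =>
    Subring.mul_mem _ (C_mem_TSucc _) (Subring.pow_mem _ X_mem_TSucc _)
  have htail : ∀ j, ∃ y : T K P.n, PowerSeries.coeff j (G - t) = c • y := by
    intro j
    have : PowerSeries.coeff j t = if j < N then PowerSeries.coeff j G else 0 := by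
      simp only [t, map_sum, PowerSeries.coeff_C_mul, PowerSeries.coeff_X_pow, mul_ite, mul_one,
        mul_zero]
      rw [Finset.sum_ite_eq]
      simp
    rw [map_sub, this]
    split_ifs with h
    · exact ⟨0, by simp⟩
    · exact ⟨q j, by rw [sub_zero, hq j (not_lt.1 h)]⟩
  choose y hy using htail
  have hGt : G - t ∈ TSucc K P.n := Subring.sub_mem _ hG ht
  have hH : PowerSeries.mk y ∈ TSucc K P.n :=
    mem_TSucc_of_smul hc0 hGt fun j => by rw [hy, PowerSeries.coeff_mk]
  have hGH : G = t + PowerSeries.C (algebraMap (RInt K) (T K P.n) c) * PowerSeries.mk y := by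
    rw [← sub_eq_iff_eq_add']
    ext1 j
    rw [hy, PowerSeries.coeff_C_mul, PowerSeries.coeff_mk, Algebra.smul_def]
  let S : P.Over := ∑ j ∈ Finset.range N, P.C (PowerSeries.coeff j g.1) * P.X ^ j
  let z : P.Over := ⟨_, _, hH, rfl⟩
  have hS : g = S + P.C (algebraMap (RInt K) A c) * z := by
    ext1
    change g.1 = P.Over.subtype S + PowerSeries.C (algebraMap (RInt K) A c) *
      PowerSeries.map (P.φ : T K P.n →+* A) (PowerSeries.mk y)
    have h1 : P.Over.subtype S = PowerSeries.map (P.φ : T K P.n →+* A) t := by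
      simp only [S, t, map_sum, map_mul, map_pow]
      refine Finset.sum_congr rfl fun j _ => ?_
      change PowerSeries.C (PowerSeries.coeff j g.1) * PowerSeries.X ^ j = _
      rw [← hg]
      simp
    have h2 : PowerSeries.C (algebraMap (RInt K) A c) = PowerSeries.map (P.φ : T K P.n →+* A)
        (PowerSeries.C (algebraMap (RInt K) (T K P.n) c)) := by
      rw [PowerSeries.map_C, RingHom.coe_coe, AlgHom.commutes]
    rw [h1, h2, ← map_mul, ← map_add, ← hGH, ← hg]
  refine ⟨N, ∑ j ∈ Finset.range N, PowerSeries.coeff j g.1 * f ^ (N - j),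
    P.proj f (P.C f) ^ N * P.proj f z, ?_⟩
  change P.proj f (P.C f) ^ N * P.proj f g = _
  conv_lhs => rw [hS, map_add, mul_add, map_mul _ _ z, mul_left_comm]
  congr 1
  simp only [S, map_sum, map_mul, map_pow, Finset.mul_sum]
  refine Finset.sum_congr rfl fun j hj => ?_
  have hj' : N = (N - j) + j := by have := Finset.mem_range.1 hj; omega
  conv_lhs => rw [hj', pow_add]
  have := congrArg (· ^ j) (P.proj_C_mul_X f)
  simp only [mul_pow, one_pow] at this
  linear_combination (P.proj f (P.C f)) ^ (N - j) * P.proj f (P.C ((PowerSeries.coeff j) g.1)) * this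

theorem isUnit_proj_C (f : A) : IsUnit (P.proj f (P.C f)) :=
  isUnit_iff_exists_inv.2 ⟨_, P.proj_C_mul_X f⟩

theorem isUnit_germ {c : RInt K} (hc : ‖(c : K)‖ < 1) {f a : A} {p : P.Pt} (h : p ∈ P.basic f)
    (ha : p ∈ P.basic a) (y : P.Loc f) : IsUnit (P.germ f p h (P.proj f (P.C a) +
      P.proj f (P.C (algebraMap (RInt K) A c)) * y)) := by
  obtain ⟨y, rfl⟩ := Ideal.Quotient.mk_surjective y
  obtain ⟨g, hg⟩ : ∃ g, g = f * a := ⟨_, rfl⟩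
  rw [← P.germ_trans (g := g) a hg p h (hg ▸ P.mem_basic_mul.2 ⟨h, ha⟩)]
  refine IsUnit.map _ ?_
  change IsUnit (P.proj g (P.scale a (P.C a + P.C (algebraMap (RInt K) A c) * y)))
  rw [map_add (P.scale a), map_mul (P.scale a), scale_C, scale_C]
  have hu : IsUnit (P.proj g (P.C a)) := by
    have e : P.proj g (P.C g) = P.proj g (P.C f) * P.proj g (P.C a) := by
      rw [← map_mul (P.proj g), ← map_mul P.C]
      exact congrArg (fun x => P.proj g (P.C x)) hg
    exact isUnit_of_mul_isUnit_right (e ▸ P.isUnit_proj_C g)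
  obtain ⟨v, hv⟩ := isUnit_iff_exists_inv.1 hu
  obtain ⟨w, rfl⟩ := Ideal.Quotient.mk_surjective v
  change P.proj g (P.C a) * P.proj g w = 1 at hv
  have h1 := (P.isUnit_one_add hc (w * P.scale a y)).map (P.proj g)
  convert hu.mul h1 using 1
  rw [map_add, map_add, map_mul, map_mul, map_mul, map_one]
  linear_combination (-P.proj g (P.C (algebraMap (RInt K) A c)) * P.proj g (P.scale a y)) * hv

instance (p : P.Pt) : Nontrivial (P.Stalk p) := by
  refine ⟨1, 0, fun h => ?_⟩
  rw [← map_one (P.germ 1 p (P.mem_basic_one p)), ← map_zero (P.germ 1 p (P.mem_basic_one p)),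
    germ_eq_iff] at h
  obtain ⟨c, hc, e⟩ := h
  rw [map_one, map_zero] at e
  exact P.loc_nontrivial hc e

instance (p : P.Pt) : IsLocalRing (P.Stalk p) := by
  refine IsLocalRing.of_isUnit_or_isUnit_one_sub_self fun s => ?_
  obtain ⟨f, h, x, rfl⟩ := P.exists_germ p s
  obtain ⟨c, hc0, hc1⟩ := exists_small (K := K)
  obtain ⟨N, a, y, e⟩ := P.decomp hc0 x
  by_cases ha : p ∈ P.basic a
  · left
    have := P.isUnit_germ hc1 h ha y
    rw [← e, map_mul] at this
    exact isUnit_of_mul_isUnit_right this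
  · right
    have hb : p ∈ P.basic (f ^ N - a) := by
      have ha' : red K a ∈ p.asIdeal := by_contra fun h' => ha h'
      intro hm
      rw [map_sub, map_pow] at hm
      have := (Submodule.sub_mem_iff_left _ ha').1 hm
      exact h (p.isPrime.mem_of_pow_mem N this)
    have := P.isUnit_germ hc1 h hb (-y)
    have e' : P.proj f (P.C (f ^ N - a)) + P.proj f (P.C (algebraMap (RInt K) A c)) * -y =
        P.proj f (P.C f) ^ N * (1 - x) := by
      rw [map_sub, map_sub, map_pow, map_pow]
      linear_combination e
    rw [e', map_mul, map_sub, map_one] at this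
    exact isUnit_of_mul_isUnit_right this

/-! ### The structure sheaf -/

/-- A function `s` on `U` with `s(p) ∈ O†_p` is a section of `O†` if for each `p ∈ U` there are
`f` with `f̄ ∉ p` and `x ∈ A⟨f⁻¹⟩†` such that `s(q)` is the image of `x` in `O†_q` for all
`q ∈ X_f̄ ∩ U`. -/
def IsSection {U : Opens P.Pt} (s : ∀ p : U, P.Stalk p.1) : Prop :=
  ∀ p : U, ∃ (f : A) (_ : p.1 ∈ P.basic f) (x : P.Loc f),
    ∀ (q : U) (hq : q.1 ∈ P.basic f), s q = P.germ f q.1 hq x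

/-- Being a section is a local condition. -/
def isSection : TopCat.LocalPredicate P.Stalk where
  pred {_} s := P.IsSection s
  res {U V} i s hs p := by
    obtain ⟨f, hf, x, hx⟩ := hs ⟨p.1, i.le p.2⟩
    exact ⟨f, hf, x, fun q hq => hx ⟨q.1, i.le q.2⟩ hq⟩
  locality {U} s hs p := by
    obtain ⟨V, hpV, i, hV⟩ := hs p
    obtain ⟨f, hf, x, hx⟩ := hV ⟨p.1, hpV⟩
    obtain ⟨_, ⟨_, ⟨g, rfl⟩, rfl⟩, hpg, hgV⟩ :=
      PrimeSpectrum.isBasis_basic_opens.exists_subset_of_mem_open hpV V.2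
    obtain ⟨g, rfl⟩ := red_surjective K g
    refine ⟨f * g, P.mem_basic_mul.2 ⟨hf, hpg⟩, P.trans g rfl x, fun q hq => ?_⟩
    obtain ⟨hqf, hqg⟩ := P.mem_basic_mul.1 hq
    rw [P.germ_trans g rfl q.1 hqf hq]
    exact hx ⟨q.1, hgV hqg⟩ hqf

/-- Two elements of the rings `A⟨f⁻¹⟩†`, `A⟨g⁻¹⟩†` have images in `A⟨(fg)⁻¹⟩†`. -/
theorem isSection_op {U : Opens P.Pt} {s t u : ∀ p : U, P.Stalk p.1}
    (op : ∀ (f : A), P.Loc f → P.Loc f → P.Loc f)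
    (h : ∀ (q : U) (f : A) (hq : q.1 ∈ P.basic f) (x y : P.Loc f),
      s q = P.germ f q.1 hq x → t q = P.germ f q.1 hq y → u q = P.germ f q.1 hq (op f x y))
    (hs : P.IsSection s) (ht : P.IsSection t) : P.IsSection u := by
  intro p
  obtain ⟨f, hf, x, hx⟩ := hs p
  obtain ⟨g, hg, y, hy⟩ := ht p
  refine ⟨f * g, P.mem_basic_mul.2 ⟨hf, hg⟩,
    op _ (P.trans g rfl x) (P.trans f (mul_comm f g) y), fun q hq => ?_⟩
  obtain ⟨hqf, hqg⟩ := P.mem_basic_mul.1 hq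
  refine h q _ hq _ _ ?_ ?_
  · rw [hx q hqf, P.germ_trans g rfl q.1 hqf hq]
  · rw [hy q hqg, P.germ_trans f (mul_comm f g) q.1 hqg hq]

/-- The ring `O†(U)`. -/
def sections (U : Opens P.Pt) : Subring (∀ p : U, P.Stalk p.1) where
  carrier := {s | P.IsSection s}
  mul_mem' := P.isSection_op (fun _ x y => x * y) fun q f hq x y hx hy => by
    rw [map_mul, ← hx, ← hy]; rfl
  add_mem' := P.isSection_op (fun _ x y => x + y) fun q f hq x y hx hy => by
    rw [map_add, ← hx, ← hy]; rfl
  neg_mem' {s} hs := P.isSection_op (s := s) (t := s) (fun _ x _ => -x) (fun q f hq x y hx hy => by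
    rw [map_neg, ← hx]; rfl) hs hs
  zero_mem' p := ⟨1, P.mem_basic_one _, 0, fun q hq => (map_zero _).symm⟩
  one_mem' p := ⟨1, P.mem_basic_one _, 1, fun q hq => (map_one _).symm⟩

/-- The structure presheaf, with the restriction of functions. -/
def presheaf : TopCat.Presheaf CommRingCat.{u} P.Pt where
  obj U := CommRingCat.of (P.sections U.unop)
  map {U V} i := CommRingCat.ofHom
    { toFun := fun s => ⟨fun q => s.1 ⟨q.1, i.unop.le q.2⟩, P.isSection.res i.unop s.1 s.2⟩
      map_one' := rfl
      map_mul' := fun _ _ => rfl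
      map_zero' := rfl
      map_add' := fun _ _ => rfl }

/-- As a presheaf of sets it is the sheaf of functions satisfying `IsSection`. -/
def presheafForget : P.presheaf ⋙ forget CommRingCat ≅ (TopCat.subsheafToTypes P.isSection).1 :=
  NatIso.ofComponents fun _ => Iso.refl _

theorem isSheaf : P.presheaf.IsSheaf :=
  (TopCat.Presheaf.isSheaf_iff_isSheaf_comp (forget CommRingCat) _).mpr
    (TopCat.Presheaf.isSheaf_of_iso P.presheafForget.symm
      (TopCat.subsheafToTypes P.isSection).property)

/-- The value `s(p) ∈ O†_p` of a section `s ∈ O†(U)`. -/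
def eval (U : Opens P.Pt) (p : P.Pt) (h : p ∈ U) : P.presheaf.obj (op U) →+* P.Stalk p :=
  (Pi.evalRingHom (fun q : U => P.Stalk q.1) ⟨p, h⟩).comp (P.sections U).subtype

/-- The canonical map `A⟨f⁻¹⟩† → O†(X_f̄)`. -/
def toSection (f : A) : P.Loc f →+* P.presheaf.obj (op (P.basic f)) :=
  (RingHom.pi fun q : P.basic f => P.germ f q.1 q.2).codRestrict (P.sections (P.basic f))
    fun x p => ⟨f, p.2, x, fun _ _ => rfl⟩

/-- The canonical map from the categorical stalk to `O†_p`. -/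
def stalkEval (p : P.Pt) : P.presheaf.stalk p →+* P.Stalk p :=
  (Limits.colimit.desc _ (⟨CommRingCat.of (P.Stalk p),
    { app := fun U => CommRingCat.ofHom (P.eval _ p U.unop.2) }⟩ :
    Limits.Cocone ((OpenNhds.inclusion p).op ⋙ P.presheaf)) :
    P.presheaf.stalk p ⟶ CommRingCat.of (P.Stalk p)).hom

theorem stalkEval_germ (p : P.Pt) (U : Opens P.Pt) (h : p ∈ U) (s : P.presheaf.obj (op U)) :
    P.stalkEval p (P.presheaf.germ U p h s) = P.eval U p h s := by
  have := Limits.colimit.ι_desc (⟨CommRingCat.of (P.Stalk p),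
    { app := fun U => CommRingCat.ofHom (P.eval _ p U.unop.2) }⟩ :
    Limits.Cocone ((OpenNhds.inclusion p).op ⋙ P.presheaf)) (op ⟨U, h⟩)
  exact congrArg (fun φ => CommRingCat.Hom.hom φ s) this

instance (p : P.Pt) : IsLocalHom (P.stalkEval p) := by
  constructor
  intro s hs
  obtain ⟨U, hpU, s, rfl⟩ := TopCat.Presheaf.exists_germ_eq (F := P.presheaf) s
  rw [stalkEval_germ] at hs
  obtain ⟨f, hf, x, hx⟩ := s.2 ⟨p, hpU⟩
  have e : P.eval U p hpU s = P.germ f p hf x := hx ⟨p, hpU⟩ hf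
  rw [e] at hs
  obtain ⟨t, ht⟩ := isUnit_iff_exists_inv.1 hs
  obtain ⟨g, hg, y, rfl⟩ := P.exists_germ p t
  have hfg : p ∈ P.basic (f * g) := P.mem_basic_mul.2 ⟨hf, hg⟩
  rw [← P.germ_trans g rfl p hf hfg, ← P.germ_trans f (mul_comm f g) p hg hfg, ← map_mul,
    ← map_one (P.germ (f * g) p hfg), germ_eq_iff] at ht
  obtain ⟨c, hc, e⟩ := ht
  let V : Opens P.Pt := U ⊓ P.basic (f * g * c)
  have hV : ∀ q ∈ V, q ∈ P.basic f ∧ q ∈ P.basic g ∧ q ∈ P.basic (f * g) := fun q hq => by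
    have := P.mem_basic_mul.1 hq.2
    exact ⟨(P.mem_basic_mul.1 this.1).1, (P.mem_basic_mul.1 this.1).2, this.1⟩
  let i : V ⟶ U := homOfLE inf_le_left
  let v : P.presheaf.obj (op V) := (⟨fun q => P.germ g q.1 (hV q.1 q.2).2.1 y,
    fun q => ⟨g, (hV q.1 q.2).2.1, y, fun _ _ => rfl⟩⟩ : P.sections V)
  have hmul : P.presheaf.map i.op s * v = 1 := by
    refine Subtype.ext (funext fun q => ?_)
    change s.1 ⟨q.1, i.le q.2⟩ * P.germ g q.1 (hV q.1 q.2).2.1 y = 1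
    obtain ⟨h1, h2, h3⟩ := hV q.1 q.2
    rw [hx ⟨q.1, i.le q.2⟩ h1]
    have e' := congrArg (P.germ _ q.1 q.2.2) e
    rw [P.germ_trans c rfl q.1 h3, P.germ_trans c rfl q.1 h3, map_mul, map_one,
      P.germ_trans g rfl q.1 h1 h3, P.germ_trans f (mul_comm f g) q.1 h2 h3] at e'
    exact e'
  have hu : IsUnit (P.presheaf.map i.op s) := isUnit_iff_exists_inv.2 ⟨v, hmul⟩
  have := hu.map (P.presheaf.germ V p ⟨hpU, hc⟩).hom
  rw [← TopCat.Presheaf.germ_res_apply P.presheaf i p ⟨hpU, hc⟩ s]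
  exact this

/-- The locally ringed space `Spf†(A)`. -/
def Spf : LocallyRingedSpace.{u} where
  carrier := P.Pt
  presheaf := P.presheaf
  IsSheaf := P.isSheaf
  isLocalRing p := (P.stalkEval p).domain_isLocalRing

/-! ### Morphisms -/

variable {P} {B : Type u} [CommRing B] [Algebra (RInt K) B] {Q : Presentation K B}

/-- A morphism `F = (φ, φ♯) : Spf†(B) → Spf†(A)` is induced by the ring homomorphism `ρ : A → B` if
* `φ` is the map `q ↦ ρ̄⁻¹(q)`, and
* for each `f ∈ A`, the map `φ♯ : O†(X_f̄) → O†(φ⁻¹ X_f̄)` restricts on the image of `A⟨f⁻¹⟩†` to the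
  map `A⟨f⁻¹⟩† → B⟨ρ(f)⁻¹⟩†` with `∑_j a_j f^{-j} ↦ ∑_j ρ(a_j) ρ(f)^{-j}`, where
  `φ⁻¹ X_f̄ = Y_{ρ(f)‾}`. -/
structure IsInducedBy (F : Q.Spf ⟶ P.Spf) (ρ : A →+* B) : Prop where
  /-- the map on the underlying spaces -/
  base : ∀ (q : Q.Pt) (f : A), F.base q ∈ P.basic f ↔ q ∈ Q.basic (ρ f)
  /-- the map on sections -/
  sections : ∀ (f : A) (g : P.Over), ∃ h : Q.Over, h.1 = PowerSeries.map ρ g.1 ∧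
    ∀ (q : Q.Pt) (hq : F.base q ∈ P.basic f),
      Q.eval ((Opens.map F.base).obj (P.basic f)) q hq
        (F.c.app (op (P.basic f)) (P.toSection f (P.proj f g))) =
      Q.germ (ρ f) q ((base q f).1 hq) (Q.proj (ρ f) h)

variable (P) in
/-- The structure map from the base ring `R` to the sections of `O†` over `U`. -/
def const (U : Opens P.Pt) : RInt K →+* P.presheaf.obj (op U) :=
  (P.presheaf.map (homOfLE fun p _ => P.mem_basic_one p : U ⟶ P.basic 1).op).hom.comp
    ((P.toSection 1).comp ((P.proj 1).comp (P.C.comp (algebraMap (RInt K) A))))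

/-- A morphism `Spf†(B) → Spf†(A)` of locally ringed spaces is a morphism over `R` if its map on
global sections is a homomorphism of `R`-algebras. -/
def IsOverBase (F : Q.Spf ⟶ P.Spf) : Prop :=
  ∀ c : RInt K, F.c.app (op (⊤ : Opens P.Pt)) (P.const ⊤ c) =
    Q.const ((Opens.map F.base).obj (⊤ : Opens P.Pt)) c

end Presentation

end

end Dagger

/-!
The morphisms `Spf†(B) → Spf†(A)` are those given by ring homomorphisms `A → B` because
`B` is the ring of global sections of `O†_B` and because all rings in sight are separated for the
`ϖ`-adic topology, where `ϖ` is a uniformizer of `R`.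

Both facts come from division by an ideal `I` of `T_n†` with control of growth. Modulo `ϖ` an
overconvergent series is a polynomial, and division by a Gröbner basis for a degree order does not
increase degrees; for radii close to one this lifts to divisions in `T_n†` that do not increase the
bounds (`exists_division_step`). The ideals of the reductions of `(I : ϖ^e)` become stationary for
large `e`, so that finitely many divisors suffice. Hence `I` is `ϖ`-adically closed
(`mem_of_forall_memMod`), and an element of `I + ϖ^N T_n†` is congruent modulo `I` to `ϖ^N y`, with
growth of `y` at most geometric in `N` (`eventually_exists_cofactor`). Sums `∑_N ϖ^N y_N` of such
elements are overconvergent, for a smaller radius (`exists_radius`).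

The first consequence makes `A` and `A⟨f⁻¹⟩†` separated, and since `A⟨f⁻¹⟩†` modulo `ϖ^N` is an
ordinary localization, an element of `A⟨f⁻¹⟩†` with zero germs, or with germs divisible by all
powers of `ϖ`, is zero (`Presentation.loc_eq_zero_of_germ_dvd`). The second one glues global
sections (`Presentation.exists_global`): given compatible `x_i ∈ A⟨h_i⁻¹⟩†` on a finite cover, their
truncations modulo `ϖ^N` have denominators `h_i^M` with `M` linear in `N`, and are glued modulo
`ϖ^N` by a partition of unity `1 = ∑ G_i h_i^M` whose growth is again geometric in `N`. Therefore
the successive differences of the approximations are `ϖ^N y_N` with controlled `y_N`, and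
the approximations converge in `A`.

A ring homomorphism `ρ : A → B` preserves overconvergence even if it is not linear over `R`
(`Presentation.map_mem_over`): it fixes the prime `p`, and the scalars of `R` have `p`-adic
expansions with digits from a finite set. If `ρ` is `R`-linear, it yields maps of prime spectra and
of the rings `A⟨f⁻¹⟩†`, and thus a morphism (`Presentation.spfMap`); its maps on stalks are local
because a germ is a unit if and only if the leading term of its expansion modulo a non-unit of
`R` is one. Conversely, a morphism gives `ρ` on global sections, locality of the stalk maps
determines its map of points, and its map on `A⟨f⁻¹⟩†` is determined modulo every power of
`p` by its values on `A` and on `f⁻¹`, and hence altogether by separatedness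
(`Presentation.isInducedBy_of_germMap_eq`).
-/

namespace Dagger

open Filter Topology TopologicalSpace TensorProduct

noncomputable section

variable {K : Type u} [NontriviallyNormedField K] [IsUltrametricDist K]

/-! ### Uniformizers and convergent sums over the ring of integers -/

/-- `ϖ` generates the maximal ideal of the ring of integers of `K`, and is not zero. -/
structure IsUniformizer (ϖ : RInt K) : Prop where
  ne_zero : ϖ ≠ 0
  norm_lt_one : ‖(ϖ : K)‖ < 1
  dvd : ∀ c : RInt K, ‖(c : K)‖ < 1 → ϖ ∣ c

theorem norm_pos_of_ne_zero {c : RInt K} (hc : c ≠ 0) : 0 < ‖(c : K)‖ :=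
  norm_pos_iff.2 (by simpa using hc)

theorem dvd_of_norm_le {c d : RInt K} (hd : d ≠ 0) (h : ‖(c : K)‖ ≤ ‖(d : K)‖) : d ∣ c := by
  have hd0 := norm_pos_of_ne_zero hd
  refine ⟨⟨(c : K) / (d : K), ?_⟩, ?_⟩
  · rw [Valuation.mem_valuationSubring_iff]
    change ‖(c : K) / (d : K)‖ ≤ 1
    rw [norm_div, div_le_one hd0]
    exact h
  · ext
    push_cast
    rw [mul_div_cancel₀ _ (by simpa using hd)]

theorem norm_le_of_dvd {c d : RInt K} (h : d ∣ c) : ‖(c : K)‖ ≤ ‖(d : K)‖ := by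
  obtain ⟨e, rfl⟩ := h
  push_cast
  rw [norm_mul]
  exact mul_le_of_le_one_right (norm_nonneg _) (norm_le_one e)

theorem norm_pow_coe (ϖ : RInt K) (N : ℕ) : ‖((ϖ ^ N : RInt K) : K)‖ = ‖(ϖ : K)‖ ^ N := by
  push_cast
  rw [norm_pow]

/-- Finitely many elements of the compact ring of integers represent it modulo `a ≠ 0`. -/
theorem exists_finite_residues [ProperSpace K] {a : RInt K} (ha : a ≠ 0) :
    ∃ S : Finset (RInt K), ∀ c, ∃ s ∈ S, a ∣ c - s := by
  classical
  have hc : IsCompact (Metric.closedBall (0 : K) 1) := isCompact_closedBall _ _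
  obtain ⟨t, htK, htf, hcov⟩ := Metric.totallyBounded_iff.1 hc.totallyBounded ‖(a : K)‖
    (norm_pos_of_ne_zero ha) |>.imp fun t ht => (⟨trivial, ht.1, ht.2⟩ : True ∧ _ ∧ _)
  -- replace each centre by an integral element of its ball
  have hsel : ∀ x : K, ∃ s : RInt K, ∀ c : RInt K, ‖(c : K) - x‖ < ‖(a : K)‖ → a ∣ c - s := by
    intro x
    by_cases h : ∃ s : RInt K, ‖(s : K) - x‖ < ‖(a : K)‖
    · obtain ⟨s, hs⟩ := h
      refine ⟨s, fun c hc => dvd_of_norm_le ha ?_⟩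
      have : ((c - s : RInt K) : K) = (c - x) - (s - x) := by push_cast; ring
      rw [this]
      rw [sub_eq_add_neg]
      refine (IsUltrametricDist.norm_add_le_max _ _).trans (max_le hc.le ?_)
      rw [norm_neg]
      exact hs.le
    · exact ⟨0, fun c hc => (h ⟨c, hc⟩).elim⟩
  choose sel hsel using hsel
  refine ⟨htf.toFinset.image sel, fun c => ?_⟩
  have hcm : (c : K) ∈ Metric.closedBall (0 : K) 1 := by
    simpa using norm_le_one c
  obtain ⟨x, hx, hcx⟩ := Set.mem_iUnion₂.1 (hcov hcm)
  refine ⟨sel x, Finset.mem_image_of_mem _ (htf.mem_toFinset.2 hx), hsel x c ?_⟩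
  rwa [Metric.mem_ball, dist_eq_norm] at hcx

/-- The norm of a locally compact field attains its largest value below one. -/
theorem exists_isUniformizer [ProperSpace K] : ∃ ϖ : RInt K, IsUniformizer ϖ := by
  have : DecidableEq (RInt K) := Classical.decEq _
  obtain ⟨a, ha, ha1⟩ := Presentation.exists_small (K := K)
  obtain ⟨S, hS⟩ := exists_finite_residues ha
  -- an element of maximal norm among `a` and the representatives of norm less than one
  obtain ⟨ϖ, hϖ, hmax⟩ := Finset.exists_max_image
    (insert a (S.filter fun s : RInt K => ‖(s : K)‖ < 1)) (fun s : RInt K => ‖(s : K)‖)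
    (Finset.insert_nonempty _ _)
  have hle : ‖(a : K)‖ ≤ ‖(ϖ : K)‖ := hmax a (Finset.mem_insert_self _ _)
  have h0 : ϖ ≠ 0 := by
    rintro rfl
    have := norm_pos_of_ne_zero ha
    simp at hle
    exact ha hle
  refine ⟨ϖ, h0, ?_, fun c hc => dvd_of_norm_le h0 ?_⟩
  · rcases Finset.mem_insert.1 hϖ with rfl | h
    · exact ha1
    · exact (Finset.mem_filter.1 h).2
  · obtain ⟨s, hs, hcs⟩ := hS c
    have h1 := norm_le_of_dvd hcs
    by_cases hca : ‖(c : K)‖ ≤ ‖(a : K)‖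
    · exact hca.trans hle
    · have hcs' : ‖(s : K)‖ = ‖(c : K)‖ := by
        have e : (s : K) = (c : K) - ((c - s : RInt K) : K) := by push_cast; ring
        have hne : ‖(c : K)‖ ≠ ‖-((c - s : RInt K) : K)‖ := by
          rw [norm_neg]
          exact (h1.trans_lt (not_le.1 hca)).ne'
        rw [e, sub_eq_add_neg, IsUltrametricDist.norm_add_eq_max_of_norm_ne_norm hne, norm_neg,
          max_eq_left (h1.trans (not_le.1 hca).le)]
      rw [← hcs']
      exact hmax s (Finset.mem_insert_of_mem (Finset.mem_filter.2 ⟨hs, hcs'.symm ▸ hc⟩))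

theorem norm_mul_pow_le (ϖ c : RInt K) (l : ℕ) :
    ‖((ϖ ^ l * c : RInt K) : K)‖ ≤ ‖(ϖ : K)‖ ^ l := by
  rw [← norm_pow_coe]
  exact norm_le_of_dvd (dvd_mul_right _ _)

theorem summable_adic [CompleteSpace K] {ϖ : RInt K} (h : ‖(ϖ : K)‖ < 1) (c : ℕ → RInt K) :
    Summable fun l => ((ϖ ^ l * c l : RInt K) : K) :=
  Summable.of_norm_bounded (summable_geometric_of_lt_one (norm_nonneg _) h)
    fun l => norm_mul_pow_le ϖ (c l) l

theorem norm_tsum_le_of_forall_le {f : ℕ → K} (hf : Summable f) {C : ℝ} (hC : 0 ≤ C)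
    (h : ∀ l, ‖f l‖ ≤ C) : ‖∑' l, f l‖ ≤ C :=
  le_of_tendsto hf.hasSum.norm <| Eventually.of_forall fun _ =>
    IsUltrametricDist.norm_sum_le_of_forall_le_of_nonneg hC fun l _ => h l

/-- The sum `∑_l ϖ^l c_l` in the ring of integers. Convergence needs `‖ϖ‖ < 1` and `K` complete;
otherwise the value is of no use. -/
def adicSum (ϖ : RInt K) (c : ℕ → RInt K) : RInt K :=
  open Classical in
  if h : ‖∑' l, ((ϖ ^ l * c l : RInt K) : K)‖ ≤ 1 then ⟨_, h⟩ else 0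

section
variable [CompleteSpace K] {ϖ : RInt K} (h : ‖(ϖ : K)‖ < 1)
include h

theorem coe_adicSum (c : ℕ → RInt K) :
    (adicSum ϖ c : K) = ∑' l, ((ϖ ^ l * c l : RInt K) : K) := by
  rw [adicSum, dif_pos]
  exact norm_tsum_le_of_forall_le (summable_adic h c) zero_le_one fun l => norm_le_one _

theorem norm_adicSum_le (c : ℕ → RInt K) {C : ℝ} (hC : 0 ≤ C)
    (hc : ∀ l, ‖(ϖ : K)‖ ^ l * ‖(c l : K)‖ ≤ C) : ‖(adicSum ϖ c : K)‖ ≤ C := by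
  rw [coe_adicSum h]
  refine norm_tsum_le_of_forall_le (summable_adic h c) hC fun l => ?_
  push_cast
  rw [norm_mul, norm_pow]
  exact hc l

theorem adicSum_eq (c : ℕ → RInt K) (N : ℕ) :
    adicSum ϖ c = ∑ l ∈ Finset.range N, ϖ ^ l * c l + ϖ ^ N * adicSum ϖ fun l => c (l + N) := by
  ext
  rw [coe_adicSum h, ← (summable_adic h c).sum_add_tsum_nat_add N]
  push_cast
  rw [coe_adicSum h, ← tsum_mul_left]
  congr 1
  refine tsum_congr fun l => ?_
  push_cast
  ring

end

/-- Families that grow geometrically become bounded, for a smaller radius, once they are multiplied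
by the powers of `t < 1`: a weighted geometric mean of the bounds `x ≤ 1` and `x r^d ≤ C τ^l`. -/
theorem exists_radius {t r C τ : ℝ} (hτ : 0 ≤ τ) (ht0 : 0 ≤ t) (ht : t < 1) (hr : 1 < r) :
    ∃ r' C' : ℝ, 1 < r' ∧ r' ≤ r ∧ 0 < C' ∧ ∀ (x : ℝ) (d l : ℕ), 0 ≤ x → x ≤ 1 →
      x * r ^ d ≤ C * τ ^ l → t ^ l * x * r' ^ d ≤ C' := by
  set C' := max C 1
  set τ' := max τ 1
  have hC' : 1 ≤ C' := le_max_right _ _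
  have hτ' : 1 ≤ τ' := le_max_right _ _
  obtain ⟨k, hk0, hk⟩ : ∃ k : ℕ, k ≠ 0 ∧ t ^ k * τ' ≤ 1 := by
    have h1 := ((tendsto_pow_atTop_nhds_zero_of_lt_one ht0 ht).mul_const τ')
    rw [zero_mul] at h1
    obtain ⟨k, hk, hk'⟩ := ((h1.eventually (ge_mem_nhds zero_lt_one)).and
      (eventually_ne_atTop 0)).exists
    exact ⟨k, hk', hk⟩
  -- the `k`-th power of the claim for `r' = r ^ (1 / k)` follows from `t ^ k * τ' ≤ 1`
  refine ⟨r ^ (k : ℝ)⁻¹, C', Real.one_lt_rpow hr (by positivity), ?_, by positivity,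
    fun x d l hx0 hx1 hx => ?_⟩
  · refine Real.rpow_le_self_of_one_le hr.le ?_
    exact inv_le_one_of_one_le₀ (by exact_mod_cast Nat.one_le_iff_ne_zero.2 hk0)
  set s := r ^ (k : ℝ)⁻¹
  have hs : s ^ k = r := Real.rpow_inv_natCast_pow (by linarith) hk0
  have hs0 : 0 ≤ s := Real.rpow_nonneg (by linarith) _
  refine le_of_pow_le_pow_left₀ hk0 (by positivity) ?_
  have hxk : x ^ k ≤ x := by
    simpa using pow_le_pow_of_le_one hx0 hx1 (Nat.one_le_iff_ne_zero.2 hk0)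
  calc (t ^ l * x * s ^ d) ^ k = (t ^ k) ^ l * x ^ k * r ^ d := by
        rw [← hs]; ring
    _ ≤ (t ^ k) ^ l * x * r ^ d := by gcongr
    _ = (t ^ k) ^ l * (x * r ^ d) := by ring
    _ ≤ (t ^ k) ^ l * (C' * τ' ^ l) := by
        refine mul_le_mul_of_nonneg_left (hx.trans ?_) (by positivity)
        exact mul_le_mul (le_max_left _ _) (pow_le_pow_left₀ hτ (le_max_left _ _) _)
          (by positivity) (by positivity)
    _ = (t ^ k * τ') ^ l * C' := by ring
    _ ≤ 1 * C' := by gcongr; exact pow_le_one₀ (by positivity) hk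
    _ ≤ C' ^ k := by
        rw [one_mul]; exact le_self_pow₀ hC' hk0

/-! ### Division by the elements of a polynomial ideal -/

open MonomialOrder in
/-- A Gröbner basis for the degree-lexicographic order: the elements of an ideal of polynomials over
a field are combinations of finitely many elements whose summands do not exceed them in degree. -/
theorem exists_groebner {k : Type*} [Field k] {n : ℕ} (J : Ideal (MvPolynomial (Fin n) k)) :
    ∃ B : Finset (MvPolynomial (Fin n) k), (∀ b ∈ B, b ∈ J ∧ b ≠ 0) ∧
      ∀ P ∈ J, ∃ q : MvPolynomial (Fin n) k → MvPolynomial (Fin n) k,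
        P = ∑ b ∈ B, q b * b ∧ ∀ b ∈ B, q b ≠ 0 → (q b).totalDegree + b.totalDegree ≤ P.totalDegree := by
  classical
  let m : MonomialOrder (Fin n) := degLex
  let D : Set (Fin n →₀ ℕ) := {d | ∃ f ∈ J, f ≠ 0 ∧ m.degree f = d}
  let M : Set (Fin n →₀ ℕ) := {d | Minimal (· ∈ D) d}
  have hfin : M.Finite := WellQuasiOrderedLE.finite_of_isAntichain (setOfPred_minimal_antichain _)
  have hex : ∀ d ∈ M, ∃ f ∈ J, f ≠ 0 ∧ m.degree f = d := fun d hd => hd.prop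
  choose! F hFJ hF0 hFd using hex
  let B := hfin.toFinset.image F
  have hB : ∀ b ∈ B, b ∈ J ∧ b ≠ 0 := by
    intro b hb
    obtain ⟨d, hd, rfl⟩ := Finset.mem_image.1 hb
    rw [Set.Finite.mem_toFinset] at hd
    exact ⟨hFJ d hd, hF0 d hd⟩
  refine ⟨B, hB, fun P hP => ?_⟩
  obtain ⟨g, r, hP', hdeg, hr⟩ := m.div_set (B := (B : Set (MvPolynomial (Fin n) k)))
    (fun b hb => (m.leadingCoeff_ne_zero_iff.2 (hB b hb).2).isUnit) P
  let q : MvPolynomial (Fin n) k → MvPolynomial (Fin n) k :=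
    fun b => if hb : b ∈ B then g ⟨b, hb⟩ else 0
  have hsum : Finsupp.linearCombination _ (fun b : (B : Set (MvPolynomial (Fin n) k)) =>
      (b : MvPolynomial (Fin n) k)) g = ∑ b ∈ B, q b * b := by
    rw [Finsupp.linearCombination_apply, Finsupp.sum_fintype _ _ (by simp),
      ← Finset.sum_coe_sort B]
    refine Finset.sum_congr rfl fun b _ => ?_
    simp [q]
  have hr0 : r = 0 := by
    by_contra h0
    have hrJ : r ∈ J := by
      have : r = P - ∑ b ∈ B, q b * b := by rw [← hsum]; nth_rewrite 1 [hP']; ring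
      rw [this]
      exact J.sub_mem hP (J.sum_mem fun b hb => J.mul_mem_left _ (hB b hb).1)
    obtain ⟨d, hd, hmin⟩ := exists_minimal_le_of_wellFoundedLT (· ∈ D) (m.degree r) ⟨r, hrJ, h0, rfl⟩
    refine hr _ (m.degree_mem_support h0) (F d) ?_ ?_
    · exact Finset.mem_coe.2 (Finset.mem_image_of_mem _ (hfin.mem_toFinset.2 hmin))
    · rw [hFd d hmin]; exact hd
  refine ⟨q, by rw [← hsum]; simpa [hr0] using hP', fun b hb hq => ?_⟩
  have h1 := MvPolynomial.degLex_totalDegree_monotone (hdeg ⟨b, hb⟩)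
  have hqb : q b = g ⟨b, hb⟩ := dif_pos hb
  rw [← hqb] at h1
  change (b * q b).totalDegree ≤ _ at h1
  rw [MvPolynomial.totalDegree_mul_of_isDomain (hB b hb).2 hq] at h1
  omega

/-! ### Convergent sums and reduction of overconvergent series -/

section
variable {n : ℕ} {C D r s : ℝ} {ϖ : RInt K}

theorem Bdd.nonneg {G : MvPowerSeries (Fin n) (RInt K)} (hG : Bdd C r G) : 0 ≤ C := by
  refine le_trans ?_ (hG 0)
  simp

theorem bdd_zero (hC : 0 ≤ C) : Bdd C r (0 : MvPowerSeries (Fin n) (RInt K)) := by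
  intro v
  simpa using hC

theorem Bdd.sub {G H : MvPowerSeries (Fin n) (RInt K)} (hr : 0 < r) (hG : Bdd C r G)
    (hH : Bdd C r H) : Bdd C r (G - H) := by
  rw [sub_eq_add_neg]
  exact hG.add hr hH.neg

theorem Bdd.smul {G : MvPowerSeries (Fin n) (RInt K)} (hr : 0 < r) (hG : Bdd C r G) (c : RInt K) :
    Bdd C r (c • G) := by
  intro v
  refine le_trans ?_ (hG v)
  rw [MvPowerSeries.coeff_smul]
  push_cast
  rw [norm_mul]
  gcongr
  exact mul_le_of_le_one_left (norm_nonneg _) (norm_le_one c)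

theorem bdd_X (i : Fin n) (hr : 1 ≤ r) : Bdd r r (MvPowerSeries.X i : MvPowerSeries (Fin n) (RInt K)) := by
  classical
  intro v
  rw [MvPowerSeries.coeff_X]
  split_ifs with h
  · subst h; simp
  · simp; linarith

theorem exists_bdd (g : T K n) : ∀ᶠ r in 𝓝[>] (1 : ℝ), ∃ C, 1 ≤ C ∧ Bdd C r g.1 := by
  obtain ⟨t, ht, hg⟩ := g.2
  obtain ⟨C, hC, hb⟩ := bdd_of_tendsto hg
  filter_upwards [Ioc_mem_nhdsGT ht] with r hr
  refine ⟨max C 1, le_max_right _ _, ?_⟩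
  exact Bdd.mono (C := C) (r := t) hb (le_max_left _ _) (by linarith [hr.1]) hr.2

/-- Finitely many overconvergent series are bounded for a common radius and constant. -/
theorem exists_common_bdd {ι : Type*} (t : Finset ι) (g : ι → T K n) :
    ∀ᶠ r in 𝓝[>] (1 : ℝ), ∃ C, 1 ≤ C ∧ ∀ i ∈ t, Bdd C r (g i).1 := by
  have h : ∀ᶠ r in 𝓝[>] (1 : ℝ), ∀ i ∈ t, ∃ C, 1 ≤ C ∧ Bdd C r (g i).1 :=
    (Filter.eventually_all_finset t).2 fun i _ => exists_bdd (g i)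
  filter_upwards [h, self_mem_nhdsWithin] with r hr hr1
  have hr0 : (0 : ℝ) ≤ r := zero_le_one.trans (le_of_lt hr1)
  choose! C hC1 hC using hr
  refine ⟨∑ i ∈ t, C i + 1, ?_, fun i hi => (hC i hi).mono ?_ hr0 le_rfl⟩
  · have : 0 ≤ ∑ i ∈ t, C i := Finset.sum_nonneg fun i hi => zero_le_one.trans (hC1 i hi)
    linarith
  · have := Finset.single_le_sum (f := C) (fun i hi => zero_le_one.trans (hC1 i hi)) hi
    linarith

theorem eq_zero_of_forall_dvd (h0 : ‖(ϖ : K)‖ < 1) {g : MvPowerSeries (Fin n) (RInt K)}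
    (h : ∀ N : ℕ, ∃ x : MvPowerSeries (Fin n) (RInt K), g = ϖ ^ N • x) : g = 0 := by
  ext v
  have hle : ∀ N : ℕ, ‖((MvPowerSeries.coeff v g : RInt K) : K)‖ ≤ ‖(ϖ : K)‖ ^ N := by
    intro N
    obtain ⟨x, rfl⟩ := h N
    rw [MvPowerSeries.coeff_smul]
    exact norm_mul_pow_le _ _ _
  have := ge_of_tendsto' (tendsto_pow_atTop_nhds_zero_of_lt_one (norm_nonneg (ϖ : K)) h0) hle
  simpa using this

/-- A series all of whose coefficients are divisible by `c` is the `c`-fold of a series. -/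
theorem exists_eq_smul {c : RInt K} (hc : c ≠ 0) {g : MvPowerSeries (Fin n) (RInt K)}
    (h : ∀ v, c ∣ MvPowerSeries.coeff v g) :
    ∃ x : MvPowerSeries (Fin n) (RInt K), g = c • x ∧
      ∀ {C r : ℝ}, Bdd C r g → Bdd (C / ‖(c : K)‖) r x := by
  have hx : ∃ x : MvPowerSeries (Fin n) (RInt K), ∀ v,
      MvPowerSeries.coeff v g = c * MvPowerSeries.coeff v x :=
    ⟨fun v => (h v).choose, fun v => (h v).choose_spec⟩
  obtain ⟨x, hx⟩ := hx
  refine ⟨x, ?_, fun {C r} hg v => ?_⟩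
  · ext1 v
    rw [MvPowerSeries.coeff_smul, hx]
  · have h1 := hg v
    rw [hx v] at h1
    push_cast at h1
    rw [norm_mul] at h1
    rw [le_div_iff₀ (norm_pos_of_ne_zero hc)]
    refine le_trans (le_of_eq ?_) h1
    ring

/-- Convergent sums `∑_l ϖ^l Q_l` of overconvergent series that grow geometrically. -/
theorem exists_sum [CompleteSpace K] (h1 : ‖(ϖ : K)‖ < 1) {τ : ℝ} (hτ : 0 ≤ τ) (hr : 1 < r)
    (Q : ℕ → T K n) (hQ : ∀ l, Bdd (C * τ ^ l) r (Q l).1) :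
    ∃ S : T K n, ∀ N, ∃ S' : T K n, S = ∑ l ∈ Finset.range N, ϖ ^ l • Q l + ϖ ^ N • S' := by
  have key : ∀ N, ∃ S : T K n, ∀ v, MvPowerSeries.coeff v S.1 =
      adicSum ϖ fun l => MvPowerSeries.coeff v (Q (l + N)).1 := by
    intro N
    obtain ⟨r', C', hr', -, hC', hb⟩ :=
      exists_radius (C := C * τ ^ N) hτ (norm_nonneg (ϖ : K)) h1 hr
    refine ⟨⟨fun v => adicSum ϖ fun l => MvPowerSeries.coeff v (Q (l + N)).1,
      mem_T_of_bdd (C := C') hr' fun v => ?_⟩, fun v => rfl⟩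
    have hp : 0 < r' ^ v.degree := by positivity
    rw [← le_div_iff₀ hp]
    refine norm_adicSum_le h1 _ (by positivity) fun l => ?_
    rw [le_div_iff₀ hp]
    refine hb _ _ _ (norm_nonneg _) (norm_le_one _) ((hQ (l + N) v).trans_eq ?_)
    rw [pow_add]; ring
  choose S hS using key
  refine ⟨S 0, fun N => ⟨S N, ?_⟩⟩
  ext1
  ext1 v
  rw [hS, adicSum_eq h1 _ N]
  simp only [add_zero, Subalgebra.coe_add, Subalgebra.coe_smul, AddSubmonoidClass.coe_finsetSum,
    map_add, map_sum, MvPowerSeries.coeff_smul, hS]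

end

section
variable {n : ℕ} {C r : ℝ} {ϖ : RInt K}

theorem residue_eq_zero_iff_norm {c : RInt K} :
    IsLocalRing.residue (RInt K) c = 0 ↔ ‖(c : K)‖ < 1 := by
  rw [IsLocalRing.residue_eq_zero_iff, IsLocalRing.mem_maximalIdeal, mem_nonunits_iff]
  refine ⟨fun h => (norm_le_one c).lt_of_ne fun h' => h (isUnit_of_norm_eq h'), ?_⟩
  rintro h ⟨u, rfl⟩
  exact h.ne (norm_unit u)

variable (K n) in
/-- The reduction of overconvergent series modulo the maximal ideal. -/
def redT : T K n →+* MvPowerSeries (Fin n) (IsLocalRing.ResidueField (RInt K)) :=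
  (MvPowerSeries.map (IsLocalRing.residue (RInt K))).comp (T K n).val.toRingHom

theorem coeff_redT (g : T K n) (v : Fin n →₀ ℕ) :
    MvPowerSeries.coeff v (redT K n g) =
      IsLocalRing.residue (RInt K) (MvPowerSeries.coeff v g.1) := rfl

theorem redT_smul {c : RInt K} (hc : ‖(c : K)‖ < 1) (g : T K n) : redT K n (c • g) = 0 := by
  ext v
  rw [coeff_redT]
  change IsLocalRing.residue (RInt K) (c * _) = 0
  rw [map_mul, residue_eq_zero_iff_norm.2 hc, zero_mul]

/-- The reduction of an overconvergent series is a polynomial. -/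
theorem exists_redT_eq (g : T K n) :
    ∃ P : MvPolynomial (Fin n) (IsLocalRing.ResidueField (RInt K)), redT K n g = P := by
  obtain ⟨r, hr, hg⟩ := g.2
  have hf : {v | ¬ ‖((MvPowerSeries.coeff v g.1 : RInt K) : K)‖ * r ^ v.degree < 1}.Finite :=
    hg.eventually (gt_mem_nhds one_pos)
  refine ⟨∑ v ∈ hf.toFinset, MvPolynomial.monomial v (MvPowerSeries.coeff v (redT K n g)), ?_⟩
  ext v
  rw [MvPolynomial.coeff_coe, MvPolynomial.coeff_sum]
  simp only [MvPolynomial.coeff_monomial]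
  rw [Finset.sum_ite_eq']
  split_ifs with hv
  · rfl
  · rw [Set.Finite.mem_toFinset, Set.mem_ofPred_eq, not_not] at hv
    rw [coeff_redT, residue_eq_zero_iff_norm]
    exact lt_of_le_of_lt (le_mul_of_one_le_right (norm_nonneg _) (one_le_pow₀ hr.le)) hv

theorem norm_coeff_eq_one {g : T K n} {P : MvPolynomial (Fin n) (IsLocalRing.ResidueField (RInt K))}
    (h : redT K n g = P) {v : Fin n →₀ ℕ} : P.coeff v ≠ 0 ↔
      ‖((MvPowerSeries.coeff v g.1 : RInt K) : K)‖ = 1 := by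
  rw [← MvPolynomial.coeff_coe, ← h, coeff_redT, Ne, residue_eq_zero_iff_norm, not_lt]
  exact ⟨fun h' => le_antisymm (norm_le_one _) h', fun h' => h'.ge⟩

/-- A bound on a series bounds the degree of its reduction. -/
theorem pow_totalDegree_le {g : T K n}
    {P : MvPolynomial (Fin n) (IsLocalRing.ResidueField (RInt K))}
    (h : redT K n g = P) (hP : P ≠ 0) (hg : Bdd C r g.1) : r ^ P.totalDegree ≤ C := by
  have hne : P.support.Nonempty := MvPolynomial.support_nonempty.2 hP
  obtain ⟨v, hv, hd⟩ := Finset.exists_mem_eq_sup P.support hne fun s => s.sum fun _ e => e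
  have h1 := hg v
  rw [(norm_coeff_eq_one h).1 (MvPolynomial.mem_support_iff.1 hv), one_mul] at h1
  rw [MvPolynomial.totalDegree, hd]
  exact h1

/-- Polynomials lift with the growth that their degree allows. -/
theorem exists_lift (P : MvPolynomial (Fin n) (IsLocalRing.ResidueField (RInt K))) :
    ∃ g : T K n, redT K n g = P ∧ ∀ r : ℝ, 1 ≤ r → Bdd (r ^ P.totalDegree) r g.1 := by
  have hsec : ∀ x : IsLocalRing.ResidueField (RInt K), ∃ c : RInt K,
      IsLocalRing.residue (RInt K) c = x ∧ (x = 0 → c = 0) := by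
    intro x
    by_cases hx : x = 0
    · exact ⟨0, by rw [hx, map_zero], fun _ => rfl⟩
    · obtain ⟨c, hc⟩ := IsLocalRing.residue_surjective x
      exact ⟨c, hc, fun h => (hx h).elim⟩
  choose sec hsec hsec0 using hsec
  let G : MvPowerSeries (Fin n) (RInt K) := fun v => sec (P.coeff v)
  have hG : ∀ r : ℝ, 1 ≤ r → Bdd (r ^ P.totalDegree) r G := by
    intro r hr v
    change ‖(sec (P.coeff v) : K)‖ * _ ≤ _
    by_cases hv : P.coeff v = 0
    · rw [hsec0 _ hv]
      simp
      positivity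
    · have hle : v.degree ≤ P.totalDegree :=
        MvPolynomial.le_totalDegree (MvPolynomial.mem_support_iff.2 hv)
      calc ‖(sec (P.coeff v) : K)‖ * r ^ v.degree ≤ 1 * r ^ P.totalDegree := by
            gcongr
            exact norm_le_one _
        _ = _ := one_mul _
  refine ⟨⟨G, mem_T_of_bdd one_lt_two (hG 2 one_le_two)⟩, ?_, hG⟩
  ext v
  rw [coeff_redT, MvPolynomial.coeff_coe]
  exact hsec _

/-- For a radius close to one the terms of norm one dominate. -/
theorem eventually_bdd_pow_totalDegree {g : T K n}
    {P : MvPolynomial (Fin n) (IsLocalRing.ResidueField (RInt K))}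
    (h : redT K n g = P) : ∀ᶠ r in 𝓝[>] (1 : ℝ), Bdd (r ^ P.totalDegree) r g.1 := by
  classical
  obtain ⟨t, ht, hg⟩ := g.2
  let c : (Fin n →₀ ℕ) → RInt K := fun v =>
    if ‖((MvPowerSeries.coeff v g.1 : RInt K) : K)‖ < 1 then MvPowerSeries.coeff v g.1 else 0
  have hc : ∀ v, ‖(c v : K)‖ < 1 := by
    intro v
    simp only [c]
    split_ifs with hv
    · exact hv
    · simp
  have hct : Tendsto (fun v => ‖(c v : K)‖ * t ^ v.degree) cofinite (𝓝 0) := by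
    refine squeeze_zero (fun v => by positivity) (fun v => ?_) hg
    simp only [c]
    split_ifs with hv
    · exact le_rfl
    · simp; positivity
  obtain ⟨s, hs, hst, -, hb⟩ := shrink ht one_pos ht hct hc
  filter_upwards [Ioc_mem_nhdsGT hs] with r hr v
  have hr1 : 1 ≤ r := hr.1.le
  by_cases hv : ‖((MvPowerSeries.coeff v g.1 : RInt K) : K)‖ < 1
  · have h1 := hb v
    simp only [c, if_pos hv] at h1
    calc _ ≤ ‖((MvPowerSeries.coeff v g.1 : RInt K) : K)‖ * s ^ v.degree := by
          gcongr; exact hr.2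
      _ ≤ 1 := h1
      _ ≤ _ := one_le_pow₀ hr1
  · have hv1 := le_antisymm (norm_le_one _) (not_lt.1 hv)
    have hle : v.degree ≤ P.totalDegree :=
      MvPolynomial.le_totalDegree (MvPolynomial.mem_support_iff.2 ((norm_coeff_eq_one h).2 hv1))
    rw [hv1, one_mul]
    exact pow_le_pow_right₀ hr1 hle

theorem exists_eq_smul_of_redT_eq_zero (hϖ : IsUniformizer ϖ) (hr : 1 < r) {g : T K n}
    (h : redT K n g = 0) (hg : Bdd C r g.1) :
    ∃ x : T K n, g = ϖ • x ∧ Bdd (C / ‖(ϖ : K)‖) r x.1 := by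
  obtain ⟨x, hx, hb⟩ := exists_eq_smul (g := g.1) hϖ.ne_zero fun v => by
    refine hϖ.dvd _ (residue_eq_zero_iff_norm.1 ?_)
    rw [← coeff_redT, h, map_zero]
  exact ⟨⟨x, mem_T_of_bdd hr (hb hg)⟩, Subtype.ext hx, hb hg⟩

end

/-! ### Effective division by an ideal of overconvergent series -/

section
variable {n : ℕ} {C r : ℝ} {ϖ : RInt K}

/-- The reductions of the elements of `(I : ϖ^e)`, an ideal of polynomials over the residue field. -/
def reductionIdeal (ϖ : RInt K) (I : Ideal (T K n)) (e : ℕ) :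
    Ideal (MvPolynomial (Fin n) (IsLocalRing.ResidueField (RInt K))) where
  carrier := {P | ∃ g : T K n, ϖ ^ e • g ∈ I ∧ redT K n g = P}
  add_mem' := by
    rintro P Q ⟨g, hg, hgP⟩ ⟨h, hh, hhQ⟩
    refine ⟨g + h, ?_, ?_⟩
    · rw [smul_add]; exact I.add_mem hg hh
    · rw [map_add, hgP, hhQ, MvPolynomial.coe_add]
  zero_mem' := ⟨0, by simp, by simp⟩
  smul_mem' := by
    rintro P Q ⟨g, hg, hgQ⟩
    obtain ⟨h, hh, -⟩ := exists_lift P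
    refine ⟨h * g, ?_, ?_⟩
    · rw [← mul_smul_comm]; exact I.mul_mem_left _ hg
    · rw [map_mul, hh, hgQ, smul_eq_mul, MvPolynomial.coe_mul]

theorem smul_mem_of_mem {I : Ideal (T K n)} {g : T K n} (c : RInt K) (h : g ∈ I) : c • g ∈ I := by
  rw [Algebra.smul_def]
  exact I.mul_mem_left _ h

theorem reductionIdeal_mono (ϖ : RInt K) (I : Ideal (T K n)) : Monotone (reductionIdeal ϖ I) := by
  refine monotone_nat_of_le_succ fun e => ?_
  rintro P ⟨g, hg, hgP⟩
  refine ⟨g, ?_, hgP⟩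
  rw [pow_succ', mul_smul]
  exact smul_mem_of_mem ϖ hg

/-- Division modulo `ϖ` by lifts of a Gröbner basis does not increase the bounds. -/
theorem exists_division_step (hϖ : IsUniformizer ϖ)
    {J : Ideal (MvPolynomial (Fin n) (IsLocalRing.ResidueField (RInt K)))}
    {B : Finset (MvPolynomial (Fin n) (IsLocalRing.ResidueField (RInt K)))}
    (hB : ∀ P ∈ J, ∃ q : MvPolynomial (Fin n) _ → MvPolynomial (Fin n) _,
      P = ∑ b ∈ B, q b * b ∧ ∀ b ∈ B, q b ≠ 0 → (q b).totalDegree + b.totalDegree ≤ P.totalDegree)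
    {F : MvPolynomial (Fin n) (IsLocalRing.ResidueField (RInt K)) → T K n}
    (hF : ∀ b ∈ B, redT K n (F b) = b) (hr : 1 < r)
    (hFb : ∀ b ∈ B, Bdd (r ^ b.totalDegree) r (F b).1) {z : T K n} (hz : Bdd C r z.1)
    {P : MvPolynomial (Fin n) (IsLocalRing.ResidueField (RInt K))} (hP : P ∈ J)
    (hzP : redT K n z = P) :
    ∃ (q : MvPolynomial (Fin n) (IsLocalRing.ResidueField (RInt K)) → T K n) (z' : T K n),
      z = ∑ b ∈ B, q b * F b + ϖ • z' ∧ (∀ b ∈ B, Bdd C r (q b).1) ∧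
      Bdd (C / ‖(ϖ : K)‖) r z'.1 := by
  have hr0 : 0 < r := by positivity
  have hC : 0 ≤ C := hz.nonneg
  obtain ⟨q, hPq, hq⟩ : ∃ q : MvPolynomial (Fin n) (IsLocalRing.ResidueField (RInt K)) →
      MvPolynomial (Fin n) (IsLocalRing.ResidueField (RInt K)), P = ∑ b ∈ B, q b * b ∧
      ∀ b ∈ B, q b ≠ 0 → r ^ (q b).totalDegree * r ^ b.totalDegree ≤ C := by
    by_cases hP0 : P = 0
    · exact ⟨0, by simp [hP0], fun b _ h => (h rfl).elim⟩
    · obtain ⟨q, hPq, hq⟩ := hB P hP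
      refine ⟨q, hPq, fun b hb hqb => ?_⟩
      rw [← pow_add]
      exact (pow_le_pow_right₀ hr.le (hq b hb hqb)).trans (pow_totalDegree_le hzP hP0 hz)
  have hlift : ∀ b, ∃ g : T K n, redT K n g = q b ∧
      (b ∈ B → Bdd C r g.1 ∧ Bdd C r (g * F b).1) := by
    intro b
    by_cases hqb : q b = 0
    · refine ⟨0, by simp [hqb], fun _ => ⟨bdd_zero hC, ?_⟩⟩
      rw [zero_mul]
      exact bdd_zero hC
    · obtain ⟨g, hg, hgb⟩ := exists_lift (K := K) (q b)
      refine ⟨g, hg, fun hb => ⟨(hgb r hr.le).mono ?_ hr0.le le_rfl, ?_⟩⟩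
      · refine le_trans ?_ (hq b hb hqb)
        exact le_mul_of_one_le_right (by positivity) (one_le_pow₀ hr.le)
      · exact ((hgb r hr.le).mul (by positivity) (by positivity) hr0 (hFb b hb)).mono
          (hq b hb hqb) hr0.le le_rfl
  choose g hg hgb using hlift
  have hsum : Bdd C r (∑ b ∈ B, g b * F b).1 := by
    rw [AddSubmonoidClass.coe_finsetSum]
    exact Bdd.sum hC hr0 fun b hb => (hgb b hb).2
  have hred : redT K n (z - ∑ b ∈ B, g b * F b) = 0 := by
    rw [map_sub, hzP, map_sum, sub_eq_zero]
    conv_lhs => rw [hPq]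
    rw [← MvPolynomial.coeToMvPowerSeries.ringHom_apply, map_sum]
    refine Finset.sum_congr rfl fun b hb => ?_
    rw [map_mul, map_mul, hg, hF b hb]
    rfl
  obtain ⟨z', hz', hb'⟩ := exists_eq_smul_of_redT_eq_zero hϖ hr hred (hz.sub hr0 hsum)
  exact ⟨g, z', by rw [← hz']; ring, fun b hb => (hgb b hb).1, hb'⟩

/-- `z` lies in `I` modulo `ϖ^N`. -/
def MemMod (ϖ : RInt K) (I : Ideal (T K n)) (N : ℕ) (z : T K n) : Prop :=
  ∃ t : T K n, z - ϖ ^ N • t ∈ I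

/-- A family of lifts of Gröbner bases that divides, for all radii near one, the elements of
`(I + ϖ^N) : ϖ^e`; the family is independent of `e` for large `e`. -/
theorem exists_division (hϖ : IsUniformizer ϖ) (I : Ideal (T K n)) :
    ∃ (E : ℕ) (s : ℕ → Finset (T K n)), (∀ e, E ≤ e → s e = s E) ∧
      (∀ e, ∀ f ∈ s e, ϖ ^ e • f ∈ I) ∧
      ∀ᶠ r in 𝓝[>] (1 : ℝ), ∀ (e N : ℕ) (C : ℝ) (z : T K n), e < N →
        MemMod ϖ I N (ϖ ^ e • z) → Bdd C r z.1 →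
        ∃ (q : T K n → T K n) (z' : T K n), z = ∑ f ∈ s e, q f * f + ϖ • z' ∧
          (∀ f ∈ s e, Bdd C r (q f).1) ∧ Bdd (C / ‖(ϖ : K)‖) r z'.1 := by
  classical
  obtain ⟨E, hE⟩ := monotone_stabilizes_iff_noetherian.2
    (inferInstance : IsNoetherianRing (MvPolynomial (Fin n) (IsLocalRing.ResidueField (RInt K))))
    ⟨reductionIdeal ϖ I, reductionIdeal_mono ϖ I⟩
  change ∀ m, E ≤ m → reductionIdeal ϖ I E = reductionIdeal ϖ I m at hE
  choose B hBJ hB using fun e => exists_groebner (reductionIdeal ϖ I e)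
  have hlift : ∀ e b, ∃ f : T K n, b ∈ B e → ϖ ^ e • f ∈ I ∧ redT K n f = b := by
    intro e b
    by_cases hb : b ∈ B e
    · obtain ⟨f, hf⟩ := (hBJ e b hb).1
      exact ⟨f, fun _ => hf⟩
    · exact ⟨0, fun h => (hb h).elim⟩
  choose F hF using hlift
  have hinj : ∀ e, Set.InjOn (F e) (B e) := by
    intro e b hb c hc h
    refine MvPolynomial.coe_injective _ _ ?_
    rw [← (hF e b hb).2, ← (hF e c hc).2, h]
  have hev : ∀ᶠ r in 𝓝[>] (1 : ℝ), ∀ e ∈ Finset.range (E + 1), ∀ b ∈ B e,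
      Bdd (r ^ b.totalDegree) r (F e b).1 :=
    (Filter.eventually_all_finset _).2 fun e _ => (Filter.eventually_all_finset _).2 fun b hb =>
      eventually_bdd_pow_totalDegree (hF e b hb).2
  refine ⟨E, fun e => (B (min e E)).image (F (min e E)), fun e he => by simp [he], ?_, ?_⟩
  · intro e f hf
    obtain ⟨b, hb, rfl⟩ := Finset.mem_image.1 hf
    have := smul_mem_of_mem (ϖ ^ (e - min e E)) (hF _ b hb).1
    rwa [smul_smul, ← pow_add, Nat.sub_add_cancel (min_le_left _ _)] at this
  · filter_upwards [hev, self_mem_nhdsWithin] with r hr hr1 e N C z heN hz hzb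
    obtain ⟨P, hP⟩ := exists_redT_eq z
    have hPJ : P ∈ reductionIdeal ϖ I (min e E) := by
      have h1 : P ∈ reductionIdeal ϖ I e := by
        obtain ⟨t, ht⟩ := hz
        refine ⟨z - ϖ ^ (N - e) • t, ?_, ?_⟩
        · rwa [smul_sub, smul_smul, ← pow_add, Nat.add_sub_cancel' heN.le]
        · have hlt : ‖((ϖ ^ (N - e) : RInt K) : K)‖ < 1 := by
            rw [norm_pow_coe]
            exact pow_lt_one₀ (norm_nonneg _) hϖ.norm_lt_one (by omega)
          rw [map_sub, redT_smul hlt, sub_zero, hP]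
      rcases le_total e E with h | h
      · rwa [min_eq_left h]
      · rwa [min_eq_right h, hE e h]
    obtain ⟨q, z', hzq, hq, hz'⟩ := exists_division_step hϖ (hB (min e E))
      (F := F (min e E)) (fun b hb => (hF _ b hb).2) hr1
      (hr _ (Finset.mem_range.2 (by omega))) hzb hPJ hP
    refine ⟨fun f => q (Function.invFunOn (F (min e E)) (B (min e E)) f), z', ?_, ?_, hz'⟩
    · rw [Finset.sum_image (hinj _), hzq]
      congr 1
      refine Finset.sum_congr rfl fun b hb => ?_
      have hb' := (hinj (min e E)).leftInvOn_invFunOn (Finset.mem_coe.2 hb)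
      simp only [hb']
    · intro f hf
      exact hq _ (Function.invFunOn_mem (by simpa using hf))

theorem MemMod.of_division {I : Ideal (T K n)} {e N : ℕ} {z z' : T K n} {s : Finset (T K n)}
    {q : T K n → T K n} (hs : ∀ f ∈ s, ϖ ^ e • f ∈ I) (h : z = ∑ f ∈ s, q f * f + ϖ • z')
    (hz : MemMod ϖ I N (ϖ ^ e • z)) : MemMod ϖ I N (ϖ ^ (e + 1) • z') ∧
      ϖ ^ e • z - ϖ ^ (e + 1) • z' ∈ I := by
  have h1 : ϖ ^ e • z - ϖ ^ (e + 1) • z' ∈ I := by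
    rw [h, smul_add, smul_smul, ← pow_succ, add_sub_cancel_right, Finset.smul_sum]
    refine I.sum_mem fun f hf => ?_
    rw [← mul_smul_comm]
    exact I.mul_mem_left _ (hs f hf)
  obtain ⟨t, ht⟩ := hz
  refine ⟨⟨t, ?_⟩, h1⟩
  have := I.sub_mem ht h1
  rwa [sub_sub_sub_cancel_left] at this

/-- Membership in `I + ϖ^N` with control of the growth of the cofactor of `ϖ^N`. -/
theorem eventually_exists_cofactor (hϖ : IsUniformizer ϖ) (I : Ideal (T K n)) :
    ∀ᶠ r in 𝓝[>] (1 : ℝ), ∀ (N : ℕ) (C : ℝ) (z : T K n), MemMod ϖ I N z → Bdd C r z.1 →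
      ∃ y : T K n, z - ϖ ^ N • y ∈ I ∧ Bdd (C / ‖(ϖ : K)‖ ^ N) r y.1 := by
  obtain ⟨E, s, -, hs, hdiv⟩ := exists_division hϖ I
  filter_upwards [hdiv] with r hr N C z hz hzb
  have key : ∀ e, e ≤ N → ∃ y : T K n, z - ϖ ^ e • y ∈ I ∧ Bdd (C / ‖(ϖ : K)‖ ^ e) r y.1 ∧
      MemMod ϖ I N (ϖ ^ e • y) := by
    intro e
    induction e with
    | zero => exact fun _ => ⟨z, by simp, by simpa using hzb, by simpa using hz⟩
    | succ e ih =>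
      intro he
      obtain ⟨y, hy, hyb, hym⟩ := ih (by omega)
      obtain ⟨q, z', h1, -, h3⟩ := hr e N _ y (by omega) hym hyb
      obtain ⟨h4, h5⟩ := MemMod.of_division (hs e) h1 hym
      refine ⟨z', ?_, ?_, h4⟩
      · have := I.add_mem hy h5
        rwa [sub_add_sub_cancel] at this
      · rwa [pow_succ, ← div_div]
  obtain ⟨y, hy, hyb, -⟩ := key N le_rfl
  exact ⟨y, hy, hyb⟩

/-- Ideals of overconvergent series are closed for the `ϖ`-adic topology. -/
theorem mem_of_forall_memMod [CompleteSpace K] (hϖ : IsUniformizer ϖ) {I : Ideal (T K n)}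
    {z : T K n} (hz : ∀ N, MemMod ϖ I N z) : z ∈ I := by
  obtain ⟨E, s, hsE, hs, hdiv⟩ := exists_division hϖ I
  obtain ⟨r, ⟨hr, hcof, C, -, hzb⟩, hr1⟩ := ((hdiv.and ((eventually_exists_cofactor hϖ I).and
    (exists_bdd z))).and self_mem_nhdsWithin).exists
  obtain ⟨y₀, hy₀, hyb₀⟩ := hcof E C z (hz E) hzb
  set D := C / ‖(ϖ : K)‖ ^ E
  -- from the exponent `E` on, each step divides by the same finite family `s E`, so the quotients
  -- of all steps can be summed to convergent series
  set Inv : ℕ → T K n → Prop := fun i y =>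
    Bdd (D * ‖(ϖ : K)‖⁻¹ ^ i) r y.1 ∧ ∀ N, MemMod ϖ I N (ϖ ^ (E + i) • y)
  have hstep : ∀ i y, Inv i y → ∃ (q : T K n → T K n) (y' : T K n),
      y = ∑ f ∈ s E, q f * f + ϖ • y' ∧ (∀ f ∈ s E, Bdd (D * ‖(ϖ : K)‖⁻¹ ^ i) r (q f).1) ∧
      Inv (i + 1) y' := by
    rintro i y ⟨hb, hm⟩
    obtain ⟨q, y', h1, h2, h3⟩ := hr (E + i) (E + i + 1) _ y (by omega) (hm _) hb
    rw [hsE (E + i) (by omega)] at h1 h2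
    refine ⟨q, y', h1, h2, ?_, fun N => ?_⟩
    · rwa [pow_succ, ← mul_assoc, ← div_eq_mul_inv]
    · refine (MemMod.of_division ?_ h1 (hm N)).1
      have := hs (E + i)
      rwa [hsE (E + i) (by omega)] at this
  choose! q next hq hqb hnext using hstep
  let y : ℕ → T K n := fun i => Nat.rec y₀ (fun i y => next i y) i
  have hy : ∀ i, Inv i (y i) := by
    intro i
    induction i with
    | zero =>
      refine ⟨by rw [pow_zero, mul_one]; exact hyb₀, fun N => ?_⟩
      obtain ⟨t, ht⟩ := hz N
      refine ⟨t, ?_⟩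
      have := I.sub_mem ht hy₀
      rwa [sub_sub_sub_cancel_left] at this
    | succ i ih => exact hnext i _ ih
  have hsum : ∀ f : T K n, ∃ S : T K n, f ∈ s E → ∀ N, ∃ S' : T K n,
      S = ∑ l ∈ Finset.range N, ϖ ^ l • q l (y l) f + ϖ ^ N • S' := by
    intro f
    by_cases hf : f ∈ s E
    · obtain ⟨S, hS⟩ := exists_sum hϖ.norm_lt_one (inv_nonneg.2 (norm_nonneg (ϖ : K))) hr1
        (fun l => q l (y l) f) fun l => hqb l _ (hy l) f hf
      exact ⟨S, fun _ => hS⟩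
    · exact ⟨0, fun h => (hf h).elim⟩
  choose S hS using hsum
  have hy0 : ∀ N, y 0 = ∑ l ∈ Finset.range N, ϖ ^ l • ∑ f ∈ s E, q l (y l) f * f + ϖ ^ N • y N := by
    intro N
    induction N with
    | zero => simp
    | succ N ih =>
      rw [ih, Finset.sum_range_succ, add_assoc, pow_succ, mul_smul, ← smul_add]
      congr 2
      exact hq N _ (hy N)
  have hyS : y 0 = ∑ f ∈ s E, S f * f := by
    rw [← sub_eq_zero]
    refine Subtype.ext (eq_zero_of_forall_dvd hϖ.norm_lt_one fun N => ?_)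
    choose! S' hS' using fun f hf => hS f hf N
    refine ⟨(y N - ∑ f ∈ s E, S' f * f).1, ?_⟩
    rw [← Subalgebra.coe_smul]
    congr 1
    have hsub : ∑ f ∈ s E, S f * f =
        ∑ f ∈ s E, (∑ l ∈ Finset.range N, ϖ ^ l • q l (y l) f + ϖ ^ N • S' f) * f :=
      Finset.sum_congr rfl fun f hf => by rw [hS' f hf]
    rw [hy0 N, hsub]
    simp only [add_mul, Finset.sum_add_distrib, Finset.sum_mul, smul_sub, Finset.smul_sum,
      smul_mul_assoc]
    rw [Finset.sum_comm (s := s E)]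
    ring
  have hfin : ϖ ^ E • y 0 ∈ I := by
    rw [hyS, Finset.smul_sum]
    refine I.sum_mem fun f hf => ?_
    rw [← mul_smul_comm]
    exact I.mul_mem_left _ (hs E f hf)
  have := I.add_mem hy₀ hfin
  change z - ϖ ^ E • y₀ + ϖ ^ E • y₀ ∈ I at this
  rwa [sub_add_cancel] at this

end

/-! ### Separatedness of weakly complete algebras and of their localizations -/

/-- `T_{n+1}†` as power series in the last variable, as a subring of all power series in `n + 1`
variables. -/
def tsuccToMvPowerSeries (n : ℕ) :
    PowerSeries (T K n) →+* MvPowerSeries (Fin (n + 1)) (RInt K) :=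
  (MvPowerSeries.finSuccEquiv (RInt K) n).symm.toRingEquiv.toRingHom.comp
    (PowerSeries.map (T K n).val.toRingHom)

theorem coeff_tsuccToMvPowerSeries {n : ℕ} (G : PowerSeries (T K n)) (v : Fin (n + 1) →₀ ℕ) :
    MvPowerSeries.coeff v (tsuccToMvPowerSeries n G) =
      MvPowerSeries.coeff v.tail (PowerSeries.coeff (v 0) G : T K n).1 := by
  conv_lhs => rw [← Finsupp.cons_tail v]
  rw [← MvPowerSeries.coeff_coeff_finSuccEquiv]
  have : MvPowerSeries.finSuccEquiv (RInt K) n (tsuccToMvPowerSeries n G) =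
      PowerSeries.map (T K n).val.toRingHom G :=
    AlgEquiv.apply_symm_apply _ _
  rw [this, PowerSeries.coeff_map]
  rfl

theorem degree_eq_tail_add {n : ℕ} (v : Fin (n + 1) →₀ ℕ) :
    v.degree = v.tail.degree + v 0 := by
  rw [Finsupp.degree_eq_sum, Finsupp.degree_eq_sum, Fin.sum_univ_succ, add_comm]
  rfl

theorem tsuccToMvPowerSeries_mem {n : ℕ} {G : PowerSeries (T K n)} (hG : G ∈ TSucc K n) :
    tsuccToMvPowerSeries n G ∈ T K (n + 1) := by
  obtain ⟨C, r, hC, hr, hb⟩ := exists_pbdd hG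
  refine mem_T_of_bdd (C := C) hr fun v => ?_
  rw [coeff_tsuccToMvPowerSeries, degree_eq_tail_add]
  exact (pbdd_iff (by positivity)).1 hb (v.tail, v 0)

/-- The two descriptions of overconvergent series in `n + 1` variables agree. -/
theorem exists_ringHom_TSucc (n : ℕ) : ∃ e : T K (n + 1) →+* TSucc K n, Function.Surjective e ∧
    ∀ c : RInt K, e (algebraMap (RInt K) (T K (n + 1)) c) =
      ⟨PowerSeries.C (algebraMap (RInt K) (T K n) c), C_mem_TSucc _⟩ := by
  let f : TSucc K n →+* T K (n + 1) :=
    ((tsuccToMvPowerSeries n).comp (TSucc K n).subtype).codRestrict (T K (n + 1)).toSubring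
      fun G => tsuccToMvPowerSeries_mem G.2
  have hf : ∀ (G : TSucc K n) v, MvPowerSeries.coeff v (f G).1 =
      MvPowerSeries.coeff v.tail (PowerSeries.coeff (v 0) G.1 : T K n).1 :=
    fun G v => coeff_tsuccToMvPowerSeries G.1 v
  have hinj : Function.Injective f := by
    intro G H h
    ext1
    ext1 j
    ext1
    ext1 v
    have := congrArg (fun x : T K (n + 1) => MvPowerSeries.coeff (v.cons j) x.1) h
    simpa only [hf, Finsupp.tail_cons, Finsupp.cons_zero] using this
  have hsurj : Function.Surjective f := by
    intro g
    obtain ⟨t, ht, hg⟩ := g.2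
    obtain ⟨C, hC, hb⟩ := bdd_of_tendsto hg
    let G' : ℕ → MvPowerSeries (Fin n) (RInt K) := fun j v => MvPowerSeries.coeff (v.cons j) g.1
    have hG' : ∀ j v, MvPowerSeries.coeff v (G' j) = MvPowerSeries.coeff (v.cons j) g.1 :=
      fun j v => rfl
    have hdeg : ∀ (v : Fin n →₀ ℕ) (j : ℕ), (v.cons j).degree = v.degree + j := by
      intro v j
      rw [degree_eq_tail_add, Finsupp.tail_cons, Finsupp.cons_zero]
    have hGb : ∀ j, Bdd C t (G' j) := by
      intro j v
      refine le_trans ?_ (hb (v.cons j))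
      rw [hG', hdeg]
      have := pow_le_pow_right₀ ht.le (Nat.le_add_right v.degree j)
      gcongr
    let G : PowerSeries (T K n) := PowerSeries.mk fun j => ⟨G' j, mem_T_of_bdd ht (hGb j)⟩
    have hG : G ∈ TSucc K n := by
      refine mem_TSucc_of_pbdd (C := C) ht ((pbdd_iff (by positivity)).2 fun vj => ?_)
      rw [PowerSeries.coeff_mk]
      change ‖((MvPowerSeries.coeff vj.1 (G' vj.2) : RInt K) : K)‖ * _ ≤ C
      rw [hG', ← hdeg]
      exact hb _
    refine ⟨⟨G, hG⟩, ?_⟩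
    ext1
    ext1 v
    rw [hf]
    change MvPowerSeries.coeff v.tail (PowerSeries.coeff (v 0) (PowerSeries.mk fun j =>
      (⟨G' j, mem_T_of_bdd ht (hGb j)⟩ : T K n))).1 = _
    rw [PowerSeries.coeff_mk]
    change MvPowerSeries.coeff v.tail (G' (v 0)) = _
    rw [hG', Finsupp.cons_tail]
  let e := RingEquiv.ofBijective f ⟨hinj, hsurj⟩
  refine ⟨e.symm.toRingHom, e.symm.surjective, fun c => ?_⟩
  refine e.symm_apply_eq.2 ?_
  change _ = f _
  ext1
  change algebraMap (RInt K) (MvPowerSeries (Fin (n + 1)) (RInt K)) c =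
    (MvPowerSeries.finSuccEquiv (RInt K) n).symm (PowerSeries.map (T K n).val.toRingHom
      (PowerSeries.C (algebraMap _ _ c)))
  rw [PowerSeries.map_C, AlgEquiv.eq_symm_apply]
  exact MvPowerSeries.finSuccEquiv_C c

theorem eq_zero_of_surjective [CompleteSpace K] {ϖ : RInt K} (hϖ : IsUniformizer ϖ) {n : ℕ}
    {S : Type*} [CommRing S] (φ : T K n →+* S) (hφ : Function.Surjective φ) {x : S}
    (hx : ∀ N, φ (algebraMap _ _ (ϖ ^ N)) ∣ x) : x = 0 := by
  obtain ⟨z, rfl⟩ := hφ x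
  refine RingHom.mem_ker.1 (mem_of_forall_memMod hϖ fun N => ?_)
  obtain ⟨y, hy⟩ := hx N
  obtain ⟨t, rfl⟩ := hφ y
  refine ⟨t, RingHom.mem_ker.2 ?_⟩
  rw [Algebra.smul_def, map_sub, hy, map_mul, sub_self]

namespace Presentation

variable {A : Type u} [CommRing A] [Algebra (RInt K) A] (P : Presentation K A)

/-- The image in `A⟨f⁻¹⟩†` of a scalar. -/
def locConst (f : A) : RInt K →+* P.Loc f :=
  (P.proj f).comp (P.C.comp (algebraMap (RInt K) A))

theorem locConst_apply (f : A) (c : RInt K) :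
    P.locConst f c = P.proj f (P.C (algebraMap (RInt K) A c)) := rfl

theorem trans_proj_C {f g : A} (c : A) (h : g = f * c) (a : A) :
    P.trans c h (P.proj f (P.C a)) = P.proj g (P.C a) := by
  rw [trans_proj, scale_C]

theorem trans_locConst {f g : A} (c : A) (h : g = f * c) (d : RInt K) :
    P.trans c h (P.locConst f d) = P.locConst g d := P.trans_proj_C c h _

include P in
theorem eq_zero_of_forall_dvd [CompleteSpace K] {ϖ : RInt K} (hϖ : IsUniformizer ϖ) {a : A}
    (h : ∀ N, algebraMap (RInt K) A (ϖ ^ N) ∣ a) : a = 0 := by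
  refine eq_zero_of_surjective hϖ (P.φ : T K P.n →+* A) P.surjective fun N => ?_
  rw [RingHom.coe_coe, AlgHom.commutes]
  exact h N

/-- The map from `T_{n+1}†` onto `A⟨ξ⟩†`. -/
def tsuccToOver : TSucc K P.n →+* P.Over :=
  ((PowerSeries.map (P.φ : T K P.n →+* A)).comp (TSucc K P.n).subtype).codRestrict P.Over
    fun G => ⟨G.1, G.2, rfl⟩

theorem tsuccToOver_surjective : Function.Surjective P.tsuccToOver := by
  rintro ⟨_, G, hG, rfl⟩
  exact ⟨⟨G, hG⟩, rfl⟩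

theorem loc_eq_zero_of_forall_dvd [CompleteSpace K] {ϖ : RInt K} (hϖ : IsUniformizer ϖ) {f : A}
    {x : P.Loc f} (h : ∀ N, P.locConst f (ϖ ^ N) ∣ x) : x = 0 := by
  obtain ⟨e, he, hc⟩ := exists_ringHom_TSucc (K := K) P.n
  refine eq_zero_of_surjective hϖ ((P.proj f).comp (P.tsuccToOver.comp e))
    (Ideal.Quotient.mk_surjective.comp (P.tsuccToOver_surjective.comp he)) fun N => ?_
  convert h N using 1
  rw [locConst_apply, RingHom.comp_apply, RingHom.comp_apply, hc]
  congr 1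
  ext1
  change PowerSeries.map (P.φ : T K P.n →+* A) (PowerSeries.C _) = PowerSeries.C _
  rw [PowerSeries.map_C, RingHom.coe_coe, AlgHom.commutes]

theorem over_coeff_dvd (g : P.Over) {c : RInt K} (hc : c ≠ 0) :
    ∃ M : ℕ, ∀ j, M ≤ j → algebraMap (RInt K) A c ∣ PowerSeries.coeff j g.1 := by
  obtain ⟨G, hG, hg⟩ := g.2
  obtain ⟨M, hM⟩ := eventually_small hG hc
  refine ⟨M, fun j hj => ?_⟩
  obtain ⟨x, hx⟩ := hM j hj
  refine ⟨P.φ x, ?_⟩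
  rw [← hg, PowerSeries.coeff_map, hx, RingHom.coe_coe, map_smul, Algebra.smul_def]

/-- The coefficients of the multiples of `f ξ - 1`. -/
theorem coeff_relation (f : A) (H : PowerSeries A) (j : ℕ) :
    PowerSeries.coeff j ((PowerSeries.C f * PowerSeries.X - 1) * H) =
      (if j = 0 then 0 else f * PowerSeries.coeff (j - 1) H) - PowerSeries.coeff j H := by
  rw [sub_mul, one_mul, map_sub, mul_assoc, PowerSeries.coeff_C_mul]
  cases j with
  | zero => simp
  | succ j => simp [PowerSeries.coeff_succ_X_mul]

/-- Modulo `c`, the ring `A⟨g⁻¹⟩†` is the localization of `A` at `g`. -/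
theorem exists_pow_mul_dvd {c : RInt K} (hc : c ≠ 0) {g a : A}
    (h : P.locConst g c ∣ P.proj g (P.C a)) : ∃ L : ℕ, algebraMap (RInt K) A c ∣ g ^ L * a := by
  obtain ⟨y, hy⟩ := h
  obtain ⟨y, rfl⟩ := Ideal.Quotient.mk_surjective y
  change P.proj g (P.C a) = P.proj g (P.C (algebraMap (RInt K) A c)) * P.proj g y at hy
  rw [← map_mul, Ideal.Quotient.mk_eq_mk_iff_sub_mem, Ideal.mem_span_singleton] at hy
  obtain ⟨H, hH⟩ := hy
  have h1 : ∀ j, PowerSeries.coeff j (PowerSeries.C a - PowerSeries.C (algebraMap (RInt K) A c) * y.1) =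
      (if j = 0 then 0 else g * PowerSeries.coeff (j - 1) H.1) - PowerSeries.coeff j H.1 := by
    intro j
    rw [← coeff_relation]
    exact congrArg (PowerSeries.coeff j) (congrArg Subtype.val hH)
  have h2 : ∀ j, algebraMap (RInt K) A c ∣ PowerSeries.coeff j H.1 + g ^ j * a := by
    intro j
    induction j with
    | zero =>
      refine ⟨PowerSeries.coeff 0 y.1, ?_⟩
      have := h1 0
      rw [map_sub, PowerSeries.coeff_C_mul, PowerSeries.coeff_C, if_pos rfl, if_pos rfl] at this
      linear_combination this
    | succ j ih =>
      obtain ⟨d, hd⟩ := ih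
      refine ⟨g * d + PowerSeries.coeff (j + 1) y.1, ?_⟩
      have := h1 (j + 1)
      rw [map_sub, PowerSeries.coeff_C_mul, PowerSeries.coeff_C, if_neg (Nat.succ_ne_zero j),
        if_neg (Nat.succ_ne_zero j), Nat.add_sub_cancel] at this
      linear_combination this + g * hd
  obtain ⟨M, hM⟩ := P.over_coeff_dvd H hc
  exact ⟨M, (dvd_add_right (hM M le_rfl)).1 (h2 M)⟩

theorem dvd_of_red_eq_zero {ϖ : RInt K} (hϖ : IsUniformizer ϖ) {a : A} (h : red K a = 0) :
    algebraMap (RInt K) A ϖ ∣ a := by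
  let f : IsLocalRing.maximalIdeal (RInt K) →ₗ[RInt K] RInt K :=
    (IsLocalRing.maximalIdeal (RInt K)).subtype
  let g : RInt K →ₗ[RInt K] IsLocalRing.ResidueField (RInt K) := Algebra.linearMap _ _
  have hfg : Function.Exact f g := by
    intro c
    change IsLocalRing.residue (RInt K) c = 0 ↔ _
    rw [IsLocalRing.residue_eq_zero_iff]
    exact ⟨fun h => ⟨⟨c, h⟩, rfl⟩, by rintro ⟨d, rfl⟩; exact d.2⟩
  have hex := lTensor_exact A hfg IsLocalRing.residue_surjective
  have h1 : g.lTensor A (a ⊗ₜ 1) = 0 := by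
    rw [LinearMap.lTensor_tmul]
    change a ⊗ₜ[RInt K] (algebraMap (RInt K) (IsLocalRing.ResidueField (RInt K)) 1) = 0
    rw [map_one]
    exact h
  obtain ⟨t, ht⟩ := (hex _).1 h1
  have h2 : ∀ t, algebraMap (RInt K) A ϖ ∣ TensorProduct.rid (RInt K) A (f.lTensor A t) := by
    intro t
    induction t using TensorProduct.induction_on with
    | zero => rw [map_zero, map_zero]; exact dvd_zero _
    | tmul b c =>
      have hc : ‖((c : RInt K) : K)‖ < 1 := by
        rw [← residue_eq_zero_iff_norm, IsLocalRing.residue_eq_zero_iff]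
        exact c.2
      obtain ⟨d, hd⟩ := hϖ.dvd _ hc
      rw [LinearMap.lTensor_tmul, TensorProduct.rid_tmul]
      change _ ∣ (c : RInt K) • b
      rw [hd, Algebra.smul_def, map_mul, mul_assoc]
      exact dvd_mul_right _ _
    | add x y hx hy => rw [map_add, map_add]; exact dvd_add hx hy
  have h3 := h2 t
  rwa [ht, TensorProduct.rid_tmul, one_smul] at h3

/-- A section of `A⟨h⁻¹⟩†` whose germs are all divisible by `ϖ^N` is itself divisible. -/
theorem loc_dvd_of_germ_dvd {ϖ : RInt K} (hϖ : IsUniformizer ϖ) {h : A} (N : ℕ) {x : P.Loc h}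
    (hx : ∀ (q : P.Pt) (hq : q ∈ P.basic h), P.germ h q hq (P.locConst h (ϖ ^ N)) ∣ P.germ h q hq x) :
    P.locConst h (ϖ ^ N) ∣ x := by
  have hc : ϖ ^ N ≠ 0 := pow_ne_zero _ hϖ.ne_zero
  obtain ⟨M, a, y, e⟩ := P.decomp hc x
  have hu : IsUnit (P.proj h (P.C h) ^ M) := (P.isUnit_proj_C h).pow M
  suffices hs : ∃ m : ℕ, algebraMap (RInt K) A (ϖ ^ N) ∣ h ^ m * a by
    obtain ⟨m, d, hd⟩ := hs
    have h1 : P.locConst h (ϖ ^ N) ∣ P.proj h (P.C h) ^ m * P.proj h (P.C a) := by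
      refine ⟨P.proj h (P.C d), ?_⟩
      rw [locConst_apply, ← map_pow, ← map_pow, ← map_mul, ← map_mul, ← map_mul, ← map_mul, hd]
    have h2 := ((P.isUnit_proj_C h).pow m).dvd_mul_left.1 h1
    refine hu.dvd_mul_left.1 ?_
    rw [e]
    exact dvd_add h2 (dvd_mul_right _ _)
  -- the elements `d` of `A` for which `d a` is divisible form an ideal
  let 𝔞 : Ideal A := Submodule.comap (LinearMap.mulRight A a) (Ideal.span {algebraMap (RInt K) A (ϖ ^ N)})
  have h𝔞 : ∀ d, d ∈ 𝔞 ↔ algebraMap (RInt K) A (ϖ ^ N) ∣ d * a := fun d => by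
    change d * a ∈ Ideal.span _ ↔ _
    rw [Ideal.mem_span_singleton]
  have hloc : ∀ q : P.Pt, q ∈ P.basic h → ∃ d ∈ 𝔞, q ∈ P.basic d := by
    intro q hq
    obtain ⟨s, hs⟩ : P.germ h q hq (P.locConst h (ϖ ^ N)) ∣ P.germ h q hq (P.proj h (P.C a)) := by
      have h1 := Dvd.dvd.mul_left (hx q hq) (P.germ h q hq (P.proj h (P.C h) ^ M))
      rw [← map_mul, e, map_add, map_mul] at h1
      exact (dvd_add_left (dvd_mul_right _ _)).1 h1
    obtain ⟨f, hf, y', rfl⟩ := P.exists_germ q s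
    have hg : q ∈ P.basic (h * f) := P.mem_basic_mul.2 ⟨hq, hf⟩
    rw [← P.germ_trans f rfl q hq hg, ← P.germ_trans f rfl q hq hg, trans_proj_C, trans_locConst,
      ← P.germ_trans h (mul_comm h f) q hf hg, ← map_mul, germ_eq_iff] at hs
    obtain ⟨c', hc', hs⟩ := hs
    rw [trans_proj_C, map_mul (P.trans c' _), trans_locConst] at hs
    obtain ⟨L, hL⟩ := P.exists_pow_mul_dvd hc ⟨_, hs⟩
    refine ⟨_, (h𝔞 _).2 hL, ?_⟩
    intro hm
    rw [map_pow] at hm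
    exact hc' (q.isPrime.mem_of_pow_mem L hm)
  have hrad : red K h ∈ (𝔞.map (red K)).radical := by
    rw [Ideal.radical_eq_sInf, Submodule.mem_sInf]
    rintro 𝔭 ⟨h𝔭, hp⟩
    by_contra hn
    obtain ⟨d, hd, hqd⟩ := hloc ⟨𝔭, hp⟩ hn
    exact hqd (h𝔭 (Ideal.mem_map_of_mem _ hd))
  obtain ⟨m, hm⟩ := hrad
  rw [← map_pow, Ideal.mem_map_iff_of_surjective _ (red_surjective K)] at hm
  obtain ⟨d, hd, hdm⟩ := hm
  obtain ⟨t, ht⟩ := dvd_of_red_eq_zero hϖ (a := h ^ m - d) (by rw [map_sub, hdm, sub_self])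
  -- `h^m` is `ϖ t` up to an element of `𝔞`, and `(ϖ t)^N` lies in `𝔞`
  refine ⟨m * N, (h𝔞 _).1 ?_⟩
  rw [pow_mul, sub_eq_iff_eq_add.1 ht]
  have hI : ∀ k, (algebraMap (RInt K) A ϖ * t + d) ^ k - (algebraMap (RInt K) A ϖ * t) ^ k ∈ 𝔞 := by
    intro k
    obtain ⟨w, hw⟩ := sub_dvd_pow_sub_pow (algebraMap (RInt K) A ϖ * t + d)
      (algebraMap (RInt K) A ϖ * t) k
    rw [hw, add_sub_cancel_left]
    exact 𝔞.mul_mem_right _ hd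
  have h1 : (algebraMap (RInt K) A ϖ * t) ^ N ∈ 𝔞 := by
    rw [h𝔞, mul_pow, map_pow, mul_assoc]
    exact dvd_mul_right _ _
  have := 𝔞.add_mem (hI N) h1
  rwa [sub_add_cancel] at this

/-- The germs of an element of `A⟨h⁻¹⟩†` determine it. -/
theorem loc_eq_zero_of_germ_dvd [CompleteSpace K] {ϖ : RInt K} (hϖ : IsUniformizer ϖ) {h : A}
    {x : P.Loc h} (hx : ∀ (N : ℕ) (q : P.Pt) (hq : q ∈ P.basic h),
      P.germ h q hq (P.locConst h (ϖ ^ N)) ∣ P.germ h q hq x) : x = 0 :=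
  P.loc_eq_zero_of_forall_dvd hϖ fun N => P.loc_dvd_of_germ_dvd hϖ N (hx N)

theorem loc_ext [CompleteSpace K] {ϖ : RInt K} (hϖ : IsUniformizer ϖ) {h : A} {x y : P.Loc h}
    (hxy : ∀ (q : P.Pt) (hq : q ∈ P.basic h), P.germ h q hq x = P.germ h q hq y) : x = y := by
  rw [← sub_eq_zero]
  refine P.loc_eq_zero_of_germ_dvd hϖ fun N q hq => ?_
  rw [map_sub, hxy, sub_self]
  exact dvd_zero _

/-- The map from `A` to the germs at `q`. -/
def stalkC (q : P.Pt) : A →+* P.Stalk q :=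
  (P.germ 1 q (P.mem_basic_one q)).comp ((P.proj 1).comp P.C)

theorem germ_proj_C (f a : A) (q : P.Pt) (hq : q ∈ P.basic f) :
    P.germ f q hq (P.proj f (P.C a)) = P.stalkC q a := by
  change _ = P.germ 1 q _ (P.proj 1 (P.C a))
  rw [← P.germ_trans f (one_mul f).symm q (P.mem_basic_one q) hq, trans_proj_C]

theorem eq_of_stalkC_eq [CompleteSpace K] {ϖ : RInt K} (hϖ : IsUniformizer ϖ) {a b : A}
    (h : ∀ q, P.stalkC q a = P.stalkC q b) : a = b := by
  rw [← sub_eq_zero]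
  refine P.eq_zero_of_forall_dvd hϖ fun N => ?_
  have h1 : P.proj 1 (P.C (a - b)) = 0 := by
    rw [map_sub, map_sub, sub_eq_zero]
    exact P.loc_ext hϖ fun q hq => by rw [germ_proj_C, germ_proj_C, h]
  obtain ⟨L, hL⟩ := P.exists_pow_mul_dvd (pow_ne_zero N hϖ.ne_zero) (h1 ▸ dvd_zero _)
  rwa [one_pow, one_mul] at hL

end Presentation

/-! ### Gluing -/

theorem exists_linear_le {t C r : ℝ} (ht : 0 < t) (hr : 1 < r) :
    ∃ κ : ℕ, ∀ N d : ℕ, κ * (N + 1) ≤ d → C ≤ t ^ N * r ^ d := by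
  obtain ⟨κ, hκ⟩ := pow_unbounded_of_one_lt (max C t⁻¹) hr
  have hκ1 : C ≤ r ^ κ := (le_max_left _ _).trans hκ.le
  have hκ2 : t⁻¹ ≤ r ^ κ := (le_max_right _ _).trans hκ.le
  refine ⟨κ, fun N d hd => ?_⟩
  calc C ≤ r ^ κ := hκ1
    _ = t ^ N * (t⁻¹ ^ N * r ^ κ) := by rw [inv_pow, mul_inv_cancel_left₀ (by positivity)]
    _ ≤ t ^ N * ((r ^ κ) ^ N * r ^ κ) := by gcongr
    _ = t ^ N * r ^ (κ * (N + 1)) := by rw [pow_mul, pow_succ]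
    _ ≤ t ^ N * r ^ d := by
      gcongr
      exact hr.le

/-- The coefficients of an overconvergent series become divisible by `ϖ^N` at a rate that is linear
in `N`. -/
theorem exists_linear_dvd_coeff {ϖ : RInt K} (hϖ0 : ϖ ≠ 0) {n : ℕ} {G : PowerSeries (T K n)}
    (hG : G ∈ TSucc K n) : ∃ κ : ℕ, ∀ N j (v : Fin n →₀ ℕ), κ * (N + 1) ≤ v.degree + j →
      ϖ ^ N ∣ MvPowerSeries.coeff v (PowerSeries.coeff j G : T K n).1 := by
  obtain ⟨C, r, hC, hr, hb⟩ := exists_pbdd hG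
  obtain ⟨κ, hκ⟩ := exists_linear_le (norm_pos_of_ne_zero hϖ0) hr
  refine ⟨κ, fun N j v hj => dvd_of_norm_le (pow_ne_zero N hϖ0) ?_⟩
  have h1 := ((pbdd_iff (by positivity)).1 hb (v, j)).trans (hκ N _ hj)
  rw [norm_pow_coe]
  exact le_of_mul_le_mul_right h1 (by positivity)

theorem exists_eq_smul_of_dvd {c : RInt K} (hc : c ≠ 0) {n : ℕ} {g : T K n}
    (h : ∀ v, c ∣ MvPowerSeries.coeff v g.1) : ∃ x : T K n, g = c • x := by
  obtain ⟨x, hx, hb⟩ := exists_eq_smul hc h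
  obtain ⟨r, ⟨C, -, hC⟩, hr⟩ := ((exists_bdd g).and self_mem_nhdsWithin).exists
  exact ⟨⟨x, mem_T_of_bdd hr (hb hC)⟩, Subtype.ext hx⟩

theorem exists_linear_dvd {ϖ : RInt K} (hϖ0 : ϖ ≠ 0) {n : ℕ} {G : PowerSeries (T K n)}
    (hG : G ∈ TSucc K n) : ∃ κ : ℕ, ∀ N j, κ * (N + 1) ≤ j →
      ∃ y : T K n, PowerSeries.coeff j G = ϖ ^ N • y := by
  obtain ⟨κ, hκ⟩ := exists_linear_dvd_coeff hϖ0 hG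
  exact ⟨κ, fun N j hj => exists_eq_smul_of_dvd (pow_ne_zero N hϖ0) fun v =>
    hκ N j v (hj.trans (Nat.le_add_left _ _))⟩

/-- The binomial expansion, split into a multiple of `x^M` and a multiple of `y^L`. -/
theorem add_pow_split {S : Type*} [CommRing S] (x y : S) (M L : ℕ) :
    (x + y) ^ (M + L) =
      x ^ M * ∑ j ∈ Finset.range (L + 1), ((M + L).choose (M + j) : S) * (x ^ j * y ^ (L - j)) +
      y ^ L * ∑ j ∈ Finset.range M, ((M + L).choose j : S) * (x ^ j * y ^ (M - j)) := by
  rw [add_pow, add_assoc, Finset.sum_range_add, add_comm, Finset.mul_sum, Finset.mul_sum]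
  congr 1
  · refine Finset.sum_congr rfl fun j hj => ?_
    have := Finset.mem_range.1 hj
    rw [show M + L - (M + j) = L - j by omega, pow_add]
    ring
  · refine Finset.sum_congr rfl fun j hj => ?_
    have := Finset.mem_range.1 hj
    rw [show M + L - j = L + (M - j) by omega, pow_add]
    ring

theorem Bdd.natCast_mul {n : ℕ} {C r : ℝ} (hr : 0 < r) {g : T K n} (hg : Bdd C r g.1) (m : ℕ) :
    Bdd C r ((m : T K n) * g).1 := by
  have := hg.smul hr (m : RInt K)
  convert this using 1
  rw [← Subalgebra.coe_smul, Algebra.smul_def, map_natCast]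

/-- A power of `∑ g_i h_i` with exponent linear in `M` is a combination `∑ G_i h_i^M` in which the
exponent of the growth of `G_i` is linear in `M`. For a relation `∑ g_i h_i = 1` this is a partition
of unity by the `h_i^M`. -/
theorem exists_sum_mul_pow {n : ℕ} {C r : ℝ} (hC : 1 ≤ C) (hr : 0 < r) {ι : Type*} (t : Finset ι)
    (g h : ι → T K n) (hg : ∀ i ∈ t, Bdd C r (g i).1) (hh : ∀ i ∈ t, Bdd C r (h i).1) (M : ℕ) :
    ∃ G : ι → T K n, (∀ i ∈ t, Bdd (C ^ (2 * (t.card * M + 1))) r (G i).1) ∧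
      ∑ i ∈ t, G i * h i ^ M = (∑ i ∈ t, g i * h i) ^ (t.card * M + 1) := by
  classical
  have hC0 : 0 ≤ C := by linarith
  induction t using Finset.induction_on with
  | empty => exact ⟨0, by simp, by simp⟩
  | insert i t hi ih =>
    obtain ⟨G, hG, hsum⟩ := ih (fun j hj => hg j (Finset.mem_insert_of_mem hj))
      (fun j hj => hh j (Finset.mem_insert_of_mem hj))
    have hu : ∀ j ∈ insert i t, Bdd (C ^ 2) r (g j * h j).1 := fun j hj => by
      rw [pow_two]
      exact (hg j hj).mul hC0 hC0 hr (hh j hj)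
    set L := t.card * M + 1
    set x := g i * h i
    set σ := ∑ j ∈ t, g j * h j
    have hx : Bdd (C ^ 2) r x.1 := hu i (Finset.mem_insert_self _ _)
    have hσ : Bdd (C ^ 2) r σ.1 := by
      rw [AddSubmonoidClass.coe_finsetSum]
      exact Bdd.sum (by positivity) hr fun j hj => hu j (Finset.mem_insert_of_mem hj)
    have hterm : ∀ (m a b : ℕ), Bdd (C ^ (2 * (a + b))) r ((m : T K n) * (x ^ a * σ ^ b)).1 := by
      intro m a b
      refine Bdd.natCast_mul hr ?_ m
      have := (hx.pow (by positivity) hr a).mul (by positivity) (by positivity) hr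
        (hσ.pow (by positivity) hr b)
      rwa [← pow_mul, ← pow_mul, ← pow_add, ← mul_add] at this
    set U := ∑ j ∈ Finset.range (L + 1), ((M + L).choose (M + j) : T K n) * (x ^ j * σ ^ (L - j))
    set V := ∑ j ∈ Finset.range M, ((M + L).choose j : T K n) * (x ^ j * σ ^ (M - j))
    have hU : Bdd (C ^ (2 * L)) r U.1 := by
      rw [AddSubmonoidClass.coe_finsetSum]
      refine Bdd.sum (by positivity) hr fun j hj => ?_
      have := hterm ((M + L).choose (M + j)) j (L - j)
      rwa [Nat.add_sub_cancel' (by have := Finset.mem_range.1 hj; omega)] at this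
    have hV : Bdd (C ^ (2 * M)) r V.1 := by
      rw [AddSubmonoidClass.coe_finsetSum]
      refine Bdd.sum (by positivity) hr fun j hj => ?_
      have := hterm ((M + L).choose j) j (M - j)
      rwa [Nat.add_sub_cancel' (by have := Finset.mem_range.1 hj; omega)] at this
    have hcard : (insert i t).card * M + 1 = M + L := by
      rw [Finset.card_insert_of_notMem hi]; ring
    have hexp : C ^ (2 * ((insert i t).card * M + 1)) = C ^ (2 * M) * C ^ (2 * L) := by
      rw [hcard, mul_add, pow_add]
    refine ⟨fun j => if j = i then g i ^ M * U else V * G j, fun j hj => ?_, ?_⟩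
    · rw [hexp]
      rcases Finset.mem_insert.1 hj with rfl | hj'
      · simp only [if_true]
        refine Bdd.mul (by positivity) (by positivity) hr
          (((hg j hj).pow hC0 hr M).mono ?_ hr.le le_rfl) hU
        exact pow_le_pow_right₀ hC (by omega)
      · have hne : j ≠ i := fun h => hi (h ▸ hj')
        simp only [if_neg hne]
        exact Bdd.mul (by positivity) (by positivity) hr hV (hG j hj')
    · rw [Finset.sum_insert hi, Finset.sum_insert hi, hcard, add_pow_split]
      congr 1
      · change (if i = i then g i ^ M * U else V * G i) * h i ^ M = (g i * h i) ^ M * U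
        rw [if_pos rfl]
        ring
      · change _ = σ ^ L * V
        rw [← hsum, Finset.sum_mul]
        refine Finset.sum_congr rfl fun j hj => ?_
        have hne : j ≠ i := fun h => hi (h ▸ hj)
        simp only [if_neg hne]
        ring

theorem sum_pow_mul_telescope {S : Type*} [CommRing S] (h : S) (d H : ℕ → S)
    (hd : ∀ l, d l = (if l = 0 then 0 else h * H (l - 1)) - H l) (m : ℕ) :
    ∑ l ∈ Finset.range (m + 1), h ^ (m - l) * d l = - H m := by
  induction m with
  | zero => simp [hd]
  | succ m ih =>
    rw [Finset.sum_range_succ, hd (m + 1), if_neg (Nat.succ_ne_zero m)]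
    have : ∑ l ∈ Finset.range (m + 1), h ^ (m + 1 - l) * d l =
        h * ∑ l ∈ Finset.range (m + 1), h ^ (m - l) * d l := by
      rw [Finset.mul_sum]
      refine Finset.sum_congr rfl fun l hl => ?_
      rw [show m + 1 - l = (m - l) + 1 by have := Finset.mem_range.1 hl; omega, pow_succ]
      ring
    rw [this, ih, Nat.add_sub_cancel, Nat.sub_self]
    ring

namespace Presentation

variable {A : Type u} [CommRing A] [Algebra (RInt K) A] (P : Presentation K A)

/-- Truncation of an element of `A⟨ξ⟩†` modulo `ϖ^N` at a degree linear in `N`. -/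
theorem exists_trunc {ϖ : RInt K} (hϖ : ϖ ≠ 0) (g : P.Over) : ∃ κ : ℕ, ∀ N L, κ * (N + 1) ≤ L →
    ∃ z : P.Over, g = ∑ l ∈ Finset.range L, P.C (PowerSeries.coeff l g.1) * P.X ^ l +
      P.C (algebraMap (RInt K) A (ϖ ^ N)) * z := by
  obtain ⟨G, hG, hg⟩ := g.2
  obtain ⟨κ, hκ⟩ := exists_linear_dvd hϖ hG
  refine ⟨κ, fun N L hL => ?_⟩
  let t : PowerSeries (T K P.n) := ∑ j ∈ Finset.range L,
    PowerSeries.C (PowerSeries.coeff j G) * PowerSeries.X ^ j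
  have ht : t ∈ TSucc K P.n := Subring.sum_mem _ fun j _ =>
    Subring.mul_mem _ (C_mem_TSucc _) (Subring.pow_mem _ X_mem_TSucc _)
  have htail : ∀ j, ∃ y : T K P.n, PowerSeries.coeff j (G - t) = ϖ ^ N • y := by
    intro j
    have : PowerSeries.coeff j t = if j < L then PowerSeries.coeff j G else 0 := by
      simp only [t, map_sum, PowerSeries.coeff_C_mul, PowerSeries.coeff_X_pow, mul_ite, mul_one,
        mul_zero]
      rw [Finset.sum_ite_eq]
      simp
    rw [map_sub, this]
    split_ifs with h
    · exact ⟨0, by simp⟩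
    · obtain ⟨y, hy⟩ := hκ N j (hL.trans (not_lt.1 h))
      exact ⟨y, by rw [sub_zero, hy]⟩
  choose y hy using htail
  have hH : PowerSeries.mk y ∈ TSucc K P.n :=
    mem_TSucc_of_smul (pow_ne_zero N hϖ) (Subring.sub_mem _ hG ht) fun j => by
      rw [hy, PowerSeries.coeff_mk]
  have hGH : G = t + PowerSeries.C (algebraMap (RInt K) (T K P.n) (ϖ ^ N)) * PowerSeries.mk y := by
    rw [← sub_eq_iff_eq_add']
    ext1 j
    rw [hy, PowerSeries.coeff_C_mul, PowerSeries.coeff_mk, Algebra.smul_def]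
  refine ⟨⟨_, _, hH, rfl⟩, ?_⟩
  ext1
  change g.1 = P.Over.subtype (∑ l ∈ Finset.range L, P.C (PowerSeries.coeff l g.1) * P.X ^ l) +
    PowerSeries.C (algebraMap (RInt K) A (ϖ ^ N)) *
      PowerSeries.map (P.φ : T K P.n →+* A) (PowerSeries.mk y)
  have h1 : P.Over.subtype (∑ l ∈ Finset.range L, P.C (PowerSeries.coeff l g.1) * P.X ^ l) =
      PowerSeries.map (P.φ : T K P.n →+* A) t := by
    simp only [t, map_sum, map_mul, map_pow]
    refine Finset.sum_congr rfl fun j _ => ?_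
    change PowerSeries.C (PowerSeries.coeff j g.1) * PowerSeries.X ^ j = _
    rw [← hg]
    simp
  have h2 : PowerSeries.C (algebraMap (RInt K) A (ϖ ^ N)) =
      PowerSeries.map (P.φ : T K P.n →+* A)
        (PowerSeries.C (algebraMap (RInt K) (T K P.n) (ϖ ^ N))) := by
    rw [PowerSeries.map_C, RingHom.coe_coe, AlgHom.commutes]
  rw [h1, h2, ← map_mul, ← map_add, ← hGH, ← hg]

theorem coeff_sum_C_mul_X_pow (a : ℕ → A) (L j : ℕ) :
    PowerSeries.coeff j (∑ l ∈ Finset.range L, P.C (a l) * P.X ^ l : P.Over).1 =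
      if j < L then a j else 0 := by
  change PowerSeries.coeff j (P.Over.subtype _) = _
  simp only [map_sum, map_mul, map_pow]
  change ∑ l ∈ Finset.range L, PowerSeries.coeff j (PowerSeries.C (a l) * PowerSeries.X ^ l) = _
  simp only [PowerSeries.coeff_C_mul, PowerSeries.coeff_X_pow, mul_ite, mul_one, mul_zero]
  rw [Finset.sum_ite_eq]
  simp

theorem coeff_dvd_of_trunc {c : A} {g z : P.Over} {L : ℕ}
    (h : g = ∑ l ∈ Finset.range L, P.C (PowerSeries.coeff l g.1) * P.X ^ l + P.C c * z) {j : ℕ}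
    (hj : L ≤ j) : c ∣ PowerSeries.coeff j g.1 := by
  refine ⟨PowerSeries.coeff j z.1, ?_⟩
  have h1 := congrArg (fun x : P.Over => PowerSeries.coeff j x.1) h
  simp only [Subring.coe_add, map_add] at h1
  rw [coeff_sum_C_mul_X_pow, if_neg (not_lt.2 hj), zero_add] at h1
  rw [h1]
  exact PowerSeries.coeff_C_mul _ _ _

theorem proj_C_pow_mul_sum (f : A) (a : ℕ → A) (M : ℕ) :
    P.proj f (P.C f) ^ M * P.proj f (∑ l ∈ Finset.range (M + 1), P.C (a l) * P.X ^ l) =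
      P.proj f (P.C (∑ l ∈ Finset.range (M + 1), f ^ (M - l) * a l)) := by
  simp only [map_sum, map_mul, map_pow, Finset.mul_sum]
  refine Finset.sum_congr rfl fun l hl => ?_
  have hl' : M = (M - l) + l := by have := Finset.mem_range.1 hl; omega
  conv_lhs => rw [hl', pow_add]
  have := congrArg (· ^ l) (P.proj_C_mul_X f)
  simp only [mul_pow, one_pow] at this
  linear_combination (P.proj f (P.C f)) ^ (M - l) * P.proj f (P.C (a l)) * this

/-- The fraction of `A⟨f⁻¹⟩†` truncated at order `M`, multiplied by `f^M`. -/
def numerator (f : A) (g : P.Over) (M : ℕ) : A :=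
  ∑ l ∈ Finset.range (M + 1), f ^ (M - l) * PowerSeries.coeff l g.1

theorem numerator_congr {c f : A} {g : P.Over} {M M' : ℕ} (hM : M ≤ M')
    (hg : ∀ j, M < j → c ∣ PowerSeries.coeff j g.1) :
    c ∣ P.numerator f g M' - f ^ (M' - M) * P.numerator f g M := by
  obtain ⟨k, rfl⟩ := Nat.exists_eq_add_of_le hM
  rw [numerator, numerator, show M + k + 1 = M + 1 + k by ring, Finset.sum_range_add,
    Finset.mul_sum, add_sub_right_comm]
  have : ∑ l ∈ Finset.range (M + 1), f ^ (M + k - l) * PowerSeries.coeff l g.1 =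
      ∑ l ∈ Finset.range (M + 1), f ^ (M + k - M) * (f ^ (M - l) * PowerSeries.coeff l g.1) := by
    refine Finset.sum_congr rfl fun l hl => ?_
    rw [← mul_assoc, ← pow_add]
    congr 2
    have := Finset.mem_range.1 hl
    omega
  rw [this, sub_self, zero_add]
  exact Finset.dvd_sum fun l _ => Dvd.dvd.mul_left (hg _ (by omega)) _

/-- Elements of `A⟨f⁻¹⟩†` and `A⟨g⁻¹⟩†` that agree in `A⟨(fg)⁻¹⟩†`: their truncated numerators agree
after multiplication by the expected power and no further one, since the series that witnesses
the equality is itself overconvergent. -/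
theorem numerator_compat {c f g : A} {x y H : P.Over} {M : ℕ}
    (hH : P.scale g x - P.scale f y = (P.C (f * g) * P.X - 1) * H)
    (hM : c ∣ PowerSeries.coeff M H.1) :
    c ∣ g ^ M * P.numerator f x M - f ^ M * P.numerator g y M := by
  have h1 : ∀ l, g ^ l * PowerSeries.coeff l x.1 - f ^ l * PowerSeries.coeff l y.1 =
      (if l = 0 then 0 else f * g * PowerSeries.coeff (l - 1) H.1) - PowerSeries.coeff l H.1 := by
    intro l
    rw [← coeff_relation, ← PowerSeries.coeff_rescale, ← PowerSeries.coeff_rescale, ← map_sub]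
    exact congrArg (PowerSeries.coeff l) (congrArg Subtype.val hH)
  have h2 := sum_pow_mul_telescope (f * g) _ (fun l => PowerSeries.coeff l H.1) h1 M
  have h3 : g ^ M * P.numerator f x M - f ^ M * P.numerator g y M = - PowerSeries.coeff M H.1 := by
    rw [← h2, numerator, numerator, Finset.mul_sum, Finset.mul_sum, ← Finset.sum_sub_distrib]
    refine Finset.sum_congr rfl fun l hl => ?_
    have hl' : M = (M - l) + l := by have := Finset.mem_range.1 hl; omega
    have e1 : g ^ M = g ^ (M - l) * g ^ l := by rw [← pow_add, ← hl']
    have e2 : f ^ M = f ^ (M - l) * f ^ l := by rw [← pow_add, ← hl']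
    rw [e1, e2, mul_pow]
    ring
  rw [h3]
  exact (dvd_neg).2 hM

end Presentation

theorem exists_coeff_bdd {n : ℕ} {G : PowerSeries (T K n)} (hG : G ∈ TSucc K n) :
    ∀ᶠ r in 𝓝[>] (1 : ℝ), ∃ C, 1 ≤ C ∧ ∀ j, Bdd C r (PowerSeries.coeff j G : T K n).1 := by
  obtain ⟨C, s, hC, hs, hb⟩ := exists_pbdd hG
  filter_upwards [Ioc_mem_nhdsGT hs] with r hr
  have hr0 : 0 < r := by linarith [hr.1]
  refine ⟨max C 1, le_max_right _ _, fun j => ?_⟩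
  refine (hb.mono (D := max C 1) hC.le (le_max_left _ _) hr0 hr.2 j).mono ?_ hr0.le le_rfl
  exact mul_le_of_le_one_right (by positivity)
    (pow_le_one₀ (by positivity) (inv_le_one_of_one_le₀ hr.1.le))

namespace Presentation

variable {A : Type u} [CommRing A] [Algebra (RInt K) A] (P : Presentation K A)

/-- Lifts to `T_n†` of finitely many elements and of the coefficients of finitely many series, with
a common bound for all radii near one. -/
theorem exists_isBounded_lifts {ι : Type*} (t : Finset ι) (g : ι → A) (x : ι → P.Over) :
    ∃ (γ : ι → T K P.n) (X : ι → ℕ → T K P.n), (∀ i, P.φ (γ i) = g i) ∧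
      (∀ i l, P.φ (X i l) = PowerSeries.coeff l (x i).1) ∧
      ∀ᶠ r in 𝓝[>] (1 : ℝ), ∃ C, 1 ≤ C ∧ ∀ i ∈ t, Bdd C r (γ i).1 ∧ ∀ l, Bdd C r (X i l).1 := by
  choose γ hγ using fun i => P.surjective (g i)
  choose X hXm hX using fun i => (x i).2
  refine ⟨γ, fun i l => PowerSeries.coeff l (X i), hγ, fun i l => ?_, ?_⟩
  · rw [← hX, PowerSeries.coeff_map]
    rfl
  · have h1 : ∀ᶠ r in 𝓝[>] (1 : ℝ), ∀ i ∈ t,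
        ∃ C, 1 ≤ C ∧ ∀ j, Bdd C r (PowerSeries.coeff j (X i) : T K P.n).1 :=
      (Filter.eventually_all_finset t).2 fun i _ => exists_coeff_bdd (hXm i)
    filter_upwards [h1, exists_common_bdd t γ, self_mem_nhdsWithin] with r hr1 hr2 hr
    have hr0 : (0 : ℝ) ≤ r := zero_le_one.trans (le_of_lt hr)
    obtain ⟨C, hC, hCb⟩ := hr2
    choose! D hD hDb using hr1
    have hD0 : ∀ i ∈ t, 0 ≤ D i := fun i hi => zero_le_one.trans (hD i hi)
    have hs := Finset.sum_nonneg hD0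
    refine ⟨C + ∑ i ∈ t, D i, by linarith, fun i hi => ⟨?_, fun l => ?_⟩⟩
    · exact (hCb i hi).mono (by linarith) hr0 le_rfl
    · exact (hDb i hi l).mono (by linarith [Finset.single_le_sum hD0 hi]) hr0 le_rfl

/-- Overconvergent fractions `x_i` with denominators `h_i` that agree on overlaps come from one
element of `A`, if the `h_i` generate the unit ideal. Modulo `ϖ^N` the elements are glued by a
partition of unity `1 = ∑ G_i h_i^M` with `M` linear in `N`; the growth of the differences of the
successive approximations is then controlled by effective division. -/
theorem exists_glue [CompleteSpace K] {ϖ : RInt K} (hϖ : IsUniformizer ϖ) {ι : Type*}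
    (t : Finset ι) (g h : ι → A) (hgh : ∑ i ∈ t, g i * h i = 1) (x : ι → P.Over)
    (hx : ∀ i ∈ t, ∀ j ∈ t, P.proj (h i * h j) (P.scale (h j) (x i)) =
      P.proj (h i * h j) (P.scale (h i) (x j))) :
    ∃ b : A, ∀ i ∈ t, P.proj (h i) (P.C b) = P.proj (h i) (x i) := by
  obtain ⟨γ, X, hγ, hX, hbd⟩ := P.exists_isBounded_lifts t g x
  obtain ⟨η, _, hη, _, hbd'⟩ := P.exists_isBounded_lifts t h x
  obtain ⟨r, ⟨⟨C₁, hC₁, hb₁⟩, ⟨C₂, hC₂, hb₂⟩, hcof⟩, hr⟩ := ((hbd.and (hbd'.and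
    (eventually_exists_cofactor hϖ (RingHom.ker P.φ)))).and self_mem_nhdsWithin).exists
  replace hr : 1 < r := hr
  have hr0 : 0 < r := by positivity
  obtain ⟨C, hC, hγb, hXb, hηb⟩ : ∃ C, 1 ≤ C ∧ (∀ i ∈ t, Bdd C r (γ i).1) ∧
      (∀ i ∈ t, ∀ l, Bdd C r (X i l).1) ∧ ∀ i ∈ t, Bdd C r (η i).1 :=
    ⟨max C₁ C₂, hC₁.trans (le_max_left _ _),
      fun i hi => (hb₁ i hi).1.mono (le_max_left _ _) hr0.le le_rfl,
      fun i hi l => ((hb₁ i hi).2 l).mono (le_max_left _ _) hr0.le le_rfl,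
      fun i hi => (hb₂ i hi).1.mono (le_max_right _ _) hr0.le le_rfl⟩
  have hC0 : 0 ≤ C := by linarith
  -- the witnesses of the compatibility on overlaps
  have hH : ∀ i j, ∃ H : P.Over, i ∈ t → j ∈ t → P.scale (h j) (x i) - P.scale (h i) (x j) =
      (P.C (h i * h j) * P.X - 1) * H := by
    intro i j
    by_cases hij : i ∈ t ∧ j ∈ t
    · have := hx i hij.1 j hij.2
      rw [Ideal.Quotient.mk_eq_mk_iff_sub_mem, Ideal.mem_span_singleton] at this
      obtain ⟨H, hH⟩ := this
      exact ⟨H, fun _ _ => hH⟩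
    · exact ⟨0, fun hi hj => (hij ⟨hi, hj⟩).elim⟩
  choose H hH using hH
  choose κ₁ hκ₁ using fun i => P.exists_trunc hϖ.ne_zero (x i)
  choose κ₂ hκ₂ using fun i j => P.exists_trunc hϖ.ne_zero (H i j)
  obtain ⟨κ, hκx, hκH⟩ : ∃ κ, (∀ i ∈ t, κ₁ i ≤ κ) ∧ ∀ i ∈ t, ∀ j ∈ t, κ₂ i j ≤ κ := by
    refine ⟨∑ i ∈ t, κ₁ i + ∑ i ∈ t, ∑ j ∈ t, κ₂ i j, fun i hi => ?_, fun i hi j hj => ?_⟩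
    · exact (Finset.single_le_sum (fun _ _ => Nat.zero_le _) hi).trans (Nat.le_add_right _ _)
    · refine le_trans ?_ (Nat.le_add_left _ _)
      exact (Finset.single_le_sum (f := fun j => κ₂ i j) (fun _ _ => Nat.zero_le _) hj).trans
        (Finset.single_le_sum (f := fun i => ∑ j ∈ t, κ₂ i j) (fun _ _ => Nat.zero_le _) hi)
  let c : ℕ → A := fun N => algebraMap (RInt K) A (ϖ ^ N)
  have hc : ∀ N, c N ∣ c (N + 1) := fun N => map_dvd _ (pow_dvd_pow _ (Nat.le_succ N))
  let M : ℕ → ℕ := fun N => κ * (N + 1)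
  have hM : ∀ N, M N ≤ M (N + 1) := fun N => Nat.mul_le_mul_left _ (by omega)
  have hxdvd : ∀ i ∈ t, ∀ N j, M N ≤ j → c N ∣ PowerSeries.coeff j (x i).1 := by
    intro i hi N j hj
    obtain ⟨z, hz⟩ := hκ₁ i N (M N) (Nat.mul_le_mul_right _ (hκx i hi))
    exact P.coeff_dvd_of_trunc hz hj
  have hHdvd : ∀ i ∈ t, ∀ j ∈ t, ∀ N, c N ∣ PowerSeries.coeff (M N) (H i j).1 := by
    intro i hi j hj N
    obtain ⟨z, hz⟩ := hκ₂ i j N (M N) (Nat.mul_le_mul_right _ (hκH i hi j hj))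
    exact P.coeff_dvd_of_trunc hz le_rfl
  -- partitions of unity and the approximations
  choose G hGb hG using fun N => exists_sum_mul_pow hC hr0 t γ η hγb hηb (M N)
  have hG1 : ∀ N, ∑ i ∈ t, P.φ (G N i) * h i ^ M N = 1 := by
    intro N
    have := congrArg P.φ (hG N)
    simp only [map_sum, map_mul, map_pow, hγ, hη, hgh, one_pow] at this
    exact this
  let a : ℕ → ι → T K P.n := fun N i =>
    ∑ l ∈ Finset.range (M N + 1), η i ^ (M N - l) * X i l
  have ha : ∀ N i, P.φ (a N i) = P.numerator (h i) (x i) (M N) := by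
    intro N i
    simp only [a, numerator, map_sum, map_mul, map_pow, hη, hX]
  have hab : ∀ N, ∀ i ∈ t, Bdd (C ^ (M N + 1)) r (a N i).1 := by
    intro N i hi
    rw [AddSubmonoidClass.coe_finsetSum]
    refine Bdd.sum (by positivity) hr0 fun l _ => ?_
    refine (((hηb i hi).pow hC0 hr0 (M N - l)).mul (by positivity) hC0 hr0 (hXb i hi l)).mono
      ?_ hr0.le le_rfl
    rw [← pow_succ]
    exact pow_le_pow_right₀ hC (by omega)
  let b : ℕ → T K P.n := fun N => ∑ i ∈ t, G N i * a N i
  obtain ⟨D, τ, hD, hτ, hbb⟩ : ∃ D τ : ℝ, 0 ≤ D ∧ 1 ≤ τ ∧ ∀ N, Bdd (D * τ ^ N) r (b N).1 := by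
    refine ⟨C ^ (2 * (t.card * κ + 1) + (κ + 1)), C ^ (2 * (t.card * κ) + κ), by positivity,
      one_le_pow₀ hC, fun N => ?_⟩
    rw [AddSubmonoidClass.coe_finsetSum]
    refine Bdd.sum (by positivity) hr0 fun i hi => ?_
    refine ((hGb N i hi).mul (by positivity) (by positivity) hr0 (hab N i hi)).mono
      (le_of_eq ?_) hr0.le le_rfl
    rw [← pow_mul, ← pow_add, ← pow_add]
    congr 1
    simp only [M]
    ring
  have hnum : ∀ N, ∀ j ∈ t,
      c N ∣ h j ^ M N * P.φ (b N) - P.numerator (h j) (x j) (M N) := by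
    intro N j hj
    have e : h j ^ M N * P.φ (b N) - P.numerator (h j) (x j) (M N) =
        ∑ i ∈ t, P.φ (G N i) * (h j ^ M N * P.numerator (h i) (x i) (M N) -
          h i ^ M N * P.numerator (h j) (x j) (M N)) := by
      conv_lhs => rw [← one_mul (P.numerator (h j) (x j) (M N)), ← hG1 N]
      simp only [b, map_sum, map_mul, ha, Finset.mul_sum, Finset.sum_mul,
        ← Finset.sum_sub_distrib]
      exact Finset.sum_congr rfl fun i _ => by ring
    rw [e]
    refine Finset.dvd_sum fun i hi => Dvd.dvd.mul_left ?_ _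
    exact P.numerator_compat (hH i j hi hj) (hHdvd i hi j hj N)
  have hdiff : ∀ N, c N ∣ P.φ (b (N + 1)) - P.φ (b N) := by
    intro N
    have e : P.φ (b (N + 1)) - P.φ (b N) = ∑ j ∈ t, P.φ (G (N + 1) j) *
        (h j ^ M (N + 1) * (P.φ (b (N + 1)) - P.φ (b N))) := by
      conv_lhs => rw [← one_mul (_ - _), ← hG1 (N + 1), Finset.sum_mul]
      exact Finset.sum_congr rfl fun i _ => by ring
    rw [e]
    refine Finset.dvd_sum fun j hj => Dvd.dvd.mul_left ?_ _
    have h1 := (hc N).trans (hnum (N + 1) j hj)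
    have h2 := P.numerator_congr (c := c N) (f := h j) (hM N) fun l hl => hxdvd j hj N l hl.le
    have h3 := Dvd.dvd.mul_left (hnum N j hj) (h j ^ (M (N + 1) - M N))
    have h4 := dvd_sub (dvd_add h1 h2) h3
    rw [mul_sub, ← mul_assoc, ← pow_add, Nat.sub_add_cancel (hM N)] at h4
    convert h4 using 1
    ring
  -- the differences with growth control, and the limit
  have hy : ∀ N, ∃ y : T K P.n, P.φ (b (N + 1)) - P.φ (b N) = P.φ (ϖ ^ N • y) ∧
      Bdd (D * τ * (τ / ‖(ϖ : K)‖) ^ N) r y.1 := by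
    intro N
    have hm : MemMod ϖ (RingHom.ker P.φ) N (b (N + 1) - b N) := by
      obtain ⟨d, hd⟩ := hdiff N
      obtain ⟨δ, rfl⟩ := P.surjective d
      refine ⟨δ, RingHom.mem_ker.2 ?_⟩
      rw [map_sub, map_sub, hd, map_smul, Algebra.smul_def, sub_self]
    have hbd : Bdd (D * τ * τ ^ N) r (b (N + 1) - b N).1 := by
      refine Bdd.sub hr0 ((hbb (N + 1)).mono (by rw [pow_succ']; ring_nf; exact le_rfl) hr0.le le_rfl)
        ((hbb N).mono ?_ hr0.le le_rfl)
      have : 0 ≤ D * τ ^ N := by positivity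
      nlinarith
    obtain ⟨y, hy, hyb⟩ := hcof N _ _ hm hbd
    refine ⟨y, ?_, ?_⟩
    · have := RingHom.mem_ker.1 hy
      rwa [map_sub, map_sub, sub_eq_zero] at this
    · rwa [mul_div_assoc, ← div_pow] at hyb
  choose y hy hyb using hy
  obtain ⟨S, hS⟩ := exists_sum hϖ.norm_lt_one (τ := τ / ‖(ϖ : K)‖) (by positivity) hr y hyb
  have hlim : ∀ N, c N ∣ P.φ (b 0 + S) - P.φ (b N) := by
    intro N
    obtain ⟨S', hS'⟩ := hS N
    have htel : ∑ l ∈ Finset.range N, P.φ (ϖ ^ l • y l) = P.φ (b N) - P.φ (b 0) := by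
      rw [← Finset.sum_range_sub (fun N => P.φ (b N))]
      exact Finset.sum_congr rfl fun l _ => (hy l).symm
    refine ⟨P.φ S', ?_⟩
    rw [← map_sum] at htel
    rw [map_add, hS', map_add, htel, map_smul, Algebra.smul_def]
    ring
  refine ⟨P.φ (b 0 + S), fun j hj => ?_⟩
  rw [← sub_eq_zero]
  refine P.loc_eq_zero_of_forall_dvd hϖ fun N => ?_
  obtain ⟨z, hz⟩ := hκ₁ j N (M N + 1)
    ((Nat.mul_le_mul_right _ (hκx j hj)).trans (Nat.le_succ _))
  refine ((P.isUnit_proj_C (h j)).pow (M N)).dvd_mul_left.1 ?_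
  obtain ⟨d, hd⟩ := dvd_add (Dvd.dvd.mul_left (hlim N) (h j ^ M N)) (hnum N j hj)
  have e1 : P.proj (h j) (P.C (h j)) ^ M N * P.proj (h j) (P.C (P.φ (b 0 + S))) =
      P.proj (h j) (P.C (P.numerator (h j) (x j) (M N))) +
        P.locConst (h j) (ϖ ^ N) * P.proj (h j) (P.C d) := by
    have : h j ^ M N * P.φ (b 0 + S) = P.numerator (h j) (x j) (M N) + c N * d := by
      linear_combination hd
    rw [locConst_apply]
    simp only [← map_mul, ← map_pow, ← map_add]
    rw [this]
  have e2 : P.proj (h j) (P.C (h j)) ^ M N * P.proj (h j) (x j) =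
      P.proj (h j) (P.C (P.numerator (h j) (x j) (M N))) +
        P.locConst (h j) (ϖ ^ N) * (P.proj (h j) (P.C (h j)) ^ M N * P.proj (h j) z) := by
    conv_lhs => rw [hz, map_add, mul_add, proj_C_pow_mul_sum, map_mul]
    rw [locConst_apply, numerator]
    ring
  rw [mul_sub, e1, e2]
  refine ⟨P.proj (h j) (P.C d) - P.proj (h j) (P.C (h j)) ^ M N * P.proj (h j) z, ?_⟩
  ring

/-- The map from `A` to the global sections of `O†` is onto. -/
theorem exists_global [CompleteSpace K] {ϖ : RInt K} (hϖ : IsUniformizer ϖ)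
    (s : ∀ q : P.Pt, P.Stalk q)
    (hs : ∀ q, ∃ (f : A) (_ : q ∈ P.basic f) (x : P.Loc f),
      ∀ (q' : P.Pt) (hq' : q' ∈ P.basic f), s q' = P.germ f q' hq' x) :
    ∃ a : A, ∀ q, s q = P.stalkC q a := by
  classical
  choose h hq x hx using hs
  obtain ⟨t, ht⟩ := CompactSpace.elim_nhds_subcover (fun q : P.Pt => (P.basic (h q) : Set P.Pt))
    fun q => (P.basic (h q)).2.mem_nhds (hq q)
  have hcov : ∀ q : P.Pt, ∃ i ∈ t, q ∈ P.basic (h i) := by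
    intro q
    have : q ∈ (⊤ : Set P.Pt) := trivial
    rw [← ht] at this
    simpa using this
  have htop : Ideal.span ((fun i => red K (h i)) '' t) = ⊤ := by
    by_contra hne
    obtain ⟨𝔪, hm, hle⟩ := Ideal.exists_le_maximal _ hne
    obtain ⟨i, hi, hqi⟩ := hcov ⟨𝔪, hm.isPrime⟩
    exact hqi (hle (Ideal.subset_span ⟨i, hi, rfl⟩))
  obtain ⟨g₀, hg₀⟩ : ∃ g₀ : P.Pt → A, red K (∑ i ∈ t, g₀ i * h i) = 1 := by
    have h1 : (1 : Red K A) ∈ Ideal.span ((fun i => red K (h i)) '' t) := htop ▸ trivial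
    obtain ⟨c, hc⟩ := (Submodule.mem_span_image_finset_iff_exists_fun _).1 h1
    choose g₀ hg₀ using fun i => red_surjective K (c i)
    refine ⟨fun i => if hi : i ∈ t then g₀ ⟨i, hi⟩ else 0, ?_⟩
    rw [map_sum, ← hc, ← Finset.sum_coe_sort t]
    exact Finset.sum_congr rfl fun i _ => by simp [hg₀]
  obtain ⟨w, hw⟩ := dvd_of_red_eq_zero hϖ (a := ∑ i ∈ t, g₀ i * h i - 1)
    (by rw [map_sub, hg₀, map_one, sub_self])
  -- an element of `A` congruent to `1` modulo `ϖ` is a unit, as it is one in `A⟨ξ⟩†`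
  have hunit : IsUnit (∑ i ∈ t, g₀ i * h i) := by
    let ε : P.Over →+* A := PowerSeries.constantCoeff.comp P.Over.subtype
    have hε : ∀ a, ε (P.C a) = a := fun a => PowerSeries.constantCoeff_C a
    have h1 := (P.isUnit_one_add hϖ.norm_lt_one (P.C w)).map ε
    rwa [map_add, map_one, map_mul, hε, hε, ← hw, add_sub_cancel] at h1
  obtain ⟨v, hv⟩ := isUnit_iff_exists_inv'.1 hunit
  choose X hX using fun q => Ideal.Quotient.mk_surjective (x q)
  obtain ⟨b, hb⟩ := P.exists_glue hϖ t (fun i => v * g₀ i) h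
    (by rw [← hv, Finset.mul_sum]; exact Finset.sum_congr rfl fun i _ => by ring) X (by
      intro i hi j hj
      refine P.loc_ext hϖ fun q hq => ?_
      obtain ⟨hqi, hqj⟩ := P.mem_basic_mul.1 hq
      have e1 := P.germ_trans (h j) rfl q hqi hq (x i)
      have e2 := P.germ_trans (h i) (mul_comm (h i) (h j)) q hqj hq (x j)
      rw [← hx i q hqi, ← hX i] at e1
      rw [← hx j q hqj, ← hX j] at e2
      exact e1.trans e2.symm)
  refine ⟨b, fun q => ?_⟩
  obtain ⟨i, hi, hqi⟩ := hcov q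
  rw [hx i q hqi, ← P.germ_proj_C (h i) b q hqi, hb i hi]
  congr 1
  exact (hX i).symm

end Presentation

/-! ### Ring homomorphisms preserve overconvergence -/

/-- Convergent sums `∑_l a^l Q_l` of elements of `T_{n+1}†` that grow geometrically. -/
theorem exists_sum_TSucc [CompleteSpace K] {n : ℕ} {a : RInt K} (h1 : ‖(a : K)‖ < 1) {C r τ : ℝ}
    (hτ : 0 ≤ τ) (hr : 1 < r) (Q : ℕ → PowerSeries (T K n))
    (hQ : ∀ l, PBdd (C * τ ^ l) r (Q l)) :
    ∃ S ∈ TSucc K n, ∀ N j, ∃ S' : T K n, PowerSeries.coeff j S =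
      ∑ l ∈ Finset.range N, a ^ l • PowerSeries.coeff j (Q l) + a ^ N • S' := by
  have key : ∀ N, ∃ S : PowerSeries (T K n), S ∈ TSucc K n ∧ ∀ j v,
      MvPowerSeries.coeff v (PowerSeries.coeff j S : T K n).1 =
        adicSum a fun l => MvPowerSeries.coeff v (PowerSeries.coeff j (Q (l + N)) : T K n).1 := by
    intro N
    obtain ⟨r', C', hr', -, hC', hb⟩ :=
      exists_radius (C := C * τ ^ N) hτ (norm_nonneg (a : K)) h1 hr
    let s : ℕ → MvPowerSeries (Fin n) (RInt K) := fun j v =>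
      adicSum a fun l => MvPowerSeries.coeff v (PowerSeries.coeff j (Q (l + N)) : T K n).1
    have hs : ∀ j (v : Fin n →₀ ℕ),
        ‖((MvPowerSeries.coeff v (s j) : RInt K) : K)‖ * r' ^ (v.degree + j) ≤ C' := by
      intro j v
      have hp : 0 < r' ^ (v.degree + j) := by positivity
      rw [← le_div_iff₀ hp]
      refine norm_adicSum_le h1 _ (by positivity) fun l => ?_
      rw [le_div_iff₀ hp]
      refine hb _ _ _ (norm_nonneg _) (norm_le_one _)
        (((pbdd_iff (by positivity)).1 (hQ (l + N)) (v, j)).trans_eq ?_)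
      rw [pow_add]; ring
    have hsT : ∀ j, s j ∈ T K n := fun j => mem_T_of_bdd (C := C') hr' fun v => by
      refine le_trans ?_ (hs j v)
      have := pow_le_pow_right₀ hr'.le (Nat.le_add_right v.degree j)
      gcongr
    refine ⟨PowerSeries.mk fun j => ⟨s j, hsT j⟩, mem_TSucc_of_pbdd (C := C') hr'
      ((pbdd_iff (by positivity)).2 fun vj => ?_), fun j v => ?_⟩
    · rw [PowerSeries.coeff_mk]
      exact hs vj.2 vj.1
    · rw [PowerSeries.coeff_mk]
      rfl
  choose S hSm hS using key
  refine ⟨S 0, hSm 0, fun N j => ⟨PowerSeries.coeff j (S N), ?_⟩⟩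
  ext1
  ext1 v
  rw [hS, adicSum_eq h1 _ N]
  simp only [add_zero, Subalgebra.coe_add, Subalgebra.coe_smul, AddSubmonoidClass.coe_finsetSum,
    map_add, map_sum, MvPowerSeries.coeff_smul, hS]

/-- Expansions in powers of `a` with digits from a finite set. -/
theorem exists_digits {a : RInt K} (ha : a ≠ 0) {S : Finset (RInt K)}
    (hS : ∀ c, ∃ s ∈ S, a ∣ c - s) :
    ∃ d : RInt K → ℕ → RInt K, (∀ c l, d c l = 0 ∨ d c l ∈ S) ∧
      (∀ c N, ∃ e, c = ∑ l ∈ Finset.range N, a ^ l * d c l + a ^ N * e) ∧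
      ∀ c l, a ^ (l + 1) ∣ c → d c l = 0 := by
  have h : ∀ c, ∃ s q : RInt K, (s = 0 ∨ s ∈ S) ∧ c = s + a * q ∧ (a ∣ c → s = 0) := by
    intro c
    by_cases hc : a ∣ c
    · obtain ⟨q, hq⟩ := hc
      exact ⟨0, q, Or.inl rfl, by rw [hq, zero_add], fun _ => rfl⟩
    · obtain ⟨s, hs, q, hq⟩ := hS c
      exact ⟨s, q, Or.inr hs, by rw [← hq]; ring, fun h => (hc h).elim⟩
  choose δ σ hδ hσ h0 using h
  refine ⟨fun c l => δ (σ^[l] c), fun c l => hδ _, fun c N => ⟨σ^[N] c, ?_⟩, fun c l hc => h0 _ ?_⟩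
  · induction N with
    | zero => simp
    | succ N ih =>
      conv_lhs => rw [ih, hσ (σ^[N] c)]
      rw [Finset.sum_range_succ, Function.iterate_succ_apply']
      ring
  · induction l generalizing c with
    | zero => simpa using hc
    | succ l ih =>
      rw [Function.iterate_succ_apply]
      refine ih _ ?_
      have h1 : c = a * σ c := by
        conv_lhs => rw [hσ c, h0 c (dvd_trans (dvd_pow_self a (by omega)) hc), zero_add]
      rw [h1, pow_succ'] at hc
      exact (mul_dvd_mul_iff_left ha).1 hc

variable (K) in
/-- The variables of `T_n†`. -/
def T.X {n : ℕ} (i : Fin n) : T K n :=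
  ⟨MvPowerSeries.X i, mem_T_of_bdd one_lt_two (bdd_X i one_le_two)⟩

theorem coe_prod_X_pow {n : ℕ} (v : Fin n →₀ ℕ) :
    ((∏ i, T.X K i ^ v i : T K n) : MvPowerSeries (Fin n) (RInt K)) =
      MvPowerSeries.monomial v 1 := by
  rw [MvPowerSeries.monomial_one_eq, Finsupp.prod_fintype _ _ (fun _ => pow_zero _)]
  change (T K n).val (∏ i, T.X K i ^ v i) = _
  simp only [map_prod, map_pow]
  rfl

theorem Bdd.prod_pow {n m : ℕ} {C r : ℝ} (hC : 0 ≤ C) (hr : 0 < r) (β : Fin n → T K m)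
    (hβ : ∀ i, Bdd C r (β i).1) (v : Fin n →₀ ℕ) :
    Bdd (C ^ v.degree) r (∏ i, β i ^ v i : T K m).1 := by
  have key : ∀ s : Finset (Fin n), Bdd (C ^ ∑ i ∈ s, v i) r (∏ i ∈ s, β i ^ v i : T K m).1 := by
    intro s
    classical
    induction s using Finset.induction_on with
    | empty => simpa using bdd_one
    | insert i s hi ih =>
      rw [Finset.prod_insert hi, Finset.sum_insert hi, pow_add]
      exact ((hβ i).pow hC hr _).mul (by positivity) (by positivity) hr ih
  rw [Finsupp.degree_eq_sum]
  exact key _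

namespace Presentation

variable {A B : Type u} [CommRing A] [CommRing B] [Algebra (RInt K) A] [Algebra (RInt K) B]

/-- Any ring homomorphism of weakly complete algebras sends overconvergent series to overconvergent
series. It need not be linear over the ring of integers, but it preserves a topologically nilpotent
integer `a`, and scalars are expanded in powers of `a` with digits from a finite set. -/
theorem map_mem_over [CompleteSpace K] {ϖ : RInt K} (hϖ : IsUniformizer ϖ)
    (P : Presentation K A) (Q : Presentation K B) (ρ : A →+* B) {a : RInt K} (ha : a ≠ 0)
    (ha1 : ‖(a : K)‖ < 1) (hρ : ρ (algebraMap (RInt K) A a) = algebraMap (RInt K) B a)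
    {S : Finset (RInt K)} (hS : ∀ c, ∃ s ∈ S, a ∣ c - s) {g : PowerSeries A} (hg : g ∈ P.Over) :
    PowerSeries.map ρ g ∈ Q.Over := by
  classical
  obtain ⟨G, hG, rfl⟩ := hg
  obtain ⟨d, hdS, hd, hd0⟩ := exists_digits ha hS
  obtain ⟨κ, hκ⟩ := exists_linear_dvd_coeff ha hG
  -- the digits of the coefficients, which vanish beyond a linear bound
  let e : ℕ → ℕ → (Fin P.n →₀ ℕ) → RInt K := fun l j v =>
    d (MvPowerSeries.coeff v (PowerSeries.coeff j G : T K P.n).1) l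
  let D : ℕ → ℕ := fun l => κ * (l + 2)
  have he0 : ∀ l j v, D l ≤ v.degree + j → e l j v = 0 := fun l j v h => hd0 _ _ (hκ _ _ _ h)
  let F : ℕ → Finset (Fin P.n →₀ ℕ) := fun l =>
    (Finsupp.finite_of_degree_le (σ := Fin P.n) (D l)).toFinset
  have hF : ∀ l v, v ∈ F l ↔ v.degree ≤ D l := fun l v => by
    simp only [F, Set.Finite.mem_toFinset]
    rfl
  -- lifts of the images of the variables and of the digits
  choose β hβ using fun i => Q.surjective (ρ (P.φ (T.X K i)))
  have hlift : ∀ s : RInt K, ∃ x : T K Q.n, Q.φ x = ρ (algebraMap (RInt K) A s) ∧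
      (s = 0 → x = 0) := by
    intro s
    by_cases hs : s = 0
    · exact ⟨0, by simp [hs], fun _ => rfl⟩
    · obtain ⟨x, hx⟩ := Q.surjective (ρ (algebraMap (RInt K) A s))
      exact ⟨x, hx, fun h => (hs h).elim⟩
  choose lift hl hl0 using hlift
  obtain ⟨r, ⟨⟨C₁, hC₁, hb₁⟩, C₂, hC₂, hb₂⟩, hr⟩ := (((exists_common_bdd Finset.univ β).and
    (exists_common_bdd S lift)).and self_mem_nhdsWithin).exists
  replace hr : 1 < r := hr
  have hr0 : 0 < r := by positivity
  set C := max C₁ C₂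
  have hC : 1 ≤ C := hC₁.trans (le_max_left _ _)
  have hC0 : 0 ≤ C := by linarith
  have hβb : ∀ i, Bdd C r (β i).1 := fun i =>
    (hb₁ i (Finset.mem_univ i)).mono (le_max_left _ _) hr0.le le_rfl
  have hlb : ∀ l j v, Bdd C r (lift (e l j v)).1 := by
    intro l j v
    rcases hdS (MvPowerSeries.coeff v (PowerSeries.coeff j G : T K P.n).1) l with h | h
    · rw [hl0 _ h]
      exact bdd_zero hC0
    · exact (hb₂ _ h).mono (le_max_right _ _) hr0.le le_rfl
  let q : ℕ → ℕ → T K Q.n := fun l j => ∑ v ∈ F l, lift (e l j v) * ∏ i, β i ^ v i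
  have hq0 : ∀ l j, D l ≤ j → q l j = 0 := by
    intro l j h
    refine Finset.sum_eq_zero fun v _ => ?_
    rw [hl0 _ (he0 l j v (h.trans (Nat.le_add_left _ _))), zero_mul]
  have hqb : ∀ l j, Bdd (C ^ (D l + 1)) r (q l j).1 := by
    intro l j
    rw [AddSubmonoidClass.coe_finsetSum]
    refine Bdd.sum (by positivity) hr0 fun v hv => ?_
    refine ((hlb l j v).mul hC0 (by positivity) hr0 (Bdd.prod_pow hC0 hr0 β hβb v)).mono ?_
      hr0.le le_rfl
    rw [← pow_succ']
    exact pow_le_pow_right₀ hC (Nat.add_le_add_right ((hF l v).1 hv) 1)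
  have hqp : ∀ l, PBdd (C ^ (2 * κ + 1) * r ^ (2 * κ) * ((C * r) ^ κ) ^ l) r
      (PowerSeries.mk (q l)) := by
    intro l j
    rw [PowerSeries.coeff_mk]
    by_cases hj : D l ≤ j
    · rw [hq0 l j hj]
      exact bdd_zero (by positivity)
    · refine (hqb l j).mono ?_ hr0.le le_rfl
      have h1 : C ^ (2 * κ + 1) * r ^ (2 * κ) * ((C * r) ^ κ) ^ l = C ^ (D l + 1) * r ^ D l := by
        simp only [D]
        ring
      rw [h1, inv_pow, ← div_eq_mul_inv, le_div_iff₀ (by positivity)]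
      gcongr
      · exact hr.le
      · exact (not_le.1 hj).le
  obtain ⟨H, hH, hHs⟩ := exists_sum_TSucc ha1 (τ := (C * r) ^ κ) (by positivity) hr _ hqp
  refine ⟨H, hH, ?_⟩
  ext1 j
  rw [PowerSeries.coeff_map, PowerSeries.coeff_map, PowerSeries.coeff_map, ← sub_eq_zero]
  refine Q.eq_zero_of_forall_dvd hϖ fun N => ?_
  refine (map_dvd (algebraMap (RInt K) B) (pow_dvd_pow_of_dvd (hϖ.dvd a ha1) N)).trans ?_
  obtain ⟨H', hH'⟩ := hHs N j
  obtain ⟨G', hG'⟩ : ∃ G' : T K P.n, (PowerSeries.coeff j G : T K P.n) -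
      ∑ l ∈ Finset.range N, a ^ l • ∑ v ∈ F l, e l j v • ∏ i, T.X K i ^ v i = a ^ N • G' := by
    refine exists_eq_smul_of_dvd (pow_ne_zero N ha) fun v => ?_
    obtain ⟨y, hy⟩ := hd (MvPowerSeries.coeff v (PowerSeries.coeff j G : T K P.n).1) N
    refine ⟨y, ?_⟩
    rw [AddSubgroupClass.coe_sub, map_sub, sub_eq_iff_eq_add']
    refine hy.trans (congrArg (· + a ^ N * y) ?_)
    simp only [AddSubmonoidClass.coe_finsetSum, Subalgebra.coe_smul, coe_prod_X_pow, map_sum,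
      MvPowerSeries.coeff_smul, MvPowerSeries.coeff_monomial]
    refine Finset.sum_congr rfl fun l _ => ?_
    congr 1
    simp only [mul_ite, mul_one, mul_zero]
    rw [Finset.sum_ite_eq]
    split_ifs with hv
    · rfl
    · refine he0 l j v ?_
      rw [hF, not_le] at hv
      omega
  have hmono : ∀ l, ρ (P.φ (∑ v ∈ F l, e l j v • ∏ i, T.X K i ^ v i)) = Q.φ (q l j) := by
    intro l
    simp only [q, map_sum, map_mul, map_prod, map_pow, Algebra.smul_def, hβ, hl, AlgHom.commutes]
  rw [sub_eq_iff_eq_add] at hG'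
  have e1 : ρ (P.φ (PowerSeries.coeff j G)) = algebraMap (RInt K) B (a ^ N) * ρ (P.φ G') +
      ∑ l ∈ Finset.range N, algebraMap (RInt K) B (a ^ l) * Q.φ (q l j) := by
    rw [hG']
    simp only [map_add, map_sum, Algebra.smul_def (a ^ _), map_mul, AlgHom.commutes, ← hmono]
    simp only [map_pow, hρ]
  have e2 : Q.φ (PowerSeries.coeff j H) = algebraMap (RInt K) B (a ^ N) * Q.φ H' +
      ∑ l ∈ Finset.range N, algebraMap (RInt K) B (a ^ l) * Q.φ (q l j) := by
    rw [hH']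
    simp only [PowerSeries.coeff_mk, map_add, map_sum, Algebra.smul_def, map_mul,
      AlgHom.commutes]
    ring
  refine ⟨Q.φ H' - ρ (P.φ G'), ?_⟩
  change Q.φ (PowerSeries.coeff j H) - ρ (P.φ (PowerSeries.coeff j G)) = _
  rw [e1, e2]
  ring

end Presentation

namespace Presentation

variable {A B : Type u} [CommRing A] [CommRing B] [Algebra (RInt K) A] [Algebra (RInt K) B]
  {P : Presentation K A} {Q : Presentation K B}

/-! ### Units in the local rings -/

/-- The germ of `a` is a unit exactly on `X_ā`. -/
theorem isUnit_stalkC_iff {a : A} {q : P.Pt} : IsUnit (P.stalkC q a) ↔ q ∈ P.basic a := by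
  refine ⟨fun hu => by_contra fun ha => ?_, fun h => ?_⟩
  · obtain ⟨s, hs⟩ := isUnit_iff_exists_inv.1 hu
    obtain ⟨f, hf, x, rfl⟩ := P.exists_germ q s
    obtain ⟨c, hc0, hc1⟩ := exists_small (K := K)
    obtain ⟨N, b, y, e⟩ := P.decomp hc0 x
    have hb : q ∈ P.basic (f ^ N - a * b) := by
      intro hm
      have ha' : red K a ∈ q.asIdeal := by_contra ha
      rw [map_sub, map_pow, map_mul] at hm
      exact hf (q.isPrime.mem_of_pow_mem N
        ((Submodule.sub_mem_iff_left _ (Ideal.mul_mem_right _ _ ha')).1 hm))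
    have h1 := P.isUnit_germ hc1 hf hb (-(P.proj f (P.C a) * y))
    have h2 : P.germ f q hf (P.proj f (P.C (f ^ N - a * b)) +
        P.proj f (P.C (algebraMap (RInt K) A c)) * -(P.proj f (P.C a) * y)) = 0 := by
      rw [← P.germ_proj_C f a q hf, ← map_mul] at hs
      have h3 : P.proj f (P.C (f ^ N - a * b)) +
          P.proj f (P.C (algebraMap (RInt K) A c)) * -(P.proj f (P.C a) * y) =
          P.proj f (P.C f) ^ N * (1 - P.proj f (P.C a) * x) := by
        rw [map_sub, map_sub, map_pow, map_pow, map_mul, map_mul]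
        linear_combination P.proj f (P.C a) * e
      rw [h3, map_mul, map_sub, hs, map_one, sub_self, mul_zero]
    rw [h2] at h1
    exact not_isUnit_zero h1
  · rw [← P.germ_proj_C a a q h]
    exact (P.isUnit_proj_C a).map _

/-- Whether the germ of an element is a unit is seen on its expansion modulo a non-unit scalar. -/
theorem isUnit_germ_iff {c : RInt K} (hc : ‖(c : K)‖ < 1) {f a : A} {q : P.Pt} (hf : q ∈ P.basic f)
    {x y : P.Loc f} {N : ℕ} (e : P.proj f (P.C f) ^ N * x =
      P.proj f (P.C a) + P.proj f (P.C (algebraMap (RInt K) A c)) * y) :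
    IsUnit (P.germ f q hf x) ↔ q ∈ P.basic a := by
  have e' := congrArg (P.germ f q hf) e
  rw [map_mul, map_pow, map_add, map_mul, germ_proj_C, germ_proj_C, germ_proj_C] at e'
  have hfu : IsUnit (P.stalkC q f ^ N) := (isUnit_stalkC_iff.2 hf).pow N
  have hcu : ¬ IsUnit (P.stalkC q (algebraMap (RInt K) A c)) := by
    rw [isUnit_stalkC_iff]
    intro h
    exact h (by rw [red_algebraMap hc]; exact zero_mem _)
  rw [← isUnit_stalkC_iff]
  constructor
  · intro hx
    have hu := hfu.mul hx
    rw [e'] at hu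
    exact (IsLocalRing.isUnit_or_isUnit_of_isUnit_add hu).resolve_right
      fun h => hcu (isUnit_of_mul_isUnit_left h)
  · intro ha
    have h := P.isUnit_germ hc hf (isUnit_stalkC_iff.1 ha) y
    rw [← e, map_mul] at h
    exact isUnit_of_mul_isUnit_right h

/-! ### The maps on localizations and local rings -/

variable {ρ : A →+* B} (hO : ∀ g ∈ P.Over, PowerSeries.map ρ g ∈ Q.Over)

/-- The coefficientwise map `A⟨ξ⟩† → B⟨ξ⟩†`. -/
def overMap : P.Over →+* Q.Over :=
  ((PowerSeries.map ρ).comp P.Over.subtype).codRestrict Q.Over fun g => hO g.1 g.2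

theorem overMap_C (a : A) : overMap hO (P.C a) = Q.C (ρ a) := by
  ext1
  exact PowerSeries.map_C ρ a

theorem overMap_X : overMap hO P.X = Q.X := by
  ext1
  exact PowerSeries.map_X ρ

theorem overMap_scale (c : A) (g : P.Over) :
    overMap hO (P.scale c g) = Q.scale (ρ c) (overMap hO g) := by
  ext1
  change PowerSeries.map ρ (PowerSeries.rescale c g.1) =
    PowerSeries.rescale (ρ c) (PowerSeries.map ρ g.1)
  ext j
  simp [PowerSeries.coeff_rescale]

/-- The map `A⟨f⁻¹⟩† → B⟨ρ(f)⁻¹⟩†`, `∑_j a_j f^{-j} ↦ ∑_j ρ(a_j) ρ(f)^{-j}`. -/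
def locMap (f : A) : P.Loc f →+* Q.Loc (ρ f) :=
  Ideal.Quotient.lift _ ((Q.proj (ρ f)).comp (overMap hO)) fun a ha => by
    rw [← RingHom.mem_ker]
    revert a
    change Ideal.span {P.C f * P.X - 1} ≤ _
    rw [Ideal.span_singleton_le_iff_mem, RingHom.mem_ker, map_sub, map_one, RingHom.comp_apply,
      map_mul, overMap_C, overMap_X, map_mul, proj_C_mul_X, sub_self]

theorem locMap_proj (f : A) (g : P.Over) :
    locMap hO f (P.proj f g) = Q.proj (ρ f) (overMap hO g) := rfl

theorem locMap_proj_C (f a : A) :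
    locMap hO f (P.proj f (P.C a)) = Q.proj (ρ f) (Q.C (ρ a)) := by
  rw [locMap_proj, overMap_C]

theorem locMap_trans {f g : A} (c : A) (h : g = f * c) (x : P.Loc f) :
    locMap hO g (P.trans c h x) = Q.trans (ρ c) (by rw [h, map_mul]) (locMap hO f x) := by
  obtain ⟨x, rfl⟩ := Ideal.Quotient.mk_surjective x
  change Q.proj (ρ g) (overMap hO (P.scale c x)) = Q.proj (ρ g) (Q.scale (ρ c) (overMap hO x))
  rw [overMap_scale]

/-- The map `O†_p → O†_q` induced by `ρ`, for `p = ρ̄⁻¹(q)`. -/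
def localRingMap (p : P.Pt) (q : Q.Pt) (h : ∀ f, p ∈ P.basic f ↔ q ∈ Q.basic (ρ f)) :
    P.Stalk p →+* Q.Stalk q :=
  DirectLimit.Ring.lift (fun f : P.Index p => P.Loc f.1) (P.tr p) (Q.Stalk q)
    (fun f => (Q.germ (ρ f.1) q ((h f.1).1 f.2)).comp (locMap hO f.1)) <| by
    rintro f g ⟨c, hc⟩ x
    rw [P.tr_eq p f g _ c hc, RingHom.comp_apply, locMap_trans,
      Q.germ_trans (ρ c) _ q ((h f.1).1 f.2)]
    rfl

theorem localRingMap_germ (p : P.Pt) (q : Q.Pt) (h : ∀ f, p ∈ P.basic f ↔ q ∈ Q.basic (ρ f))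
    (f : A) (hf : p ∈ P.basic f) (x : P.Loc f) :
    localRingMap hO p q h (P.germ f p hf x) = Q.germ (ρ f) q ((h f).1 hf) (locMap hO f x) := rfl

theorem isLocalHom_localRingMap (p : P.Pt) (q : Q.Pt)
    (h : ∀ f, p ∈ P.basic f ↔ q ∈ Q.basic (ρ f))
    (hρ : ∀ c, ρ (algebraMap (RInt K) A c) = algebraMap (RInt K) B c) :
    IsLocalHom (localRingMap hO p q h) := by
  constructor
  intro s hs
  obtain ⟨f, hf, x, rfl⟩ := P.exists_germ p s
  rw [localRingMap_germ] at hs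
  obtain ⟨c, hc0, hc1⟩ := exists_small (K := K)
  obtain ⟨N, a, y, e⟩ := P.decomp hc0 x
  have e' := congrArg (locMap hO f) e
  rw [map_mul, map_pow, map_add, map_mul, locMap_proj_C, locMap_proj_C, locMap_proj_C, hρ] at e'
  rw [isUnit_germ_iff hc1 hf e, h, ← isUnit_germ_iff hc1 _ e']
  exact hs

/-- The map `q ↦ ρ̄⁻¹(q)` of prime spectra given by a homomorphism of `R`-algebras. -/
def pointMap (ρ : A →ₐ[RInt K] B) : Q.Pt ⟶ P.Pt :=
  TopCat.ofHom ⟨PrimeSpectrum.comap (Algebra.TensorProduct.map ρ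
    (AlgHom.id (RInt K) (IsLocalRing.ResidueField (RInt K)))).toRingHom, by fun_prop⟩

theorem pointMap_mem_basic (ρ : A →ₐ[RInt K] B) (q : Q.Pt) (f : A) :
    (pointMap ρ : Q.Pt ⟶ P.Pt) q ∈ P.basic f ↔ q ∈ Q.basic (ρ f) := by
  have : (Algebra.TensorProduct.map ρ (AlgHom.id (RInt K) (IsLocalRing.ResidueField (RInt K))))
      (red K f) = red K (ρ f) := Algebra.TensorProduct.map_tmul ..
  change (Algebra.TensorProduct.map ρ (AlgHom.id (RInt K) (IsLocalRing.ResidueField (RInt K))))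
      (red K f) ∉ q.asIdeal ↔ red K (ρ f) ∉ q.asIdeal
  rw [this]

/-- The basic open sets separate points. -/
theorem point_ext {p p' : P.Pt} (h : ∀ f, p ∈ P.basic f ↔ p' ∈ P.basic f) : p = p' := by
  refine PrimeSpectrum.ext (Ideal.ext fun x => ?_)
  obtain ⟨f, rfl⟩ := red_surjective K x
  exact not_iff_not.1 (h f)

open AlgebraicGeometry CategoryTheory Opposite

/-! ### The morphism given by a homomorphism of algebras -/

theorem eval_map {U V : Opens P.Pt} (i : V ⟶ U) (p : P.Pt) (h : p ∈ V)
    (s : P.presheaf.obj (op U)) :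
    P.eval V p h (P.presheaf.map i.op s) = P.eval U p (i.le h) s := rfl

theorem eval_toSection (f : A) (p : P.Pt) (h : p ∈ P.basic f) (x : P.Loc f) :
    P.eval _ p h (P.toSection f x) = P.germ f p h x := rfl

theorem section_ext {U : Opens P.Pt} {s t : P.presheaf.obj (op U)}
    (h : ∀ p hp, P.eval U p hp s = P.eval U p hp t) : s = t :=
  Subtype.ext (funext fun p => h p.1 p.2)

/-- Near a point, a section comes from some `A⟨f⁻¹⟩†`. -/
theorem exists_res_eq_toSection {U : Opens P.Pt} (s : P.presheaf.obj (op U)) (p : P.Pt)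
    (hp : p ∈ U) : ∃ (f : A) (_ : p ∈ P.basic f) (i : P.basic f ⟶ U) (x : P.Loc f),
      P.presheaf.map i.op s = P.toSection f x := by
  obtain ⟨f, hf, x, hx⟩ := s.2 ⟨p, hp⟩
  obtain ⟨_, ⟨_, ⟨g, rfl⟩, rfl⟩, hpg, hgU⟩ :=
    PrimeSpectrum.isBasis_basic_opens.exists_subset_of_mem_open hp U.2
  obtain ⟨g, rfl⟩ := red_surjective K g
  refine ⟨f * g, P.mem_basic_mul.2 ⟨hf, hpg⟩,
    homOfLE fun q hq => hgU (P.mem_basic_mul.1 hq).2, P.trans g rfl x,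
    section_ext fun q hq => ?_⟩
  rw [eval_map, eval_toSection, P.germ_trans g rfl q (P.mem_basic_mul.1 hq).1]
  exact hx ⟨q, hgU (P.mem_basic_mul.1 hq).2⟩ (P.mem_basic_mul.1 hq).1

section

variable (ρ : A →ₐ[RInt K] B)
  (hO : ∀ g ∈ P.Over, PowerSeries.map (ρ : A →+* B) g ∈ Q.Over)

/-- The pullback of sections. -/
def sectionMap (U : Opens P.Pt) :
    P.sections U →+* Q.sections ((Opens.map (pointMap ρ : Q.Pt ⟶ P.Pt)).obj U) :=
  ((RingHom.pi fun q : (Opens.map (pointMap ρ : Q.Pt ⟶ P.Pt)).obj U =>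
    (localRingMap hO (pointMap ρ q.1) q.1 (pointMap_mem_basic ρ q.1)).comp
      (Pi.evalRingHom (fun p : U => P.Stalk p.1) ⟨pointMap ρ q.1, q.2⟩)).comp
    (P.sections U).subtype).codRestrict _ fun s q => by
      obtain ⟨f, hf, x, hx⟩ := s.2 ⟨pointMap ρ q.1, q.2⟩
      refine ⟨ρ f, (pointMap_mem_basic ρ q.1 f).1 hf, locMap hO f x, fun q' hq' => ?_⟩
      have hf' := (pointMap_mem_basic (P := P) ρ q'.1 f).2 hq'
      exact congrArg (localRingMap hO _ q'.1 (pointMap_mem_basic ρ q'.1))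
        (hx ⟨pointMap ρ q'.1, q'.2⟩ hf')

/-- The morphism of presheafed spaces given by `ρ`. -/
def presheafedSpaceHom : Q.Spf.toPresheafedSpace ⟶ P.Spf.toPresheafedSpace where
  base := pointMap ρ
  c := { app := fun U => CommRingCat.ofHom (sectionMap ρ hO U.unop)
         naturality := fun _ _ _ => rfl }

theorem eval_presheafedSpaceHom (U : Opens P.Pt) (s : P.presheaf.obj (op U)) (q : Q.Pt)
    (hq : pointMap ρ q ∈ U) :
    Q.eval ((Opens.map (pointMap ρ)).obj U) q hq ((presheafedSpaceHom ρ hO).c.app (op U) s) =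
      localRingMap hO (pointMap ρ q) q (pointMap_mem_basic ρ q) (P.eval U (pointMap ρ q) hq s) :=
  rfl

/-- The stalk maps of a morphism are compatible with its values at points. -/
theorem stalkEval_stalkMap (F : Q.Spf.toPresheafedSpace ⟶ P.Spf.toPresheafedSpace) (U : Opens P.Pt) (q : Q.Pt)
    (hq : F.base q ∈ U) (s : P.presheaf.obj (op U)) :
    Q.stalkEval q ((F.stalkMap q) (P.presheaf.germ U (F.base q) hq s)) =
      Q.eval ((Opens.map F.base).obj U) q hq (F.c.app (op U) s) := by
  refine Eq.trans (congrArg (Q.stalkEval q) ?_)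
    (Q.stalkEval_germ q ((Opens.map F.base).obj U) hq (F.c.app (op U) s))
  exact congrArg (fun φ => CommRingCat.Hom.hom φ s) (PresheafedSpace.stalkMap_germ F U q hq)

/-- The values of a morphism on sections are compatible with restriction. -/
theorem eval_app_res (F : Q.Spf.toPresheafedSpace ⟶ P.Spf.toPresheafedSpace) {U V : Opens P.Pt}
    (i : V ⟶ U) (q : Q.Pt) (hq : F.base q ∈ V) (s : P.presheaf.obj (op U)) :
    Q.eval ((Opens.map F.base).obj V) q hq (F.c.app (op V) (P.presheaf.map i.op s)) =
      Q.eval ((Opens.map F.base).obj U) q (i.le hq) (F.c.app (op U) s) :=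
  congrArg (fun φ => Q.eval ((Opens.map F.base).obj V) q hq (CommRingCat.Hom.hom φ s))
    (F.c.naturality i.op)

/-- The morphism `Spf†(B) → Spf†(A)` given by a homomorphism of `R`-algebras. -/
def spfMap : Q.Spf ⟶ P.Spf where
  toHom := presheafedSpaceHom ρ hO
  prop := fun (q : Q.Pt) => by
    constructor
    intro t ht
    obtain ⟨U, hU, s, rfl⟩ := TopCat.Presheaf.exists_germ_eq (F := P.presheaf) t
    have h1 : IsUnit (localRingMap hO (pointMap ρ q) q (pointMap_mem_basic ρ q)
        (P.eval U (pointMap ρ q) hU s)) := by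
      rw [← show _ = localRingMap hO (pointMap ρ q) q (pointMap_mem_basic ρ q)
          (P.eval U (pointMap ρ q) hU s) from
        (stalkEval_stalkMap (presheafedSpaceHom ρ hO) U q hU s).trans
          (eval_presheafedSpaceHom ρ hO U s q hU)]
      exact ht.map (Q.stalkEval q)
    have := isLocalHom_localRingMap hO (pointMap ρ q) q (pointMap_mem_basic ρ q)
      (fun c => ρ.commutes c)
    refine isUnit_of_map_unit (P.stalkEval (pointMap ρ q)) _ ?_
    exact (P.stalkEval_germ (pointMap ρ q) U hU s).symm ▸ isUnit_of_map_unit _ _ h1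

theorem isInducedBy_spfMap : IsInducedBy (spfMap ρ hO) (ρ : A →+* B) where
  base q f := pointMap_mem_basic ρ q f
  sections _ g := ⟨overMap hO g, rfl, fun _ _ => rfl⟩

end

/-- A morphism induced by `ρ` is determined by `ρ`. -/
theorem IsInducedBy.unique {F G : Q.Spf ⟶ P.Spf} {ρ : A →+* B} (hF : IsInducedBy F ρ)
    (hG : IsInducedBy G ρ) : F = G := by
  have hb : F.base = G.base := by
    ext q : 1
    exact point_ext fun f => (hF.base q f).trans (hG.base q f).symm
  obtain ⟨⟨b, c⟩, hloc⟩ := F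
  obtain ⟨⟨b', c'⟩, hloc'⟩ := G
  change b = b' at hb
  subst hb
  have hc : c = c' := by
    refine NatTrans.ext (funext fun U => ?_)
    refine CommRingCat.hom_ext (RingHom.ext fun s => ?_)
    refine section_ext fun q hq => ?_
    obtain ⟨f, hf, i, x, hx⟩ := exists_res_eq_toSection (U := U.unop) s (b q) hq
    obtain ⟨g, rfl⟩ := Ideal.Quotient.mk_surjective x
    obtain ⟨h, hh, h1⟩ := hF.sections f g
    obtain ⟨h', hh', h2⟩ := hG.sections f g
    obtain rfl : h = h' := Subtype.ext (hh.trans hh'.symm)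
    have e1 := eval_app_res (P := P) (Q := Q) ⟨b, c⟩ i q hf s
    have e2 := eval_app_res (P := P) (Q := Q) ⟨b, c'⟩ i q hf s
    rw [hx] at e1 e2
    exact e1.symm.trans ((h1 q hf).trans ((h2 q hf).symm.trans e2))
  subst hc
  rfl

/-! ### The homomorphism given by a morphism -/

/-- For a morphism `(φ, φ♯)`, the ring homomorphism sending `a ∈ A` to the germ of `φ♯(a)` at a
point `q`. -/
def germMap (F : Q.Spf ⟶ P.Spf) (q : Q.Pt) : A →+* Q.Stalk q :=
  (Q.eval ((Opens.map F.base).obj (P.basic 1)) q (P.mem_basic_one _)).comp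
    ((F.c.app (op (P.basic 1))).hom.comp ((P.toSection 1).comp ((P.proj 1).comp P.C)))

theorem eval_app_toSection_C (F : Q.Spf ⟶ P.Spf) (f a : A) (q : Q.Pt)
    (hq : F.base q ∈ P.basic f) :
    Q.eval ((Opens.map F.base).obj (P.basic f)) q hq
      (F.c.app (op (P.basic f)) (P.toSection f (P.proj f (P.C a)))) = germMap F q a := by
  have i : P.basic f ⟶ P.basic 1 := homOfLE fun p _ => P.mem_basic_one p
  have h : P.presheaf.map i.op (P.toSection 1 (P.proj 1 (P.C a))) =
      P.toSection f (P.proj f (P.C a)) := by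
    refine section_ext fun p hp => ?_
    rw [eval_map, eval_toSection, eval_toSection, germ_proj_C, germ_proj_C]
  rw [← h]
  exact eval_app_res F.toHom i q hq _

theorem isUnit_stalkEval_iff (p : P.Pt) (t : P.presheaf.stalk p) :
    IsUnit (P.stalkEval p t) ↔ IsUnit t :=
  isUnit_map_iff _ _

/-- Since the stalk maps are local, the points where the germ of `φ♯(a)` is a unit are those mapped
to `X_ā`. -/
theorem isUnit_germMap_iff (F : Q.Spf ⟶ P.Spf) (q : Q.Pt) (a : A) :
    IsUnit (germMap F q a) ↔ F.base q ∈ P.basic a := by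
  refine Iff.trans ?_ (isUnit_stalkC_iff (P := P) (q := F.base q))
  let s : P.presheaf.obj (op (P.basic 1)) := P.toSection 1 (P.proj 1 (P.C a))
  let t : P.presheaf.stalk (F.base q) :=
    P.presheaf.germ (P.basic 1) (F.base q) (P.mem_basic_one _) s
  have h1 : germMap F q a = Q.stalkEval q ((F.toHom.stalkMap q) t) :=
    (stalkEval_stalkMap F.toHom (P.basic 1) q (P.mem_basic_one _) s).symm
  have h2 : P.stalkC (F.base q) a = P.stalkEval (F.base q) t :=
    (P.stalkEval_germ (F.base q) (P.basic 1) (P.mem_basic_one _) s).symm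
  rw [h1, h2]
  have h3 : IsUnit ((F.toHom.stalkMap q).hom t) ↔ IsUnit t :=
    ⟨fun h => (F.prop q).map_nonunit t h, fun h => h.map _⟩
  exact (isUnit_stalkEval_iff q ((F.toHom.stalkMap q).hom t)).trans
    (h3.trans (isUnit_stalkEval_iff (P := P) (F.base q) t).symm)

theorem IsInducedBy.germMap_eq {F : Q.Spf ⟶ P.Spf} {ρ : A →+* B} (hF : IsInducedBy F ρ) (q : Q.Pt)
    (a : A) : germMap F q a = Q.stalkC q (ρ a) := by
  obtain ⟨h, hh, e⟩ := hF.sections 1 (P.C a)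
  obtain rfl : h = Q.C (ρ a) := Subtype.ext (hh.trans (PowerSeries.map_C ρ a))
  exact (e q (P.mem_basic_one _)).trans (Q.germ_proj_C _ _ _ _)

/-- A global section of `O†_B` is an element of `B`, so the germs of `φ♯(a)` are those of some
`ρ(a) ∈ B`. -/
theorem exists_ringHom_germMap_eq [CompleteSpace K] {ϖ : RInt K} (hϖ : IsUniformizer ϖ)
    (F : Q.Spf ⟶ P.Spf) : ∃ ρ : A →+* B, ∀ q a, germMap F q a = Q.stalkC q (ρ a) := by
  have h : ∀ a, ∃ b, ∀ q, germMap F q a = Q.stalkC q b := by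
    intro a
    refine Q.exists_global hϖ (fun q => germMap F q a) fun q => ?_
    obtain ⟨f, hf, i, x, hx⟩ := exists_res_eq_toSection
      (U := (Opens.map F.base).obj (P.basic 1))
      (F.c.app (op (P.basic 1)) (P.toSection 1 (P.proj 1 (P.C a)))) q (P.mem_basic_one _)
    exact ⟨f, hf, x, fun q' hq' => congrArg (Q.eval _ q' hq') hx⟩
  choose ρ hρ using h
  have ext : ∀ {b b' : B}, (∀ q, Q.stalkC q b = Q.stalkC q b') → b = b' := Q.eq_of_stalkC_eq hϖ
  refine ⟨{ toFun := ρ, map_one' := ?_, map_mul' := ?_, map_zero' := ?_, map_add' := ?_ },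
    fun q a => hρ a q⟩
  · exact ext fun q => by rw [← hρ, map_one, map_one]
  · exact fun a b => ext fun q => by rw [← hρ, map_mul, map_mul, hρ, hρ]
  · exact ext fun q => by rw [← hρ, map_zero, map_zero]
  · exact fun a b => ext fun q => by rw [← hρ, map_add, map_add, hρ, hρ]

/-- The morphism is induced by the homomorphism read off from global sections. On `A⟨f⁻¹⟩†` this is
clear modulo `p^N`, where the elements become fractions with denominator a power of `f`, and it
follows for all elements because sections divisible by every `p^N` vanish. -/
theorem isInducedBy_of_germMap_eq [CompleteSpace K] {ϖ : RInt K} (hϖ : IsUniformizer ϖ) {m : ℕ}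
    (hm0 : (m : RInt K) ≠ 0) (hm1 : ‖((m : RInt K) : K)‖ < 1) {F : Q.Spf ⟶ P.Spf} {ρ : A →+* B}
    (hρ : ∀ q a, germMap F q a = Q.stalkC q (ρ a))
    (hO : ∀ g ∈ P.Over, PowerSeries.map ρ g ∈ Q.Over) : IsInducedBy F ρ := by
  have base : ∀ (q : Q.Pt) (f : A), F.base q ∈ P.basic f ↔ q ∈ Q.basic (ρ f) := fun q f => by
    rw [← isUnit_germMap_iff, hρ, isUnit_stalkC_iff]
  refine ⟨base, fun f g => ⟨overMap hO g, rfl, fun q hq => ?_⟩⟩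
  let U : Opens Q.Pt := (Opens.map F.base).obj (P.basic f)
  let j : U ⟶ Q.basic (ρ f) := homOfLE fun q hq => (base q f).1 hq
  let Φ : P.Loc f →+* Q.presheaf.obj (op U) :=
    (F.c.app (op (P.basic f))).hom.comp (P.toSection f)
  let Ψ : P.Loc f →+* Q.presheaf.obj (op U) :=
    (Q.presheaf.map j.op).hom.comp ((Q.toSection (ρ f)).comp (locMap hO f))
  have hΦ : ∀ q hq a, Q.eval U q hq (Φ (P.proj f (P.C a))) = Q.stalkC q (ρ a) := fun q hq a =>
    (eval_app_toSection_C F f a q hq).trans (hρ q a)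
  have hΨ : ∀ q hq a, Q.eval U q hq (Ψ (P.proj f (P.C a))) = Q.stalkC q (ρ a) := by
    intro q hq a
    rw [← Q.germ_proj_C (ρ f) (ρ a) q ((base q f).1 hq), ← locMap_proj_C hO]
    rfl
  have hdvd : ∀ (N : ℕ) q hq, Q.stalkC q (algebraMap (RInt K) B (ϖ ^ N)) ∣
      Q.eval U q hq (Φ (P.proj f g) - Ψ (P.proj f g)) := by
    intro N q hq
    obtain ⟨M, a, y, e⟩ := P.decomp (pow_ne_zero N hm0) (P.proj f g)
    have hu : IsUnit (Q.stalkC q (ρ f) ^ M) := (isUnit_stalkC_iff.2 ((base q f).1 hq)).pow M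
    have e1 := congrArg (fun x => Q.eval U q hq (Φ x)) e
    have e2 := congrArg (fun x => Q.eval U q hq (Ψ x)) e
    simp only [map_mul, map_pow, map_add, hΦ] at e1
    simp only [map_mul, map_pow, map_add, hΨ] at e2
    -- a natural number is preserved by `ρ`, whether or not `ρ` is linear
    have hd : Q.stalkC q (algebraMap (RInt K) B (ϖ ^ N)) ∣
        Q.stalkC q (ρ (algebraMap (RInt K) A (m : RInt K))) ^ N := by
      rw [map_natCast, map_natCast, ← map_natCast (algebraMap (RInt K) B), ← map_pow, ← map_pow]
      exact map_dvd _ (map_dvd _ (pow_dvd_pow_of_dvd (hϖ.dvd _ hm1) N))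
    refine hu.dvd_mul_left.1 (hd.trans ⟨Q.eval U q hq (Φ y) - Q.eval U q hq (Ψ y), ?_⟩)
    rw [map_sub]
    linear_combination e1 - e2
  -- near `q` the difference comes from some `B⟨k⁻¹⟩†`, which is separated
  have hzero : Q.eval U q hq (Φ (P.proj f g) - Ψ (P.proj f g)) = 0 := by
    obtain ⟨k, hk, i, y, hy⟩ := exists_res_eq_toSection (Φ (P.proj f g) - Ψ (P.proj f g)) q hq
    have hy' : ∀ q' (hq' : q' ∈ Q.basic k),
        Q.eval U q' (i.le hq') (Φ (P.proj f g) - Ψ (P.proj f g)) = Q.germ k q' hq' y :=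
      fun q' hq' => congrArg (Q.eval _ q' hq') hy
    have : y = 0 := Q.loc_eq_zero_of_germ_dvd hϖ fun N q' hq' => by
      rw [← hy', locConst_apply, germ_proj_C]
      exact hdvd N q' _
    exact (hy' q hk).trans (by rw [this, map_zero])
  rw [map_sub, sub_eq_zero] at hzero
  exact hzero

theorem isOverBase_iff (F : Q.Spf ⟶ P.Spf) : IsOverBase F ↔ ∀ (c : RInt K) (q : Q.Pt),
    germMap F q (algebraMap (RInt K) A c) = Q.stalkC q (algebraMap (RInt K) B c) := by
  have h : ∀ (c : RInt K) (q : Q.Pt), Q.eval ((Opens.map F.base).obj (⊤ : Opens P.Pt)) q trivial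
      (F.c.app (op (⊤ : Opens P.Pt)) (P.const ⊤ c)) = germMap F q (algebraMap (RInt K) A c) :=
    fun c q => eval_app_res F.toHom (homOfLE fun p _ => P.mem_basic_one p : ⊤ ⟶ P.basic 1) q
      trivial (P.toSection 1 (P.proj 1 (P.C (algebraMap (RInt K) A c))))
  constructor
  · intro hF c q
    rw [← h, hF c]
    rfl
  · intro hF c
    exact section_ext (P := Q) fun q hq => (h c q).trans (hF c q)

end Presentation

end

end Dagger

theorem proposition12 (p : ℕ) [Fact p.Prime] (K : Type u) [NontriviallyNormedField K]
    [IsUltrametricDist K] [NormedAlgebra ℚ_[p] K] [FiniteDimensional ℚ_[p] K]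
    (A B : Type u) [CommRing A] [CommRing B]
    [Algebra (Dagger.RInt K) A] [Algebra (Dagger.RInt K) B]
    (P : Dagger.Presentation K A) (Q : Dagger.Presentation K B) :
    (∀ ρ : A →ₐ[Dagger.RInt K] B, ∃! F : Q.Spf ⟶ P.Spf,
      Dagger.Presentation.IsInducedBy F (ρ : A →+* B)) ∧
    (∀ F : Q.Spf ⟶ P.Spf, ∃! ρ : A →+* B, Dagger.Presentation.IsInducedBy F ρ) ∧
    (∀ F : Q.Spf ⟶ P.Spf, Dagger.Presentation.IsOverBase F ↔
      ∃ ρ : A →ₐ[Dagger.RInt K] B, Dagger.Presentation.IsInducedBy F (ρ : A →+* B)) := by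
  have : ProperSpace K := FiniteDimensional.proper ℚ_[p] K
  obtain ⟨ϖ, hϖ⟩ := Dagger.exists_isUniformizer (K := K)
  have hp : ‖(((p : ℕ) : Dagger.RInt K) : K)‖ = (p : ℝ)⁻¹ := by
    have h : (((p : ℕ) : Dagger.RInt K) : K) = algebraMap ℚ_[p] K p := by
      rw [map_natCast]
      rfl
    rw [h, norm_algebraMap', Padic.norm_p]
  have hp1 : ‖(((p : ℕ) : Dagger.RInt K) : K)‖ < 1 := by
    rw [hp]
    exact inv_lt_one_of_one_lt₀ (by exact_mod_cast (Fact.out : p.Prime).one_lt)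
  have hp0 : ((p : ℕ) : Dagger.RInt K) ≠ 0 := by
    intro h
    rw [h] at hp
    have : (0 : ℝ) < (p : ℝ)⁻¹ := inv_pos.2 (by exact_mod_cast (Fact.out : p.Prime).pos)
    simp only [ZeroMemClass.coe_zero, norm_zero] at hp
    linarith
  obtain ⟨S, hS⟩ := Dagger.exists_finite_residues hp0
  have hO : ∀ (ρ : A →+* B), ∀ g ∈ P.Over, PowerSeries.map ρ g ∈ Q.Over := fun ρ g hg =>
    Dagger.Presentation.map_mem_over hϖ P Q ρ hp0 hp1 (by simp only [map_natCast]) hS hg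
  have hex : ∀ F : Q.Spf ⟶ P.Spf, ∃! ρ : A →+* B, Dagger.Presentation.IsInducedBy F ρ := by
    intro F
    obtain ⟨ρ, hρ⟩ := Dagger.Presentation.exists_ringHom_germMap_eq hϖ F
    refine ⟨ρ, Dagger.Presentation.isInducedBy_of_germMap_eq hϖ hp0 hp1 hρ (hO ρ),
      fun ρ' hρ' => RingHom.ext fun a => Q.eq_of_stalkC_eq hϖ fun q => ?_⟩
    rw [← hρ, hρ'.germMap_eq]
  refine ⟨fun ρ => ⟨Dagger.Presentation.spfMap ρ (hO ρ),
    Dagger.Presentation.isInducedBy_spfMap ρ (hO ρ), fun F hF =>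
      hF.unique (Dagger.Presentation.isInducedBy_spfMap ρ (hO ρ))⟩, hex, fun F => ?_⟩
  rw [Dagger.Presentation.isOverBase_iff]
  constructor
  · intro hF
    obtain ⟨ρ, hρ, -⟩ := hex F
    refine ⟨{ ρ with commutes' := fun c => Q.eq_of_stalkC_eq hϖ fun q => ?_ }, hρ⟩
    exact (hρ.germMap_eq q _).symm.trans (hF c q)
  · rintro ⟨ρ, hρ⟩ c q
    rw [hρ.germMap_eq, RingHom.coe_coe, ρ.commutes]
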